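/- Let $K$ be a field complete with respect to a non-trivial nonarchimedean absolute value. A seminorm $q$ on a $K$-algebra $A$ is an algebra seminorm if it is nonarchimedean and $q(ab)\le c\,q(a)q(b)$ for some constant $c>0$; let $A_q$ denote the Hausdorff completion of $A$ with respect to $q$. Let $A$ be a two-sided $K$-Fréchet–Stein algebra, given by a sequence $q_0\le q_1\le\dots$: that is, $A$ is a Hausdorff complete topological $K$-algebra whose topology is defined by the increasing sequence of algebra seminorms $(q_n)_{n\ge 0}$, such that each $A_{q_n}$ is left and right noetherian and is flat both as a left and as a right $A_{q_{n+1}}$-module. For a ring $R$ and a left or right $R$-module $N$, let $j_R(N)=\min\{l\ge 0:\mathrm{Ext}^l_R(N,R)\neq 0\}\in\mathbb N\cup\{\infty\}$ (with $\min\emptyset=\infty$) be the grade of $N$; here $\mathrm{Ext}^l_R(N,R)$ is regarded as a module on the other side through the second argument $R$. The module $N$ is pure if $\mathrm{Ext}^l_R(\mathrm{Ext}^l_R(N,R),R)=0$ for all $l\ne j_R(N)$. A left and right noetherian ring $R$ is Auslander regular if every finitely generated left or right $R$-module $N$ has finite projective dimension and satisfies $j_R(L)\ge l$ for all $l\ge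 0$ and all submodules $L\subseteq\mathrm{Ext}^l_R(N,R)$. For a finitely generated module $N$ over an Auslander regular ring $R$, let $\Delta^l(N)$ be the largest submodule of $N$ of grade $\geq l$ (the sum of all submodules of grade $\ge l$). Assume (DIM): there is an integer $d\ge 0$ such that each $A_{q_n}$ is Auslander regular of global dimension $\le d$. A left $A$-module $M$ is coadmissible if it is isomorphic to $\varprojlim_n M_n$ for finitely generated left $A_{q_n}$-modules $M_n$ together with isomorphisms $A_{q_n}\otimes_{A_{q_{n+1}}}M_{n+1}\cong M_n$ of $A_{q_n}$-modules. For such $M$ and $l\ge 0$, let $\Delta^l(M)$ be the set of all $m\in M$ with $1\otimes m\in\Delta^l(A_{q_n}\otimes_A M)$ for every $n$. Let $M$ be a coadmissible $A$-module. Then $M=\Delta^0(M)\supseteq\Delta^1(M)\supseteq\dots\supseteq\Delta^{d+1}(M)=0$ is a filtration of $M$ by coadmissible submodules such that, for all $l$ and $n$, the map $A_{q_n}\otimes_A\Delta^l(M)\to A_{q_n}\otimes_A M$ is injective with image $\Delta^l(A_{q_n}\otimes_A M)$ (the dimension filtration of $M$), and moreover: (i) a coadmissible submodule $N\subseteq M$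 has grade $j_A(N)\ge l$ if and only if $N\subseteq\Delta^l(M)$; (ii) $j_A(M)=\sup\{l\ge 0:\Delta^l(M)=M\}$; (iii) if $M$ is pure and $j_A(M)<\infty$ (that is, $M\neq 0$), then $M=\Delta^{j_A(M)}(M)\supseteq\Delta^{j_A(M)+1}(M)=0$; (iv) for every $l\ge 0$, the module $\Delta^l(M)/\Delta^{l+1}(M)$ is zero or pure of grade $l$. -/

import Mathlib

open CategoryTheory Abelian
open scoped TensorProduct

universe w u

noncomputable section

/-! ### Extension of scalars, flatness -/

section BaseChange

variable {R S : Type u} [Ring R] [Ring S] (φ : R →+* S)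

/-- The relations `(s * φ r) ⊗ n = s ⊗ (r • n)` inside `S ⊗[ℤ] N`
(this set is stable under left multiplication by `S`). -/
def baseChangeRel (N : Type u) [AddCommGroup N] [Module R N] : Submodule S (S ⊗[ℤ] N) :=
  Submodule.span S
    {x | ∃ (s : S) (r : R) (n : N), x = (s * φ r) ⊗ₜ[ℤ] n - s ⊗ₜ[ℤ] (r • n)}

/-- The left `S`-module `S ⊗_R N`, where `N` is a left module over the possibly noncommutative
ring `R`, and `S` is a right `R`-module via `φ : R → S`. -/
def BaseChange (N : Type u) [AddCommGroup N] [Module R N] : Type u :=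
  (S ⊗[ℤ] N) ⧸ baseChangeRel φ N

variable (N : Type u) [AddCommGroup N] [Module R N]
variable (N' : Type u) [AddCommGroup N'] [Module R N']

instance : AddCommGroup (BaseChange φ N) :=
  inferInstanceAs (AddCommGroup ((S ⊗[ℤ] N) ⧸ baseChangeRel φ N))

instance : Module S (BaseChange φ N) :=
  inferInstanceAs (Module S ((S ⊗[ℤ] N) ⧸ baseChangeRel φ N))

variable {N N'}

/-- The pure tensor `s ⊗ n` in `S ⊗_R N`. -/
def BaseChange.tmul (s : S) (n : N) : BaseChange φ N :=
  (baseChangeRel φ N).mkQ (s ⊗ₜ[ℤ] n)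

theorem BaseChange.tmul_add (s : S) (n n' : N) :
    BaseChange.tmul φ s (n + n') = BaseChange.tmul φ s n + BaseChange.tmul φ s n' := by
  simp only [BaseChange.tmul, TensorProduct.tmul_add]
  exact map_add _ _ _

theorem BaseChange.tmul_zero (s : S) : BaseChange.tmul φ s (0 : N) = 0 := by
  simp only [BaseChange.tmul, TensorProduct.tmul_zero]
  exact map_zero _

theorem BaseChange.smul_tmul (s t : S) (n : N) :
    s • BaseChange.tmul φ t n = BaseChange.tmul φ (s * t) n :=
  rfl

theorem BaseChange.tmul_smul (s : S) (r : R) (n : N) :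
    BaseChange.tmul φ s (r • n) = BaseChange.tmul φ (s * φ r) n := by
  symm
  rw [BaseChange.tmul, BaseChange.tmul]
  exact (Submodule.Quotient.eq _).2 (Submodule.subset_span ⟨s, r, n, rfl⟩)

/-- The `S`-linear map `S ⊗ f : S ⊗_R N → S ⊗_R N'` induced by an `R`-linear map `f`. -/
def BaseChange.map (f : N →ₗ[R] N') : BaseChange φ N →ₗ[S] BaseChange φ N' :=
  Submodule.mapQ (baseChangeRel φ N) (baseChangeRel φ N')
    (TensorProduct.AlgebraTensorModule.map (LinearMap.id : S →ₗ[S] S) (f.restrictScalars ℤ))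
    (by
      refine Submodule.span_le.2 ?_
      rintro _ ⟨s, r, n, rfl⟩
      refine Submodule.subset_span ⟨s, r, f n, ?_⟩
      simp)

theorem BaseChange.map_tmul (f : N →ₗ[R] N') (s : S) (n : N) :
    BaseChange.map φ f (BaseChange.tmul φ s n) = BaseChange.tmul φ s (f n) :=
  rfl

/-- `S` is flat as a right `R`-module via `φ`: the functor `S ⊗_R -` on left `R`-modules preserves
injections. -/
def FlatAsRightModule : Prop :=
  ∀ (N N' : Type u) [AddCommGroup N] [Module R N] [AddCommGroup N'] [Module R N']
    (f : N →ₗ[R] N'), Function.Injective f → Function.Injective (BaseChange.map φ f)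

/-- `S` is flat as a left `R`-module via `φ`: the functor `- ⊗_R S` on right `R`-modules preserves
injections. Right modules are left modules over the opposite ring, and `N ⊗_R S` is
`Sᵐᵒᵖ ⊗_{Rᵐᵒᵖ} N`. -/
def FlatAsLeftModule : Prop := FlatAsRightModule φ.op

end BaseChange

/-! ### Grade, purity, dimension filtration and Auslander regularity

All modules are left modules; right `R`-modules are (left) `Rᵐᵒᵖ`-modules. -/

section Auslander

variable (R : Type u) [Ring R]

/-- Right multiplication by `r`, as an endomorphism of the left `R`-module `R`. -/
def rightMulHom (r : R) : ModuleCat.of R R ⟶ ModuleCat.of R R :=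
  ModuleCat.ofHom (LinearMap.toSpanSingleton R R r)

variable (N : Type u) [AddCommGroup N] [Module R N]

/-- The group `Ext^l_R(N, R)`. -/
def ExtDual (l : ℕ) : Type u :=
  Abelian.Ext.{u} (ModuleCat.of R N) (ModuleCat.of R R) l

instance (l : ℕ) : AddCommGroup (ExtDual R N l) :=
  inferInstanceAs (AddCommGroup (Abelian.Ext.{u} (ModuleCat.of R N) (ModuleCat.of R R) l))

/-- The right `R`-module structure on `Ext^l_R(N, R)`, induced by right multiplication on the
second argument `R`. -/
@[reducible] def extDualModule (l : ℕ) :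
    Module Rᵐᵒᵖ (Abelian.Ext.{u} (ModuleCat.of R N) (ModuleCat.of R R) l) where
  smul r x := x.comp (Abelian.Ext.mk₀ (rightMulHom R r.unop)) (add_zero l)
  one_smul x := by
    change x.comp (Abelian.Ext.mk₀ (rightMulHom R 1)) (add_zero l) = x
    have : rightMulHom R 1 = 𝟙 _ := by
      ext; simp [rightMulHom]
    rw [this]
    exact Abelian.Ext.comp_mk₀_id _
  mul_smul r s x := by
    change x.comp (Abelian.Ext.mk₀ (rightMulHom R (s.unop * r.unop))) (add_zero l) =
      (x.comp (Abelian.Ext.mk₀ (rightMulHom R s.unop)) (add_zero l)).comp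
        (Abelian.Ext.mk₀ (rightMulHom R r.unop)) (add_zero l)
    have : rightMulHom R (s.unop * r.unop) = rightMulHom R s.unop ≫ rightMulHom R r.unop := by
      ext; simp [rightMulHom]
    rw [this, Abelian.Ext.comp_assoc_of_third_deg_zero, Abelian.Ext.mk₀_comp_mk₀]
  smul_zero r := by
    change (0 : Abelian.Ext.{u} (ModuleCat.of R N) (ModuleCat.of R R) l).comp
      (Abelian.Ext.mk₀ (rightMulHom R r.unop)) (add_zero l) = 0
    simp
  smul_add r x y := Abelian.Ext.add_comp _ _ _ _
  add_smul r s x := by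
    change x.comp (Abelian.Ext.mk₀ (rightMulHom R (r.unop + s.unop))) (add_zero l) =
      x.comp (Abelian.Ext.mk₀ (rightMulHom R r.unop)) (add_zero l) +
        x.comp (Abelian.Ext.mk₀ (rightMulHom R s.unop)) (add_zero l)
    have : rightMulHom R (r.unop + s.unop) = rightMulHom R r.unop + rightMulHom R s.unop := by
      ext; simp [rightMulHom]
    rw [this, Abelian.Ext.mk₀_add, Abelian.Ext.comp_add]
  zero_smul x := by
    change x.comp (Abelian.Ext.mk₀ (rightMulHom R 0)) (add_zero l) = 0
    have : rightMulHom R 0 = 0 := by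
      ext; simp [rightMulHom]
    rw [this, Abelian.Ext.mk₀_zero]
    exact Abelian.Ext.comp_zero _ _ _ _ _

instance (l : ℕ) : Module Rᵐᵒᵖ (ExtDual R N l) := extDualModule R N l

/-- The grade `j_R(N) = min {l ≥ 0 : Ext^l_R(N, R) ≠ 0}`, which is `∞` if there is no such `l`. -/
def moduleGrade : ℕ∞ := ⨅ (l : ℕ) (_ : Nontrivial (ExtDual R N l)), (l : ℕ∞)

/-- `N` is pure: `Ext^l_R(Ext^l_R(N, R), R) = 0` for all `l ≠ j_R(N)`. -/
def IsPureModule : Prop :=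
  ∀ l : ℕ, (l : ℕ∞) ≠ moduleGrade R N → Subsingleton (ExtDual Rᵐᵒᵖ (ExtDual R N l) l)

/-- The step `Δ^l(N)` of the dimension filtration of `N`: the largest submodule of
grade at least `l` (the sum of all submodules of grade at least `l`). -/
def dimFiltration (l : ℕ) : Submodule R N :=
  sSup {L : Submodule R N | (l : ℕ∞) ≤ moduleGrade R L}

/-- The Auslander condition for `N`: each submodule of `Ext^l_R(N, R)` has grade at least `l`. -/
def AuslanderCondition : Prop :=
  ∀ (l : ℕ) (L : Submodule Rᵐᵒᵖ (ExtDual R N l)), (l : ℕ∞) ≤ moduleGrade Rᵐᵒᵖ L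

/-- Every finitely generated left `R`-module has finite projective dimension and satisfies the
Auslander condition. -/
def AuslanderRegularLeft : Prop :=
  ∀ (N : Type u) [AddCommGroup N] [Module R N] [Module.Finite R N],
    (∃ m : ℕ, HasProjectiveDimensionLE (ModuleCat.of R N) m) ∧ AuslanderCondition R N

/-- `R` is (left and right) noetherian and Auslander regular. -/
structure IsAuslanderRegular : Prop where
  noetherian_left : IsNoetherianRing R
  noetherian_right : IsNoetherianRing Rᵐᵒᵖ
  regular_left : AuslanderRegularLeft R
  regular_right : AuslanderRegularLeft Rᵐᵒᵖ

/-- `R` has (left and right) global dimension at most `d`. -/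
def GlobalDimensionLE (d : ℕ) : Prop :=
  (∀ X : ModuleCat.{u} R, HasProjectiveDimensionLE X d) ∧
    ∀ X : ModuleCat.{u} Rᵐᵒᵖ, HasProjectiveDimensionLE X d

end Auslander

/-! ### Fréchet–Stein algebras -/

section FrechetStein

variable (K : Type w) [NontriviallyNormedField K] (A : Type u) [Ring A] [Algebra K A]

/-- A (nonarchimedean) algebra seminorm: `q(ab) ≤ c q(a) q(b)` for some constant `c > 0`. -/
structure AlgSeminorm extends Seminorm K A where
  nonarch : ∀ a b : A, toFun (a + b) ≤ max (toFun a) (toFun b)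
  exists_mul_le : ∃ c : ℝ, 0 < c ∧ ∀ a b : A, toFun (a * b) ≤ c * (toFun a * toFun b)

variable {K A}

/-- The ring `A`, with the topology and the uniform structure given by the seminorm `q`. -/
def AlgSeminorm.Source (_q : AlgSeminorm K A) : Type u := A

instance (q : AlgSeminorm K A) : Ring q.Source := inferInstanceAs (Ring A)

/-- The seminorm `q`, on `q.Source`. -/
def AlgSeminorm.sourceSeminorm (q : AlgSeminorm K A) : AddGroupSeminorm q.Source :=
  q.toSeminorm.toAddGroupSeminorm

instance (q : AlgSeminorm K A) : SeminormedAddCommGroup q.Source :=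
  q.sourceSeminorm.toSeminormedAddCommGroup

theorem AlgSeminorm.norm_def (q : AlgSeminorm K A) (a : q.Source) : ‖a‖ = q.toSeminorm a := rfl

theorem AlgSeminorm.continuous_mul_source (q : AlgSeminorm K A) :
    Continuous fun p : q.Source × q.Source => p.1 * p.2 := by
  obtain ⟨c, hc, h⟩ := q.exists_mul_le
  have h' : ∀ a b : q.Source, ‖a * b‖ ≤ c * (‖a‖ * ‖b‖) := h
  rw [continuous_iff_continuousAt]
  rintro ⟨a, b⟩
  rw [ContinuousAt, tendsto_iff_norm_sub_tendsto_zero]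
  have key : Filter.Tendsto
      (fun p : q.Source × q.Source => c * (‖p.1 - a‖ * ‖p.2‖) + c * (‖a‖ * ‖p.2 - b‖))
      (nhds (a, b)) (nhds (c * (‖a - a‖ * ‖b‖) + c * (‖a‖ * ‖b - b‖))) := by
    refine Continuous.tendsto (f := fun p : q.Source × q.Source =>
      c * (‖p.1 - a‖ * ‖p.2‖) + c * (‖a‖ * ‖p.2 - b‖)) ?_ (a, b)
    fun_prop
  have h0 : c * (‖a - a‖ * ‖b‖) + c * (‖a‖ * ‖b - b‖) = 0 := by simp
  rw [h0] at key
  refine squeeze_zero (fun _ => norm_nonneg _) (fun p => ?_) key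
  change ‖p.1 * p.2 - a * b‖ ≤ _
  have e : p.1 * p.2 - a * b = (p.1 - a) * p.2 + a * (p.2 - b) := by noncomm_ring
  rw [e]
  exact (norm_add_le _ _).trans (add_le_add (h' _ _) (h' _ _))

instance (q : AlgSeminorm K A) : IsTopologicalRing q.Source where
  continuous_mul := q.continuous_mul_source
  continuous_add := continuous_add
  continuous_neg := continuous_neg

/-- The Banach algebra `A_q`: the completion of `A / {q = 0}` with respect to `q`, i.e. the
Hausdorff completion of `A` for `q`. -/
abbrev AlgSeminorm.Compl (q : AlgSeminorm K A) : Type u := UniformSpace.Completion q.Source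

/-- The natural map `A → A_q`. -/
def AlgSeminorm.toCompl (q : AlgSeminorm K A) : A →+* q.Compl :=
  (UniformSpace.Completion.coeRingHom : q.Source →+* UniformSpace.Completion q.Source)

/-- The identity of `A`, as a ring homomorphism from `(A, q)` to `(A, q')`. -/
def AlgSeminorm.idHom (q q' : AlgSeminorm K A) : q.Source →+* q'.Source := RingHom.id A

theorem AlgSeminorm.continuous_idHom (q q' : AlgSeminorm K A)
    (h : ∀ a : A, q'.toSeminorm a ≤ q.toSeminorm a) :
    Continuous (AlgSeminorm.idHom q q') :=
  AddMonoidHomClass.continuous_of_bound (AlgSeminorm.idHom q q') 1 fun a => by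
    rw [one_mul]
    exact h a

/-- The transition map `A_q → A_{q'}` for `q' ≤ q`, extending the identity of `A`. -/
def AlgSeminorm.transition (q q' : AlgSeminorm K A)
    (h : ∀ a : A, q'.toSeminorm a ≤ q.toSeminorm a) : q.Compl →+* q'.Compl :=
  UniformSpace.Completion.mapRingHom (AlgSeminorm.idHom q q') (q.continuous_idHom q' h)

variable (K A) in
/-- An increasing sequence `q_0 ≤ q_1 ≤ ...` of algebra seminorms on `A`. -/
structure AlgSeminormSeq where
  q : ℕ → AlgSeminorm K A
  le_succ : ∀ (n : ℕ) (a : A), (q n).toSeminorm a ≤ (q (n + 1)).toSeminorm a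

namespace AlgSeminormSeq

variable (Q : AlgSeminormSeq K A)

/-- The Banach algebra `A_{q_n}`. -/
abbrev alg (n : ℕ) : Type u := (Q.q n).Compl

/-- The natural map `A → A_{q_n}`. -/
def ι (n : ℕ) : A →+* Q.alg n := (Q.q n).toCompl

/-- The transition map `A_{q_{n+1}} → A_{q_n}`. -/
def φ (n : ℕ) : Q.alg (n + 1) →+* Q.alg n := (Q.q (n + 1)).transition (Q.q n) (Q.le_succ n)

/-- A coherent sheaf for `(A, (q_n))`: finitely generated `A_{q_n}`-modules `M_n` together with
isomorphisms `A_{q_n} ⊗_{A_{q_{n+1}}} M_{n+1} ≅ M_n` of `A_{q_n}`-modules. -/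
structure CoherentSheaf where
  obj : ℕ → Type u
  [addCommGroup : ∀ n, AddCommGroup (obj n)]
  [module : ∀ n, Module (Q.alg n) (obj n)]
  [finite : ∀ n, Module.Finite (Q.alg n) (obj n)]
  iso : ∀ n, BaseChange (Q.φ n) (obj (n + 1)) ≃ₗ[Q.alg n] obj n

attribute [instance] CoherentSheaf.addCommGroup CoherentSheaf.module CoherentSheaf.finite

variable {Q}

/-- The transition map `M_{n+1} → M_n`, `m ↦ 1 ⊗ m`, of a coherent sheaf. -/
def CoherentSheaf.res (F : Q.CoherentSheaf) (n : ℕ) (m : F.obj (n + 1)) : F.obj n :=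
  F.iso n (BaseChange.tmul (Q.φ n) 1 m)

theorem φ_ι (n : ℕ) (a : A) : Q.φ n (Q.ι (n + 1) a) = Q.ι n a :=
  UniformSpace.Completion.mapRingHom_coe
    (AlgSeminorm.continuous_idHom (Q.q (n + 1)) (Q.q n) (Q.le_succ n)) a

theorem CoherentSheaf.res_smul (F : Q.CoherentSheaf) (n : ℕ) (a : A) (m : F.obj (n + 1)) :
    F.res n (Q.ι (n + 1) a • m) = Q.ι n a • F.res n m := by
  rw [res, res, BaseChange.tmul_smul, φ_ι, ← map_smul, BaseChange.smul_tmul, one_mul, mul_one]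

/-- The global sections `Γ(M_n) = lim M_n` of a coherent sheaf. -/
def CoherentSheaf.globalSections (F : Q.CoherentSheaf) : AddSubgroup (∀ n, F.obj n) where
  carrier := {x | ∀ n, F.res n (x (n + 1)) = x n}
  zero_mem' n := by
    simp [res, BaseChange.tmul_zero]
  add_mem' {x y} hx hy n := by
    have h1 := hx n
    have h2 := hy n
    simp only [res] at h1 h2
    simp only [res, Pi.add_apply, BaseChange.tmul_add, map_add, h1, h2]
  neg_mem' {x} hx n := by
    have h : F.res n (x (n + 1)) + F.res n ((-x) (n + 1)) = 0 := by
      simp only [res, ← map_add, ← BaseChange.tmul_add, Pi.neg_apply, add_neg_cancel,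
        BaseChange.tmul_zero, map_zero]
    rw [hx n] at h
    exact (neg_eq_of_add_eq_zero_right h).symm

/-- `A` acts on the global sections through the maps `A → A_{q_n}`. -/
instance (F : Q.CoherentSheaf) : Module A F.globalSections where
  smul a x := ⟨fun n => Q.ι n a • x.1 n, fun n => by rw [F.res_smul, x.2 n]⟩
  one_smul x := Subtype.ext <| funext fun n =>
    show Q.ι n 1 • x.1 n = x.1 n by rw [map_one, one_smul]
  mul_smul a b x := Subtype.ext <| funext fun n =>
    show Q.ι n (a * b) • x.1 n = Q.ι n a • Q.ι n b • x.1 n by rw [map_mul, mul_smul]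
  smul_zero a := Subtype.ext <| funext fun n => smul_zero (Q.ι n a)
  smul_add a x y := Subtype.ext <| funext fun n => smul_add (Q.ι n a) (x.1 n) (y.1 n)
  add_smul a b x := Subtype.ext <| funext fun n =>
    show Q.ι n (a + b) • x.1 n = Q.ι n a • x.1 n + Q.ι n b • x.1 n by rw [map_add, add_smul]
  zero_smul x := Subtype.ext <| funext fun n =>
    show Q.ι n 0 • x.1 n = 0 by rw [map_zero, zero_smul]

variable (Q)

/-- A left `A`-module is coadmissible if it is isomorphic to the module of global sections of a
coherent sheaf for `(A, (q_n))`. -/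
def IsCoadmissible (M : Type u) [AddCommGroup M] [Module A M] : Prop :=
  ∃ F : Q.CoherentSheaf, Nonempty (M ≃ₗ[A] F.globalSections)

/-- The step `Δ^l(M)` of the dimension filtration of an `A`-module `M`: the
submodule of all `m` such that `1 ⊗ m` lies in `Δ^l(A_{q_n} ⊗_A M)` for every `n`. -/
def dimFil (M : Type u) [AddCommGroup M] [Module A M] (l : ℕ) : Submodule A M where
  carrier := {m | ∀ n, BaseChange.tmul (Q.ι n) 1 m ∈
    dimFiltration (Q.alg n) (BaseChange (Q.ι n) M) l}
  zero_mem' n := by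
    rw [BaseChange.tmul_zero]
    exact zero_mem _
  add_mem' hx hy n := by
    rw [BaseChange.tmul_add]
    exact add_mem (hx n) (hy n)
  smul_mem' a x hx n := by
    rw [BaseChange.tmul_smul, one_mul, ← mul_one (Q.ι n a), ← BaseChange.smul_tmul]
    exact Submodule.smul_mem _ _ (hx n)

/-- `(q_n)` exhibits the topological algebra `A` as a two-sided `K`-Fréchet–Stein algebra:
`A` is Hausdorff and complete, its topology is defined by the `q_n`, each `A_{q_n}` is left and
right noetherian, and flat as a left and as a right `A_{q_{n+1}}`-module. -/
structure IsTwoSidedFrechetStein [UniformSpace A] : Prop where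
  t2 : T2Space A
  complete : CompleteSpace A
  withSeminorms : WithSeminorms (fun n => (Q.q n).toSeminorm)
  noetherian_left : ∀ n, IsNoetherianRing (Q.alg n)
  noetherian_right : ∀ n, IsNoetherianRing (Q.alg n)ᵐᵒᵖ
  flat_left : ∀ n, FlatAsLeftModule (Q.φ n)
  flat_right : ∀ n, FlatAsRightModule (Q.φ n)

end AlgSeminormSeq

end FrechetStein

end

/-!
Over an Auslander regular ring `R`, dualizing twice a projective resolution of a finite module `N`
embeds every submodule of `N` that has no nonzero homomorphism to the modules
`Ext^i(Ext^i(N, R), R)` with `i ≤ k` into some `Ext^{k+1}(-, Rᵐᵒᵖ)`, whose submodules have grade at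
least `k + 1`. It follows that grades do not drop on submodules, and that
`Ext^i(Ext^i(N, R), R)` vanishes for all `i ≥ l` if and only if `N` has no nonzero submodule of
grade at least `l`. This criterion is stable under two-sided flat base change, hence so is the
dimension filtration.

For a coadmissible module `M` over `A = lim A_{q_n}`, the submodules `Δ^l(A_{q_n} ⊗_A M)` therefore
form a coherent system, and by Theorems A and B (Mittag-Leffler) its limit `Δ^l(M)` and the quotient
`M / Δ^l(M)` are coadmissible and induce the expected modules over each `A_{q_n}`. Applying
`Ext_A(M, -)` to the exact sequence `0 → A → ∏ A_{q_n} → ∏ A_{q_n} → 0` shows that `Ext_A^i(M, A)`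
is coadmissible with base changes `Ext^i(A_{q_n} ⊗_A M, A_{q_n})`, so grades and purity over `A` can
be read off over the rings `A_{q_n}`.
-/

noncomputable section

/-! ### `Ext` groups of modules -/

section ModExt

variable (R : Type u) [Ring R]

/-- The group `Ext^l_R(N, B)`, for unbundled modules `N` and `B`. -/
abbrev ModExt (N B : Type u) [AddCommGroup N] [Module R N] [AddCommGroup B] [Module R B] (l : ℕ) :
    Type u :=
  Abelian.Ext.{u} (ModuleCat.of R N) (ModuleCat.of R B) l

variable {R}
variable {N N' N'' : Type u} [AddCommGroup N] [Module R N] [AddCommGroup N'] [Module R N']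
  [AddCommGroup N''] [Module R N'']
variable {B B' B'' : Type u} [AddCommGroup B] [Module R B] [AddCommGroup B'] [Module R B']
  [AddCommGroup B''] [Module R B'']

namespace ModExt

/-- Functoriality of `Ext` in the first variable. -/
def precomp (B : Type u) [AddCommGroup B] [Module R B] (l : ℕ) (f : N →ₗ[R] N') :
    ModExt R N' B l →+ ModExt R N B l :=
  (Ext.mk₀ (ModuleCat.ofHom f)).precomp _ (zero_add l)

/-- Functoriality of `Ext` in the second variable. -/
def postcomp (N : Type u) [AddCommGroup N] [Module R N] (l : ℕ) (g : B →ₗ[R] B') :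
    ModExt R N B l →+ ModExt R N B' l :=
  (Ext.mk₀ (ModuleCat.ofHom g)).postcomp _ (add_zero l)

theorem precomp_apply (l : ℕ) (f : N →ₗ[R] N') (x : ModExt R N' B l) :
    precomp B l f x = (Ext.mk₀ (ModuleCat.ofHom f)).comp x (zero_add l) := rfl

theorem postcomp_apply (l : ℕ) (g : B →ₗ[R] B') (x : ModExt R N B l) :
    postcomp N l g x = x.comp (Ext.mk₀ (ModuleCat.ofHom g)) (add_zero l) := rfl

theorem postcomp_precomp (l : ℕ) (f : N →ₗ[R] N') (g : B →ₗ[R] B') (x : ModExt R N' B l) :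
    postcomp N l g (precomp B l f x) = precomp B' l f (postcomp N' l g x) := by
  simp [precomp_apply, postcomp_apply]

theorem precomp_comp (l : ℕ) (f : N →ₗ[R] N') (g : N' →ₗ[R] N'') (x : ModExt R N'' B l) :
    precomp B l (g ∘ₗ f) x = precomp B l f (precomp B l g x) := by
  simp [precomp_apply, ModuleCat.ofHom_comp]

theorem precomp_id (l : ℕ) (x : ModExt R N B l) : precomp B l LinearMap.id x = x :=
  Ext.mk₀_id_comp x

theorem precomp_zero (l : ℕ) (x : ModExt R N' B l) : precomp B l (0 : N →ₗ[R] N') x = 0 := by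
  have : ModuleCat.ofHom (0 : N →ₗ[R] N') = 0 := rfl
  simp [precomp_apply, this]

theorem postcomp_comp (l : ℕ) (f : B →ₗ[R] B') (g : B' →ₗ[R] B'') (x : ModExt R N B l) :
    postcomp N l (g ∘ₗ f) x = postcomp N l g (postcomp N l f x) := by
  simp [postcomp_apply, ModuleCat.ofHom_comp, ← Ext.mk₀_comp_mk₀]

theorem postcomp_id (l : ℕ) (x : ModExt R N B l) : postcomp N l LinearMap.id x = x :=
  Ext.comp_mk₀_id x

theorem postcomp_bijective (e : B ≃ₗ[R] B') (l : ℕ) :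
    Function.Bijective (postcomp N l e.toLinearMap) :=
  Function.bijective_iff_has_inverse.2 ⟨postcomp N l e.symm.toLinearMap,
    fun x => by rw [← postcomp_comp, LinearEquiv.symm_comp, postcomp_id],
    fun x => by rw [← postcomp_comp, LinearEquiv.comp_symm, postcomp_id]⟩

theorem postcomp_zero (l : ℕ) (x : ModExt R N B l) : postcomp N l (0 : B →ₗ[R] B') x = 0 := by
  have : ModuleCat.ofHom (0 : B →ₗ[R] B') = 0 := rfl
  simp [postcomp_apply, this]

theorem postcomp_add (l : ℕ) (f g : B →ₗ[R] B') (x : ModExt R N B l) :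
    postcomp N l (f + g) x = postcomp N l f x + postcomp N l g x := by
  have : ModuleCat.ofHom (f + g) = ModuleCat.ofHom f + ModuleCat.ofHom g := rfl
  simp only [postcomp_apply, this, Ext.mk₀_add, Ext.comp_add]

theorem postcomp_sub (l : ℕ) (f g : B →ₗ[R] B') (x : ModExt R N B l) :
    postcomp N l (f - g) x = postcomp N l f x - postcomp N l g x := by
  rw [eq_sub_iff_add_eq, ← postcomp_add, sub_add_cancel]

/-- `Ext` in degree zero is `Hom`. -/
def homEquiv : ModExt R N B 0 ≃+ (N →ₗ[R] B) :=
  Ext.addEquiv₀.trans ModuleCat.homAddEquiv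

theorem mk₀_homEquiv (x : ModExt R N B 0) : Ext.mk₀ (ModuleCat.ofHom (homEquiv x)) = x :=
  Ext.addEquiv₀.symm_apply_apply x

theorem homEquiv_mk₀ (f : ModuleCat.of R N ⟶ ModuleCat.of R B) :
    homEquiv (Ext.mk₀ f) = f.hom :=
  congrArg ModuleCat.Hom.hom (Ext.addEquiv₀.apply_symm_apply f)

theorem homEquiv_precomp (f : N →ₗ[R] N') (x : ModExt R N' B 0) :
    homEquiv (precomp B 0 f x) = homEquiv x ∘ₗ f := by
  conv_lhs => rw [← mk₀_homEquiv x]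
  simp [precomp_apply, homEquiv_mk₀]

theorem homEquiv_postcomp (g : B →ₗ[R] B') (x : ModExt R N B 0) :
    homEquiv (postcomp N 0 g x) = g ∘ₗ homEquiv x := by
  conv_lhs => rw [← mk₀_homEquiv x]
  simp [postcomp_apply, homEquiv_mk₀]

theorem subsingleton_of_projective [Module.Projective R N] (l : ℕ) :
    Subsingleton (ModExt R N B (l + 1)) :=
  have : Projective (ModuleCat.of R N) := (IsProjective.iff_projective (R := R) N).1 inferInstance
  Ext.subsingleton_of_projective _ _ _

theorem subsingleton_of_projectiveDimensionLE {m : ℕ}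
    (h : HasProjectiveDimensionLE (ModuleCat.of R N) m) {l : ℕ} (hl : m < l) :
    Subsingleton (ModExt R N B l) :=
  have : HasProjectiveDimensionLT (ModuleCat.of R N) (m + 1) := h
  HasProjectiveDimensionLT.subsingleton _ (m + 1) _ hl _

section ContravariantSequence

variable {f : N →ₗ[R] N'} {g : N' →ₗ[R] N''} (hf : Function.Injective f)
  (hg : Function.Surjective g) (hfg : Function.Exact f g)

/-- The short complex attached to an exact pair of linear maps. -/
abbrev shortComplex (hfg : Function.Exact f g) : ShortComplex (ModuleCat.{u} R) :=
  ShortComplex.mk (ModuleCat.ofHom f) (ModuleCat.ofHom g)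
    (ModuleCat.hom_ext hfg.linearMap_comp_eq_zero)

include hf hg hfg in
theorem shortExact : (shortComplex hfg).ShortExact :=
  ModuleCat.shortComplex_shortExact _ hfg hf hg

/-- The connecting homomorphism of the contravariant long exact sequence. -/
def δ (B : Type u) [AddCommGroup B] [Module R B] (l : ℕ) :
    ModExt R N B l →+ ModExt R N'' B (l + 1) :=
  (shortExact hf hg hfg).extClass.precomp _ (add_comm 1 l)

include hf hg hfg in
theorem exact_precomp_precomp (l : ℕ) : Function.Exact (precomp B l g) (precomp B l f) := by
  refine fun x => ⟨Ext.contravariant_sequence_exact₂ (shortExact hf hg hfg) _ x, ?_⟩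
  rintro ⟨y, rfl⟩
  rw [← precomp_comp, hfg.linearMap_comp_eq_zero, precomp_zero]

theorem exact_precomp_δ (l : ℕ) : Function.Exact (precomp B l f) (δ hf hg hfg B l) := by
  refine fun x =>
    ⟨Ext.contravariant_sequence_exact₁ (shortExact hf hg hfg) _ x (add_comm 1 l), ?_⟩
  rintro ⟨y, rfl⟩
  exact (shortExact hf hg hfg).extClass_comp_assoc y (h := add_comm 1 l)

theorem exact_δ_precomp (l : ℕ) : Function.Exact (δ hf hg hfg B l) (precomp B (l + 1) g) := by
  refine fun x => ⟨fun hx =>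
    Ext.contravariant_sequence_exact₃ (shortExact hf hg hfg) _ x hx (add_comm 1 l), ?_⟩
  rintro ⟨y, rfl⟩
  exact (shortExact hf hg hfg).comp_extClass_assoc y (add_comm 1 l)

theorem precomp_injective_of_surjective (hg : Function.Surjective g) :
    Function.Injective (precomp B 0 g) :=
  have : Epi (ModuleCat.ofHom g) := (ModuleCat.epi_iff_surjective _).2 hg
  Ext.precomp_mk₀_injective_of_epi _ _

theorem δ_postcomp (l : ℕ) (b : B →ₗ[R] B') (x : ModExt R N B l) :
    δ hf hg hfg B' l (postcomp N l b x) = postcomp N'' (l + 1) b (δ hf hg hfg B l x) :=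
  (Ext.comp_assoc_of_third_deg_zero (shortExact hf hg hfg).extClass x
    (Ext.mk₀ (ModuleCat.ofHom b)) (add_comm 1 l)).symm

end ContravariantSequence

section CovariantSequence

variable {f : B →ₗ[R] B'} {g : B' →ₗ[R] B''} (hf : Function.Injective f)
  (hg : Function.Surjective g) (hfg : Function.Exact f g)

/-- The connecting homomorphism of the covariant long exact sequence. -/
def covδ (N : Type u) [AddCommGroup N] [Module R N] (l : ℕ) :
    ModExt R N B'' l →+ ModExt R N B (l + 1) :=
  (shortExact hf hg hfg).extClass.postcomp _ rfl

include hf hg hfg in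
theorem exact_postcomp_postcomp (l : ℕ) : Function.Exact (postcomp N l f) (postcomp N l g) := by
  refine fun x => ⟨Ext.covariant_sequence_exact₂ _ (shortExact hf hg hfg) x, ?_⟩
  rintro ⟨y, rfl⟩
  rw [← postcomp_comp, hfg.linearMap_comp_eq_zero, postcomp_zero]

theorem exact_postcomp_covδ (l : ℕ) : Function.Exact (postcomp N l g) (covδ hf hg hfg N l) := by
  refine fun x =>
    ⟨fun hx => Ext.covariant_sequence_exact₃ _ (shortExact hf hg hfg) x rfl hx, ?_⟩
  rintro ⟨y, rfl⟩
  change (y.comp _ (add_zero l)).comp (shortExact hf hg hfg).extClass rfl = 0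
  rw [Ext.comp_assoc _ _ _ (add_zero l) (zero_add 1) (by omega)]
  exact (congrArg (fun z => y.comp z rfl) (shortExact hf hg hfg).comp_extClass).trans
    (Ext.comp_zero _ _ _ _ _)

theorem exact_covδ_postcomp (l : ℕ) :
    Function.Exact (covδ hf hg hfg N l) (postcomp N (l + 1) f) := by
  refine fun x =>
    ⟨fun hx => Ext.covariant_sequence_exact₁ _ (shortExact hf hg hfg) x hx rfl, ?_⟩
  rintro ⟨y, rfl⟩
  change (y.comp (shortExact hf hg hfg).extClass rfl).comp _ (add_zero (l + 1)) = 0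
  rw [Ext.comp_assoc _ _ _ rfl (add_zero 1) (by omega)]
  exact (congrArg (fun z => y.comp z rfl) (shortExact hf hg hfg).extClass_comp).trans
    (Ext.comp_zero _ _ _ _ _)

theorem postcomp_injective_of_injective (hf : Function.Injective f) :
    Function.Injective (postcomp N 0 f) :=
  have : Mono (ModuleCat.ofHom f) := (ModuleCat.mono_iff_injective _).2 hf
  Ext.postcomp_mk₀_injective_of_mono _ _

end CovariantSequence

end ModExt

end ModExt

namespace ExtDual

variable {R : Type u} [Ring R]
variable {N N' N'' : Type u} [AddCommGroup N] [Module R N] [AddCommGroup N'] [Module R N']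
  [AddCommGroup N''] [Module R N'']

/-- Contravariant functoriality of `Ext^l_R(-, R)`. -/
def map (l : ℕ) (f : N →ₗ[R] N') : ExtDual R N' l →ₗ[Rᵐᵒᵖ] ExtDual R N l where
  toFun := ModExt.precomp R l f
  map_add' := map_add _
  map_smul' r x :=
    (ModExt.postcomp_precomp (B' := R) l f (LinearMap.toSpanSingleton R R r.unop) x).symm

theorem map_comp (l : ℕ) (f : N →ₗ[R] N') (g : N' →ₗ[R] N'') (x : ExtDual R N'' l) :
    map l (g ∘ₗ f) x = map l f (map l g x) := ModExt.precomp_comp l f g x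

theorem map_id (l : ℕ) (x : ExtDual R N l) : map l LinearMap.id x = x := ModExt.precomp_id l x

theorem map_zero (l : ℕ) (x : ExtDual R N' l) : map l (0 : N →ₗ[R] N') x = 0 :=
  ModExt.precomp_zero l x

/-- `Ext^l_R(-, R)` of an isomorphism. -/
def congr (l : ℕ) (e : N ≃ₗ[R] N') : ExtDual R N' l ≃ₗ[Rᵐᵒᵖ] ExtDual R N l :=
  LinearEquiv.ofLinearMap (map l e.toLinearMap) (map l e.symm.toLinearMap)
    (by ext x; simp [← map_comp, map_id]) (by ext x; simp [← map_comp, map_id])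

/-- `Ext^0_R(N, R)` is the dual of `N`. -/
def homEquiv : ExtDual R N 0 ≃+ (N →ₗ[R] R) := ModExt.homEquiv

theorem homEquiv_map (f : N →ₗ[R] N') (x : ExtDual R N' 0) :
    homEquiv (map 0 f x) = homEquiv x ∘ₗ f := ModExt.homEquiv_precomp f x

theorem homEquiv_smul (r : Rᵐᵒᵖ) (x : ExtDual R N 0) (n : N) :
    homEquiv (r • x) n = homEquiv x n * r.unop :=
  LinearMap.congr_fun (ModExt.homEquiv_postcomp (LinearMap.toSpanSingleton R R r.unop) x) n

theorem subsingleton_of_projective [Module.Projective R N] (l : ℕ) :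
    Subsingleton (ExtDual R N (l + 1)) := ModExt.subsingleton_of_projective l

variable {f : N →ₗ[R] N'} {g : N' →ₗ[R] N''} (hf : Function.Injective f)
  (hg : Function.Surjective g) (hfg : Function.Exact f g)

/-- The connecting homomorphism of the long exact sequence of `Ext^l_R(-, R)`. -/
def δ (l : ℕ) : ExtDual R N l →ₗ[Rᵐᵒᵖ] ExtDual R N'' (l + 1) where
  toFun := ModExt.δ hf hg hfg R l
  map_add' := map_add _
  map_smul' r x :=
    ModExt.δ_postcomp (B' := R) hf hg hfg l (LinearMap.toSpanSingleton R R r.unop) x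

include hf hg hfg in
theorem exact_map_map (l : ℕ) :
    Function.Exact (map l g : ExtDual R N'' l →ₗ[Rᵐᵒᵖ] _) (map l f) :=
  ModExt.exact_precomp_precomp hf hg hfg l

theorem exact_map_δ (l : ℕ) : Function.Exact (map l f) (δ hf hg hfg l) :=
  ModExt.exact_precomp_δ hf hg hfg l

theorem exact_δ_map (l : ℕ) : Function.Exact (δ hf hg hfg l) (map (l + 1) g) :=
  ModExt.exact_δ_precomp hf hg hfg l

theorem map_injective_of_surjective (hg : Function.Surjective g) :
    Function.Injective (map 0 g) := ModExt.precomp_injective_of_surjective hg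

end ExtDual

/-! ### Extension of scalars -/

namespace BaseChange

section Functoriality

variable {R S : Type u} [Ring R] [Ring S] (φ : R →+* S)
variable {N N' N'' : Type u} [AddCommGroup N] [Module R N] [AddCommGroup N'] [Module R N']
  [AddCommGroup N''] [Module R N'']
variable {X : Type*} [AddCommGroup X] [Module S X]

/-- The universal semilinear map `n ↦ 1 ⊗ n`. -/
def mk (N : Type u) [AddCommGroup N] [Module R N] : N →ₛₗ[φ] BaseChange φ N where
  toFun n := tmul φ 1 n
  map_add' := tmul_add φ 1
  map_smul' r n := by rw [tmul_smul, one_mul, smul_tmul, mul_one]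

theorem mk_apply (n : N) : mk φ N n = tmul φ 1 n := rfl

theorem smul_mk (s : S) (n : N) : s • mk φ N n = tmul φ s n := by
  rw [mk_apply, smul_tmul, mul_one]

theorem zero_tmul (n : N) : tmul φ 0 n = 0 := by
  rw [← smul_mk, zero_smul]

theorem map_mk (f : N →ₗ[R] N') (n : N) : map φ f (mk φ N n) = mk φ N' (f n) := rfl

@[elab_as_elim]
theorem induction {p : BaseChange φ N → Prop} (tmul : ∀ s n, p (tmul φ s n))
    (add : ∀ x y, p x → p y → p (x + y)) (x : BaseChange φ N) : p x := by
  obtain ⟨t, rfl⟩ := Submodule.Quotient.mk_surjective _ x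
  induction t using TensorProduct.induction_on with
  | zero =>
    have h := tmul 0 0
    rw [zero_tmul] at h
    exact h
  | tmul s n => exact tmul s n
  | add a b ha hb => exact add _ _ ha hb

theorem exists_sum (x : BaseChange φ N) :
    ∃ (k : ℕ) (s : Fin k → S) (n : Fin k → N), x = ∑ i, tmul φ (s i) (n i) := by
  induction x using induction with
  | tmul s n => exact ⟨1, fun _ => s, fun _ => n, by simp⟩
  | add x y hx hy =>
    obtain ⟨k, s, n, rfl⟩ := hx
    obtain ⟨l, t, m, rfl⟩ := hy
    exact ⟨k + l, Fin.append s t, Fin.append n m, by simp [Fin.sum_univ_add]⟩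

theorem span_range_mk : Submodule.span S (Set.range (mk φ N)) = ⊤ := by
  rw [eq_top_iff]
  rintro x -
  induction x using induction with
  | tmul s n =>
    rw [← smul_mk]
    exact Submodule.smul_mem _ _ (Submodule.subset_span ⟨n, rfl⟩)
  | add x y hx hy => exact add_mem hx hy

variable {φ} in
theorem hom_ext {f g : BaseChange φ N →ₗ[S] X} (h : ∀ n, f (mk φ N n) = g (mk φ N n)) : f = g :=
  LinearMap.ext_on (span_range_mk φ) (Set.forall_mem_range.2 h)

variable {φ} in
/-- The linear map `S ⊗_R N → X` attached to a semilinear map `N → X`. -/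
def lift (f : N →ₛₗ[φ] X) : BaseChange φ N →ₗ[S] X :=
  Submodule.liftQ (baseChangeRel φ N)
    (TensorProduct.AlgebraTensorModule.lift
      (LinearMap.toSpanSingleton S (N →ₗ[ℤ] X) f.toAddMonoidHom.toIntLinearMap))
    (by
      refine Submodule.span_le.2 ?_
      rintro _ ⟨s, r, n, rfl⟩
      simp [mul_smul])

variable {φ} in
theorem lift_tmul (f : N →ₛₗ[φ] X) (s : S) (n : N) : lift f (tmul φ s n) = s • f n := rfl

variable {φ} in
theorem lift_mk (f : N →ₛₗ[φ] X) (n : N) : lift f (mk φ N n) = f n := by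
  rw [mk_apply, lift_tmul, one_smul]

variable {φ} in
theorem range_lift (f : N →ₛₗ[φ] X) :
    LinearMap.range (lift f) = Submodule.span S (Set.range f) := by
  rw [LinearMap.range_eq_map, ← span_range_mk, Submodule.map_span, ← Set.range_comp]
  exact congrArg _ (congrArg Set.range (funext (lift_mk f)))

theorem map_comp (f : N →ₗ[R] N') (g : N' →ₗ[R] N'') (x : BaseChange φ N) :
    map φ (g ∘ₗ f) x = map φ g (map φ f x) :=
  have : map φ (g ∘ₗ f) = (map φ g).comp (map φ f) := hom_ext fun _ => rfl
  LinearMap.congr_fun this x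

theorem map_id (x : BaseChange φ N) : map φ LinearMap.id x = x :=
  have : map φ LinearMap.id = (LinearMap.id : BaseChange φ N →ₗ[S] _) := hom_ext fun _ => rfl
  LinearMap.congr_fun this x

theorem map_zero (x : BaseChange φ N) : map φ (0 : N →ₗ[R] N') x = 0 :=
  have : map φ (0 : N →ₗ[R] N') = 0 := hom_ext fun _ => (mk φ N').map_zero
  LinearMap.congr_fun this x

/-- Extension of scalars of an isomorphism. -/
def congr (e : N ≃ₗ[R] N') : BaseChange φ N ≃ₗ[S] BaseChange φ N' :=
  LinearEquiv.ofLinearMap (map φ e.toLinearMap) (map φ e.symm.toLinearMap)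
    (by ext x; simp [← map_comp, map_id]) (by ext x; simp [← map_comp, map_id])

instance [Subsingleton N] : Subsingleton (BaseChange φ N) := by
  refine ⟨fun x y => ?_⟩
  have : LinearMap.id = (0 : N →ₗ[R] N) := Subsingleton.elim _ _
  rw [← map_id φ x, ← map_id φ y, this, map_zero, map_zero]

theorem range_map (f : N →ₗ[R] N') :
    LinearMap.range (map φ f) = Submodule.span S (mk φ N' '' LinearMap.range f) := by
  rw [LinearMap.range_eq_map, ← span_range_mk, Submodule.map_span, ← Set.range_comp,
    LinearMap.coe_range, ← Set.range_comp]
  rfl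

theorem map_surjective {g : N →ₗ[R] N'} (hg : Function.Surjective g) :
    Function.Surjective (map φ g) := by
  rw [← LinearMap.range_eq_top, range_map, LinearMap.range_eq_top.2 hg, Submodule.top_coe,
    Set.image_univ, span_range_mk]

theorem map_exact {f : N →ₗ[R] N'} {g : N' →ₗ[R] N''} (hfg : Function.Exact f g)
    (hg : Function.Surjective g) : Function.Exact (map φ f) (map φ g) := by
  intro x
  refine ⟨fun hx => ?_, ?_⟩
  · -- the projection to the cokernel of `S ⊗ f` factors through `S ⊗ g`
    let q := (LinearMap.range (map φ f)).mkQ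
    have hker : LinearMap.ker g ≤ LinearMap.ker (q.comp (mk φ N')) := by
      intro y hy
      obtain ⟨c, rfl⟩ := (hfg y).1 hy
      exact (Submodule.Quotient.mk_eq_zero _).2 ⟨mk φ N c, rfl⟩
    let s : N'' →ₛₗ[φ] (BaseChange φ N' ⧸ LinearMap.range (map φ f)) :=
      ((LinearMap.ker g).liftQ (q.comp (mk φ N')) hker).comp
        (g.quotKerEquivOfSurjective hg).symm.toLinearMap
    have hs : (lift s).comp (map φ g) = q := hom_ext fun n => by
      rw [LinearMap.comp_apply, map_mk, lift_mk]
      change (LinearMap.ker g).liftQ _ hker ((g.quotKerEquivOfSurjective hg).symm (g n)) = _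
      rw [← g.quotKerEquivOfSurjective_apply_mk hg, LinearEquiv.symm_apply_apply]
      rfl
    refine (Submodule.Quotient.mk_eq_zero _).1 (?_ : q x = 0)
    rw [← hs, LinearMap.comp_apply, hx, _root_.map_zero]
  · rintro ⟨y, rfl⟩
    rw [← map_comp, hfg.linearMap_comp_eq_zero, map_zero]

theorem _root_.FlatAsRightModule.map_exact {φ : R →+* S} (hφ : FlatAsRightModule φ)
    {f : N →ₗ[R] N'} {g : N' →ₗ[R] N''} (hfg : Function.Exact f g) :
    Function.Exact (map φ f) (map φ g) := by
  refine fun x => ⟨fun hx => ?_, ?_⟩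
  · have hx' : map φ g.rangeRestrict x = 0 := by
      apply hφ _ _ _ (LinearMap.range g).injective_subtype
      rw [← map_comp, _root_.map_zero]
      exact hx
    have hfg' : Function.Exact f g.rangeRestrict := fun y => by
      rw [← hfg y, ← Subtype.coe_inj]
      rfl
    exact (BaseChange.map_exact φ hfg' g.surjective_rangeRestrict x).1 hx'
  · rintro ⟨y, rfl⟩
    rw [← map_comp, hfg.linearMap_comp_eq_zero, map_zero]

instance [Module.Finite R N] : Module.Finite S (BaseChange φ N) := by
  obtain ⟨k, f, hf⟩ := Module.Finite.exists_fin' R N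
  classical
  refine ⟨⟨Finset.univ.image fun i => mk φ N (f (Pi.single i 1)), ?_⟩⟩
  rw [eq_top_iff, ← span_range_mk, Submodule.span_le]
  rintro _ ⟨n, rfl⟩
  obtain ⟨a, rfl⟩ := hf n
  rw [← (Pi.basisFun R (Fin k)).sum_repr a, map_sum, map_sum]
  refine sum_mem fun i _ => ?_
  rw [map_smul, (mk φ N).map_smulₛₗ]
  exact Submodule.smul_mem _ _ (Submodule.subset_span (by simp))

instance projective [Module.Projective R N] : Module.Projective S (BaseChange φ N) := by
  obtain ⟨s, hs⟩ := (Module.projective_def' (R := R) (P := N)).1 inferInstance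
  let b : N →ₛₗ[φ] (N →₀ S) :=
    { toFun := fun n => (s n).mapRange φ (_root_.map_zero φ)
      map_add' := fun x y => by ext; simp
      map_smul' := fun r x => by ext; simp }
  refine Module.Projective.of_split (M := N →₀ S) (lift b)
    (Finsupp.linearCombination S (mk φ N)) (hom_ext fun n => ?_)
  rw [LinearMap.comp_apply, lift_mk, LinearMap.id_apply]
  conv_rhs => rw [← LinearMap.id_apply (R := R) n, ← hs]
  simp only [b, LinearMap.coe_mk, AddHom.coe_mk, LinearMap.comp_apply,
    Finsupp.linearCombination_apply]
  rw [Finsupp.sum_mapRange_index (by simp), Finsupp.sum, Finsupp.sum, map_sum]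
  exact Finset.sum_congr rfl fun x _ => ((mk φ N).map_smulₛₗ _ _).symm

theorem lift_bijective_congr {φ : R →+* S} {X₁ : Type*} [AddCommGroup X₁] [Module S X₁]
    {f : N →ₛₗ[φ] X} {f₁ : N' →ₛₗ[φ] X₁} (e : N ≃ₗ[R] N') (e' : X ≃ₗ[S] X₁)
    (h : ∀ n, f₁ (e n) = e' (f n)) (hf : Function.Bijective (lift f)) :
    Function.Bijective (lift f₁) := by
  have key : (lift f₁).comp (congr φ e).toLinearMap = e'.toLinearMap.comp (lift f) :=
    hom_ext fun n => (lift_mk f₁ _).trans <| (h n).trans (congrArg e' (lift_mk f n)).symm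
  refine (Function.Bijective.of_comp_iff _ (congr φ e).bijective).1 ?_
  change Function.Bijective ((lift f₁).comp (congr φ e).toLinearMap)
  rw [key]
  exact e'.bijective.comp hf

end Functoriality

section Transitivity

variable {A R S : Type u} [Ring A] [Ring R] [Ring S] {φ : R →+* S} {ι' : A →+* R} {ι : A →+* S}
  (h : ∀ a, φ (ι' a) = ι a) (M : Type u) [AddCommGroup M] [Module A M]

/-- The semilinear transition map `R ⊗_A M → S ⊗_A M`. -/
def trans : BaseChange ι' M →ₛₗ[φ] BaseChange ι M :=
  letI : Module R (BaseChange ι M) := Module.compHom _ φ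
  let g : M →ₛₗ[ι'] BaseChange ι M :=
    { toFun := mk ι M
      map_add' := map_add _
      map_smul' := fun a m => by
        rw [(mk ι M).map_smulₛₗ, ← h]
        rfl }
  { toFun := lift g
    map_add' := map_add _
    map_smul' := fun r x => (lift g).map_smul r x }

theorem trans_tmul (r : R) (m : M) : trans h M (tmul ι' r m) = tmul ι (φ r) m := by
  rw [← smul_mk ι]
  rfl

theorem trans_mk (m : M) : trans h M (mk ι' M m) = mk ι M m := by
  rw [mk_apply, trans_tmul, map_one, mk_apply]

theorem trans_map {M' : Type u} [AddCommGroup M'] [Module A M'] (f : M →ₗ[A] M')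
    (x : BaseChange ι' M) : trans h M' (map ι' f x) = map ι f (trans h M x) := by
  induction x using induction with
  | tmul r m => rw [map_tmul, trans_tmul, trans_tmul, map_tmul]
  | add x y hx hy => simp only [map_add, hx, hy]

theorem lift_trans_bijective : Function.Bijective (lift (trans h M)) := by
  let g : M →ₛₗ[ι] BaseChange φ (BaseChange ι' M) :=
    { toFun := fun m => mk φ _ (mk ι' M m)
      map_add' := by simp
      map_smul' := fun a m => by
        rw [(mk ι' M).map_smulₛₗ, (mk φ _).map_smulₛₗ, h] }
  have lift_g_trans (y : BaseChange ι' M) : lift g (trans h M y) = mk φ _ y := by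
    induction y using induction with
    | tmul r m =>
      rw [trans_tmul, lift_tmul, ← smul_mk ι', (mk φ _).map_smulₛₗ]
      rfl
    | add x y hx hy => simp only [map_add, hx, hy]
  have left_inv : (lift g).comp (lift (trans h M)) = LinearMap.id := hom_ext fun y => by
    rw [LinearMap.comp_apply, lift_mk, lift_g_trans, LinearMap.id_apply]
  have right_inv : (lift (trans h M)).comp (lift g) = LinearMap.id := hom_ext fun m => by
    rw [LinearMap.comp_apply, lift_mk, LinearMap.id_apply]
    exact (lift_mk _ _).trans (trans_mk h M m)
  exact Function.bijective_iff_has_inverse.2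
    ⟨lift g, LinearMap.congr_fun left_inv, LinearMap.congr_fun right_inv⟩

end Transitivity

theorem mk_bijective_of_ringEquiv {R S : Type u} [Ring R] [Ring S] (σ : R ≃+* S) (N : Type u)
    [AddCommGroup N] [Module R N] : Function.Bijective (mk (σ : R →+* S) N) := by
  let : Module S N := Module.compHom N (σ.symm : S →+* R)
  let t : N →ₛₗ[(σ : R →+* S)] N :=
    { toFun := id
      map_add' := fun _ _ => rfl
      map_smul' := fun r n => congrArg (· • n) (σ.symm_apply_apply r).symm }
  refine Function.bijective_iff_has_inverse.2 ⟨lift t, lift_mk t, fun x => ?_⟩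
  induction x using induction with
  | tmul s n =>
    obtain ⟨r, rfl⟩ := σ.surjective s
    rw [lift_tmul, ← smul_mk]
    refine (congrArg (mk (σ : R →+* S) N) ?_).trans ((mk (σ : R →+* S) N).map_smulₛₗ r n)
    exact congrArg (· • n) (σ.symm_apply_apply r)
  | add x y hx hy => rw [map_add, map_add, hx, hy]

end BaseChange

namespace FlatAsRightModule

theorem comp {A R S : Type u} [Ring A] [Ring R] [Ring S] {φ : R →+* S} {ψ : A →+* R}
    (hφ : FlatAsRightModule φ) (hψ : FlatAsRightModule ψ) : FlatAsRightModule (φ.comp ψ) := by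
  intro N N' _ _ _ _ f hf
  let e (M : Type u) [AddCommGroup M] [Module A M] :=
    BaseChange.lift (BaseChange.trans (φ := φ) (ι' := ψ) (ι := φ.comp ψ) (fun _ => rfl) M)
  have hf' : (BaseChange.map (φ.comp ψ) f).comp (e N) =
      (e N').comp (BaseChange.map φ (BaseChange.map ψ f)) := BaseChange.hom_ext fun y => by
    simp only [e, LinearMap.comp_apply, BaseChange.map_mk, BaseChange.lift_mk,
      BaseChange.trans_map]
  have he (M : Type u) [AddCommGroup M] [Module A M] : Function.Bijective (e M) :=
    BaseChange.lift_trans_bijective _ M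
  refine (Function.Injective.of_comp_iff' _ (he N)).1 ?_
  change Function.Injective ((BaseChange.map (φ.comp ψ) f).comp (e N))
  rw [hf']
  exact (he N').1.comp (hφ _ _ _ (hψ _ _ f hf))

theorem of_ringEquiv {R S : Type u} [Ring R] [Ring S] (σ : R ≃+* S) :
    FlatAsRightModule (σ : R →+* S) := by
  intro N N' _ _ _ _ f hf
  refine (Function.Injective.of_comp_iff' _ (BaseChange.mk_bijective_of_ringEquiv σ N)).1 ?_
  exact (BaseChange.mk_bijective_of_ringEquiv σ N').1.comp hf

theorem op_op {R S : Type u} [Ring R] [Ring S] {φ : R →+* S} (hφ : FlatAsRightModule φ) :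
    FlatAsRightModule φ.op.op := by
  have : φ.op.op = ((RingEquiv.opOp S : S →+* Sᵐᵒᵖᵐᵒᵖ).comp φ).comp
      ((RingEquiv.opOp R).symm : Rᵐᵒᵖᵐᵒᵖ →+* R) := RingHom.ext fun _ => rfl
  rw [this]
  exact ((of_ringEquiv (RingEquiv.opOp S)).comp hφ).comp (of_ringEquiv (RingEquiv.opOp R).symm)

end FlatAsRightModule

/-! ### Restriction of scalars on `Ext` groups -/

theorem exists_projective_presentation (R : Type u) [Ring R] (N : Type u) [AddCommGroup N]
    [Module R N] : ∃ (K P : Type u) (_ : AddCommGroup K) (_ : Module R K) (_ : AddCommGroup P)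
      (_ : Module R P) (i : K →ₗ[R] P) (p : P →ₗ[R] N), Module.Projective R P ∧
      Function.Injective i ∧ Function.Surjective p ∧ Function.Exact i p :=
  ⟨LinearMap.ker (Finsupp.linearCombination R (id : N → N)), N →₀ R, inferInstance, inferInstance,
    inferInstance, inferInstance, Submodule.subtype _, Finsupp.linearCombination R (id : N → N),
    inferInstance, Submodule.injective_subtype _, Finsupp.linearCombination_id_surjective R N,
    LinearMap.exact_subtype_ker_map _⟩

section Restriction

variable {R S : Type u} [Ring R] [Ring S] (φ : R →+* S)

/-- Restriction of scalars of an `S`-module along `φ : R → S`. -/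
def Restriction (_φ : R →+* S) (B : Type u) : Type u := B

variable (B B' : Type u) [AddCommGroup B] [Module S B] [AddCommGroup B'] [Module S B']

instance : AddCommGroup (Restriction φ B) := inferInstanceAs (AddCommGroup B)

instance : Module R (Restriction φ B) := Module.compHom B φ

variable {B B'}

/-- Restriction of scalars of a linear map. -/
def Restriction.map (f : B →ₗ[S] B') : Restriction φ B →ₗ[R] Restriction φ B' where
  toFun := f
  map_add' := map_add f
  map_smul' r x := f.map_smul (φ r) x

instance : Limits.PreservesFiniteLimits (ModuleCat.restrictScalars.{u} φ) := by
  have exact_map (T : ShortComplex (ModuleCat.{u} S)) (hT : T.Exact) :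
      (T.map (ModuleCat.restrictScalars.{u} φ)).Exact := by
    rw [ShortComplex.ShortExact.moduleCat_exact_iff_function_exact] at hT ⊢
    exact hT
  have := ((Functor.exact_tfae (ModuleCat.restrictScalars.{u} φ)).out 1 3).mp exact_map
  exact this.1

namespace ModExt

/-- The map induced by restriction of scalars on `Ext` groups. -/
def restriction (Y B : Type u) [AddCommGroup Y] [Module S Y] [AddCommGroup B] [Module S B]
    (l : ℕ) : ModExt S Y B l →+ ModExt R (Restriction φ Y) (Restriction φ B) l :=
  (ModuleCat.restrictScalars.{u} φ).mapExtAddHom (ModuleCat.of S Y) (ModuleCat.of S B) l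

variable {Y Y' Y'' : Type u} [AddCommGroup Y] [Module S Y] [AddCommGroup Y'] [Module S Y']
  [AddCommGroup Y''] [Module S Y'']

theorem restriction_mk₀ (f : Y →ₗ[S] B) :
    restriction φ Y B 0 (Ext.mk₀ (ModuleCat.ofHom f)) =
      Ext.mk₀ (ModuleCat.ofHom (Restriction.map φ f)) :=
  Ext.mapExactFunctor_mk₀ (ModuleCat.restrictScalars.{u} φ) (ModuleCat.ofHom f)

theorem restriction_precomp (l : ℕ) (f : Y →ₗ[S] Y') (x : ModExt S Y' B l) :
    restriction φ Y B l (precomp B l f x) =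
      precomp _ l (Restriction.map φ f) (restriction φ Y' B l x) := by
  refine (Ext.mapExactFunctor_comp (ModuleCat.restrictScalars.{u} φ)
    (Ext.mk₀ (ModuleCat.ofHom f)) x (zero_add l)).trans ?_
  rw [Ext.mapExactFunctor_mk₀]
  rfl

theorem restriction_postcomp (l : ℕ) (f : B →ₗ[S] B') (x : ModExt S Y B l) :
    restriction φ Y B' l (postcomp Y l f x) =
      postcomp _ l (Restriction.map φ f) (restriction φ Y B l x) := by
  refine (Ext.mapExactFunctor_comp (ModuleCat.restrictScalars.{u} φ)
    x (Ext.mk₀ (ModuleCat.ofHom f)) (add_zero l)).trans ?_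
  rw [Ext.mapExactFunctor_mk₀]
  rfl

theorem homEquiv_restriction (x : ModExt S Y B 0) :
    homEquiv (restriction φ Y B 0 x) = Restriction.map φ (homEquiv x) := by
  conv_lhs => rw [← mk₀_homEquiv x, restriction_mk₀, homEquiv_mk₀]
  rfl

theorem restriction_δ {f : Y →ₗ[S] Y'} {g : Y' →ₗ[S] Y''} (hf : Function.Injective f)
    (hg : Function.Surjective g) (hfg : Function.Exact f g) (l : ℕ) (x : ModExt S Y B l) :
    restriction φ Y'' B (l + 1) (δ hf hg hfg B l x) =
      δ (f := Restriction.map φ f) (g := Restriction.map φ g) hf hg hfg _ l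
        (restriction φ Y B l x) := by
  refine (Ext.mapExactFunctor_comp (ModuleCat.restrictScalars.{u} φ)
    (shortExact hf hg hfg).extClass x (add_comm 1 l)).trans ?_
  rw [Ext.mapExactFunctor_extClass]
  rfl

end ModExt

end Restriction

section Naturality

variable {R : Type u} [Ring R]
variable {N₁ N₂ N₃ M₁ M₂ M₃ : Type u} [AddCommGroup N₁] [Module R N₁] [AddCommGroup N₂]
  [Module R N₂] [AddCommGroup N₃] [Module R N₃] [AddCommGroup M₁] [Module R M₁] [AddCommGroup M₂]
  [Module R M₂] [AddCommGroup M₃] [Module R M₃]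
  {f : N₁ →ₗ[R] N₂} {g : N₂ →ₗ[R] N₃} (hf : Function.Injective f)
  (hg : Function.Surjective g) (hfg : Function.Exact f g)
  {f' : M₁ →ₗ[R] M₂} {g' : M₂ →ₗ[R] M₃} (hf' : Function.Injective f')
  (hg' : Function.Surjective g') (hfg' : Function.Exact f' g')
  (B : Type u) [AddCommGroup B] [Module R B]

theorem ModExt.δ_precomp (a : N₁ →ₗ[R] M₁) (b : N₂ →ₗ[R] M₂) (c : N₃ →ₗ[R] M₃)
    (h₁ : f' ∘ₗ a = b ∘ₗ f) (h₂ : g' ∘ₗ b = c ∘ₗ g) (l : ℕ) (x : ModExt R M₁ B l) :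
    δ hf hg hfg B l (precomp B l a x) = precomp B (l + 1) c (δ hf' hg' hfg' B l x) := by
  let t : shortComplex hfg ⟶ shortComplex hfg' :=
    { τ₁ := ModuleCat.ofHom a, τ₂ := ModuleCat.ofHom b, τ₃ := ModuleCat.ofHom c
      comm₁₂ := by
        change ModuleCat.ofHom (f' ∘ₗ a) = ModuleCat.ofHom (b ∘ₗ f)
        rw [h₁]
      comm₂₃ := by
        change ModuleCat.ofHom (g' ∘ₗ b) = ModuleCat.ofHom (c ∘ₗ g)
        rw [h₂] }
  have extClass_naturality := ShortComplex.ShortExact.extClass_naturality (shortExact hf hg hfg)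
    (shortExact hf' hg' hfg') t
  have assoc_left := Ext.comp_assoc (shortExact hf hg hfg).extClass (Ext.mk₀ (ModuleCat.ofHom a)) x
    (add_zero 1) (zero_add l) (show 1 + 0 + l = l + 1 by omega)
  have assoc_right := Ext.comp_assoc (Ext.mk₀ (ModuleCat.ofHom c))
    (shortExact hf' hg' hfg').extClass x (zero_add 1) (add_comm 1 l)
    (show 0 + 1 + l = l + 1 by omega)
  exact assoc_left.symm.trans
    ((congrArg (fun z => Ext.comp z x (add_comm 1 l)) extClass_naturality).trans assoc_right)

end Naturality

section Adjunction

variable {R S : Type u} [Ring R] [Ring S] (φ : R →+* S)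
variable {N N' N'' : Type u} [AddCommGroup N] [Module R N] [AddCommGroup N'] [Module R N']
  [AddCommGroup N''] [Module R N'']

/-- The unit `N → S ⊗_R N`, as an `R`-linear map. -/
def BaseChange.unit (N : Type u) [AddCommGroup N] [Module R N] :
    N →ₗ[R] Restriction φ (BaseChange φ N) where
  toFun := mk φ N
  map_add' := map_add _
  map_smul' r n := (mk φ N).map_smulₛₗ r n

namespace ModExt

variable (N) (B : Type u) [AddCommGroup B] [Module S B]

/-- The comparison map `Ext^l_S(S ⊗_R N, B) → Ext^l_R(N, B)`. -/
def ofBaseChange (l : ℕ) : ModExt S (BaseChange φ N) B l →+ ModExt R N (Restriction φ B) l :=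
  (precomp _ l (BaseChange.unit φ N)).comp (restriction φ _ _ l)

variable {N B}

theorem ofBaseChange_postcomp {B' : Type u} [AddCommGroup B'] [Module S B'] (l : ℕ)
    (f : B →ₗ[S] B') (x : ModExt S (BaseChange φ N) B l) :
    ofBaseChange φ N B' l (postcomp _ l f x) =
      postcomp _ l (Restriction.map φ f) (ofBaseChange φ N B l x) := by
  simp only [ofBaseChange, AddMonoidHom.comp_apply, restriction_postcomp, postcomp_precomp]

theorem ofBaseChange_precomp (l : ℕ) (f : N →ₗ[R] N') (x : ModExt S (BaseChange φ N') B l) :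
    ofBaseChange φ N B l (precomp _ l (BaseChange.map φ f) x) =
      precomp _ l f (ofBaseChange φ N' B l x) := by
  simp only [ofBaseChange, AddMonoidHom.comp_apply, restriction_precomp, ← precomp_comp]
  rfl

theorem homEquiv_ofBaseChange (x : ModExt S (BaseChange φ N) B 0) (n : N) :
    homEquiv (ofBaseChange φ N B 0 x) n = homEquiv x (BaseChange.mk φ N n) := by
  rw [ofBaseChange, AddMonoidHom.comp_apply, homEquiv_precomp, homEquiv_restriction]
  rfl

theorem ofBaseChange_δ {f : N →ₗ[R] N'} {g : N' →ₗ[R] N''} (hf : Function.Injective f)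
    (hg : Function.Surjective g) (hfg : Function.Exact f g)
    (hf' : Function.Injective (BaseChange.map φ f))
    (hg' : Function.Surjective (BaseChange.map φ g))
    (hfg' : Function.Exact (BaseChange.map φ f) (BaseChange.map φ g))
    (l : ℕ) (x : ModExt S (BaseChange φ N) B l) :
    ofBaseChange φ N'' B (l + 1) (δ hf' hg' hfg' B l x) =
      δ hf hg hfg _ l (ofBaseChange φ N B l x) := by
  simp only [ofBaseChange, AddMonoidHom.comp_apply, restriction_δ]
  rw [δ_precomp hf hg hfg (f' := Restriction.map φ (BaseChange.map φ f))
    (g' := Restriction.map φ (BaseChange.map φ g)) hf' hg' hfg' _ _ (BaseChange.unit φ N')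
    (BaseChange.unit φ N'')]
  · rfl
  · rfl

theorem ofBaseChange_zero_bijective : Function.Bijective (ofBaseChange φ N B 0) := by
  constructor
  · refine (injective_iff_map_eq_zero _).2 fun x hx => homEquiv.injective ?_
    refine BaseChange.hom_ext fun n => ?_
    rw [← homEquiv_ofBaseChange, hx, map_zero, map_zero]
    rfl
  · intro y
    let f : N →ₛₗ[φ] B :=
      { toFun := homEquiv y, map_add' := map_add (homEquiv y), map_smul' := (homEquiv y).map_smul }
    refine ⟨homEquiv.symm (BaseChange.lift f), homEquiv.injective ?_⟩
    ext n
    rw [homEquiv_ofBaseChange, AddEquiv.apply_symm_apply, BaseChange.lift_mk]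
    rfl

theorem ofBaseChange_bijective (hφ : FlatAsRightModule φ) (l : ℕ) (N : Type u) [AddCommGroup N]
    [Module R N] : Function.Bijective (ofBaseChange φ N B l) := by
  induction l generalizing N with
  | zero => exact ofBaseChange_zero_bijective φ
  | succ l ih =>
    obtain ⟨K, P, _, _, _, _, i, p, _, hi, hp, hip⟩ := exists_projective_presentation R N
    have hi' : Function.Injective (BaseChange.map φ i) := hφ _ _ i hi
    have hp' := BaseChange.map_surjective φ hp
    have hip' := BaseChange.map_exact φ hip hp
    have := subsingleton_of_projective (R := S) (N := BaseChange φ P) (B := B) l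
    have := subsingleton_of_projective (R := R) (N := P) (B := Restriction φ B) l
    exact AddMonoidHom.bijective_of_surjective_of_bijective_of_right_exact
      (precomp B l (BaseChange.map φ i)) (δ hi' hp' hip' B l) (precomp _ l i) (δ hi hp hip _ l)
      (ofBaseChange φ P B l) (ofBaseChange φ K B l) (ofBaseChange φ N B (l + 1))
      (AddMonoidHom.ext fun x => (ofBaseChange_precomp φ l i x).symm)
      (AddMonoidHom.ext fun x => (ofBaseChange_δ φ hi hp hip hi' hp' hip' l x).symm)
      (exact_precomp_δ hi' hp' hip' l) (exact_precomp_δ hi hp hip l) (ih P).2 (ih K)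
      (fun y => (exact_δ_precomp hi' hp' hip' l y).1 (Subsingleton.elim _ _))
      (fun y => (exact_δ_precomp hi hp hip l y).1 (Subsingleton.elim _ _))

end ModExt

end Adjunction

section Product

variable {R : Type u} [Ring R]

theorem exact_piMap {J : Type*} {X Y Z : J → Type*} [∀ n, Zero (Z n)] {f : ∀ n, X n → Y n}
    {g : ∀ n, Y n → Z n} (h : ∀ n, Function.Exact (f n) (g n)) :
    Function.Exact (Pi.map f) (Pi.map g) := by
  refine fun y => ⟨fun hy => ?_, ?_⟩
  · choose x hx using fun n => (h n (y n)).1 (congrFun hy n)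
    exact ⟨x, funext hx⟩
  · rintro ⟨x, rfl⟩
    exact funext fun n => (h n _).2 ⟨x n, rfl⟩

namespace ModExt

variable {J : Type} (B : J → Type u) [∀ n, AddCommGroup (B n)] [∀ n, Module R (B n)]

/-- The comparison map `Ext^l_R(N, ∏ B_n) → ∏ Ext^l_R(N, B_n)`. -/
def piMap (N : Type u) [AddCommGroup N] [Module R N] (l : ℕ) :
    ModExt R N (∀ n, B n) l →+ ∀ n, ModExt R N (B n) l :=
  AddMonoidHom.mk' (fun x n => postcomp N l (LinearMap.proj (R := R) (φ := B) n) x) fun x y => by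
    ext n; simp

theorem piMap_apply (N : Type u) [AddCommGroup N] [Module R N] (l : ℕ)
    (x : ModExt R N (∀ n, B n) l) (n : J) :
    piMap (R := R) B N l x n = postcomp N l (LinearMap.proj (R := R) (φ := B) n) x := rfl

theorem piMap_zero_bijective (N : Type u) [AddCommGroup N] [Module R N] :
    Function.Bijective (piMap (R := R) B N 0) := by
  constructor
  · refine (injective_iff_map_eq_zero _).2 fun x hx => homEquiv.injective ?_
    ext m n
    have h := LinearMap.congr_fun (congrArg homEquiv (congrFun hx n)) m
    simpa [piMap_apply, homEquiv_postcomp] using h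
  · intro y
    refine ⟨homEquiv.symm (LinearMap.pi fun n => homEquiv (y n)), funext fun n => ?_⟩
    apply homEquiv.injective
    rw [piMap_apply, homEquiv_postcomp, AddEquiv.apply_symm_apply]
    rfl

theorem piMap_bijective (l : ℕ) (N : Type u) [AddCommGroup N] [Module R N] :
    Function.Bijective (piMap (R := R) B N l) := by
  induction l generalizing N with
  | zero => exact piMap_zero_bijective B N
  | succ l ih =>
    obtain ⟨K, P, _, _, _, _, i, p, _, hi, hp, hip⟩ := exists_projective_presentation R N
    have := subsingleton_of_projective (R := R) (N := P) (B := ∀ n, B n) l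
    have (n : J) := subsingleton_of_projective (R := R) (N := P) (B := B n) l
    refine AddMonoidHom.bijective_of_surjective_of_bijective_of_right_exact
      (precomp (∀ n, B n) l i) (δ hi hp hip _ l) (AddMonoidHom.piMap fun n => precomp (B n) l i)
      (AddMonoidHom.piMap fun n => δ hi hp hip (B n) l) (piMap B P l) (piMap B K l)
      (piMap B N (l + 1)) (AddMonoidHom.ext fun x => funext fun n => ?_)
      (AddMonoidHom.ext fun x => funext fun n => ?_) (exact_precomp_δ hi hp hip l)
      (exact_piMap fun n => exact_precomp_δ hi hp hip l) (ih P).2 (ih K)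
      (fun y => (exact_δ_precomp hi hp hip l y).1 (Subsingleton.elim _ _))
      (Function.Surjective.piMap fun n y =>
        (exact_δ_precomp hi hp hip l y).1 (Subsingleton.elim _ _))
    · change precomp (B n) l i (piMap B P l x n) = piMap B K l (precomp _ l i x) n
      rw [piMap_apply, piMap_apply, postcomp_precomp]
    · change δ hi hp hip (B n) l (piMap B K l x n) = piMap B N (l + 1) (δ hi hp hip _ l x) n
      rw [piMap_apply, piMap_apply, δ_postcomp]

end ModExt

end Product

/-! ### The groups `Ext^l_R(N, S)` for a ring homomorphism `R → S` -/

section ExtAlong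

variable {R S : Type u} [Ring R] [Ring S] (φ : R →+* S)

namespace Restriction

/-- Right multiplication on `S`, as an `R`-linear map. -/
def mulRight (s : S) : Restriction φ S →ₗ[R] Restriction φ S :=
  Restriction.map φ (LinearMap.toSpanSingleton S S s)

theorem mulRight_one : mulRight φ 1 = LinearMap.id :=
  LinearMap.ext fun x => mul_one (M := S) x

theorem mulRight_zero : mulRight φ 0 = 0 :=
  LinearMap.ext fun x => mul_zero (M₀ := S) x

theorem mulRight_add (s t : S) :
    mulRight φ (s + t) = mulRight φ s + mulRight φ t :=
  LinearMap.ext fun x => mul_add (R := S) x s t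

theorem mulRight_mul (s t : S) :
    mulRight φ (s * t) = mulRight φ t ∘ₗ mulRight φ s :=
  LinearMap.ext fun x => (mul_assoc (G := S) x s t).symm

/-- `φ` as an `R`-linear map. -/
def ofRing : R →ₗ[R] Restriction φ S where
  toFun := φ
  map_add' := map_add φ
  map_smul' := map_mul φ

/-- Semilinear maps to `S` are linear maps to the restriction of scalars of `S`. -/
def semilinearEquiv {N : Type u} [AddCommGroup N] [Module R N] :
    (N →ₗ[R] Restriction φ S) ≃+ (N →ₛₗ[φ] S) where
  toFun f := { toFun := f, map_add' := map_add f, map_smul' := f.map_smul }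
  invFun f := { toFun := f, map_add' := map_add f, map_smul' := f.map_smulₛₗ }
  left_inv _ := rfl
  right_inv _ := rfl
  map_add' _ _ := rfl

section Trans

variable {A : Type u} [Ring A] {ι' : A →+* R} {ι : A →+* S} {φ} (h : ∀ a, φ (ι' a) = ι a)

/-- `φ : R → S` as an `A`-linear map. -/
def ofTower : Restriction ι' R →ₗ[A] Restriction ι S where
  toFun := φ
  map_add' := map_add φ
  map_smul' a (x : R) := (map_mul φ (ι' a) x).trans (congrArg (· * φ x) (h a))

/-- Iterated restriction of scalars is restriction along the composite. -/
def transEquiv : Restriction ι' (Restriction φ S) ≃ₗ[A] Restriction ι S where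
  __ := AddEquiv.refl S
  map_smul' a (x : S) := congrArg (· * x) (h a)

end Trans

end Restriction

/-- The group `Ext^l_R(N, S)`, which is a right `S`-module. -/
def ExtAlong (N : Type u) [AddCommGroup N] [Module R N] (l : ℕ) : Type u :=
  ModExt R N (Restriction φ S) l

variable (N N' N'' : Type u) [AddCommGroup N] [Module R N] [AddCommGroup N'] [Module R N']
  [AddCommGroup N''] [Module R N'']

instance (l : ℕ) : AddCommGroup (ExtAlong φ N l) := inferInstanceAs (AddCommGroup (ModExt R N _ l))

open Restriction in
instance (l : ℕ) : Module Sᵐᵒᵖ (ExtAlong φ N l) where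
  smul s x := ModExt.postcomp N l (mulRight φ s.unop) x
  one_smul x := (congrArg (fun f => ModExt.postcomp N l f x) (mulRight_one φ)).trans
    (ModExt.postcomp_id l x)
  mul_smul s t x := (congrArg (fun f => ModExt.postcomp N l f x)
    (mulRight_mul φ t.unop s.unop)).trans (ModExt.postcomp_comp l _ _ x)
  smul_zero s := map_zero (ModExt.postcomp N l (mulRight φ s.unop))
  smul_add s := map_add (ModExt.postcomp N l (mulRight φ s.unop))
  add_smul s t x := (congrArg (fun f => ModExt.postcomp N l f x)
    (mulRight_add φ s.unop t.unop)).trans (ModExt.postcomp_add l _ _ x)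
  zero_smul x := (congrArg (fun f => ModExt.postcomp N l f x) (mulRight_zero φ)).trans
    (ModExt.postcomp_zero l x)

namespace ExtAlong

variable {N N' N''}

/-- Contravariant functoriality of `Ext^l_R(-, S)`. -/
def map (l : ℕ) (f : N →ₗ[R] N') : ExtAlong φ N' l →ₗ[Sᵐᵒᵖ] ExtAlong φ N l where
  toFun := ModExt.precomp _ l f
  map_add' := map_add _
  map_smul' _ x := (ModExt.postcomp_precomp l f _ x).symm

/-- `Ext^0_R(N, S)` consists of the semilinear maps `N → S`. -/
def homEquiv : ExtAlong φ N 0 ≃+ (N →ₛₗ[φ] S) :=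
  (ModExt.homEquiv : ModExt R N (Restriction φ S) 0 ≃+ _).trans (Restriction.semilinearEquiv φ)

theorem homEquiv_smul (s : Sᵐᵒᵖ) (x : ExtAlong φ N 0) (n : N) :
    homEquiv φ (s • x) n = homEquiv φ x n * s.unop :=
  LinearMap.congr_fun (ModExt.homEquiv_postcomp (Restriction.mulRight φ s.unop) x) n

variable (N) in
/-- The comparison `Ext^l_S(S ⊗_R N, S) → Ext^l_R(N, S)`, as a linear map. -/
def ofBaseChange (l : ℕ) : ExtDual S (BaseChange φ N) l →ₗ[Sᵐᵒᵖ] ExtAlong φ N l where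
  toFun := ModExt.ofBaseChange φ N S l
  map_add' := map_add _
  map_smul' r x := ModExt.ofBaseChange_postcomp φ l (LinearMap.toSpanSingleton S S r.unop) x

variable (N) in
/-- `Ext^l_S(S ⊗_R N, S) = Ext^l_R(N, S)` if `S` is right flat over `R`. -/
def ofBaseChangeEquiv (hφ : FlatAsRightModule φ) (l : ℕ) :
    ExtDual S (BaseChange φ N) l ≃ₗ[Sᵐᵒᵖ] ExtAlong φ N l :=
  LinearEquiv.ofBijective (ofBaseChange φ N l) (ModExt.ofBaseChange_bijective φ hφ l N)

variable (N) in
/-- The semilinear map `Ext^l_R(N, R) → Ext^l_R(N, S)` induced by `φ`. -/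
def ofDual (l : ℕ) : ExtDual R N l →ₛₗ[RingHom.op φ] ExtAlong φ N l where
  toFun := ModExt.postcomp N l (Restriction.ofRing φ)
  map_add' := map_add _
  map_smul' r x := by
    have hcomm : Restriction.ofRing φ ∘ₗ LinearMap.toSpanSingleton R R r.unop =
        Restriction.mulRight φ (φ r.unop) ∘ₗ Restriction.ofRing φ :=
      LinearMap.ext fun x => φ.map_mul x _
    exact (ModExt.postcomp_comp (B' := R) l _ _ x).symm.trans
      ((congrArg (fun f => ModExt.postcomp N l f x) hcomm).trans (ModExt.postcomp_comp l _ _ x))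

theorem ofDual_map (l : ℕ) (f : N →ₗ[R] N') (x : ExtDual R N' l) :
    ofDual φ N l (ExtDual.map l f x) = map φ l f (ofDual φ N' l x) :=
  ModExt.postcomp_precomp l f (Restriction.ofRing φ) x

theorem homEquiv_ofDual (x : ExtDual R N 0) (n : N) :
    homEquiv φ (ofDual φ N 0 x) n = φ (ExtDual.homEquiv x n) :=
  LinearMap.congr_fun (ModExt.homEquiv_postcomp (Restriction.ofRing φ) x) n

section Trans

variable {A : Type u} [Ring A] {ι' : A →+* R} {ι : A →+* S} {φ} (h : ∀ a, φ (ι' a) = ι a)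
variable (M : Type u) [AddCommGroup M] [Module A M]

/-- The semilinear map `Ext^l_A(M, R) → Ext^l_A(M, S)` induced by `R → S`. -/
def trans (l : ℕ) : ExtAlong ι' M l →ₛₗ[RingHom.op φ] ExtAlong ι M l where
  toFun := ModExt.postcomp M l (Restriction.ofTower h)
  map_add' := map_add _
  map_smul' r x := by
    have hcomm : Restriction.ofTower h ∘ₗ Restriction.mulRight ι' r.unop =
        Restriction.mulRight ι (φ r.unop) ∘ₗ Restriction.ofTower h :=
      LinearMap.ext fun x => φ.map_mul x _
    exact (ModExt.postcomp_comp l _ _ x).symm.trans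
      ((congrArg (fun f => ModExt.postcomp M l f x) hcomm).trans (ModExt.postcomp_comp l _ _ x))

/-- The additive map underlying `ExtAlong.ofBaseChangeTower`. -/
def ofBaseChangeTowerHom (l : ℕ) :
    ModExt R (BaseChange ι' M) (Restriction φ S) l →+ ModExt A M (Restriction ι S) l :=
  (ModExt.postcomp M l (Restriction.transEquiv h).toLinearMap).comp
    (ModExt.ofBaseChange ι' M (Restriction φ S) l)

theorem ofBaseChangeTowerHom_postcomp (l : ℕ) (s : S)
    (x : ModExt R (BaseChange ι' M) (Restriction φ S) l) :
    ofBaseChangeTowerHom h M l (ModExt.postcomp _ l (Restriction.mulRight φ s) x) =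
      ModExt.postcomp M l (Restriction.mulRight ι s) (ofBaseChangeTowerHom h M l x) := by
  simp only [ofBaseChangeTowerHom, AddMonoidHom.comp_apply, ModExt.ofBaseChange_postcomp,
    ← ModExt.postcomp_comp]
  rfl

theorem ofBaseChangeTowerHom_ofRing (l : ℕ) (x : ModExt R (BaseChange ι' M) R l) :
    ofBaseChangeTowerHom h M l (ModExt.postcomp _ l (Restriction.ofRing φ) x) =
      ModExt.postcomp M l (Restriction.ofTower h) (ModExt.ofBaseChange ι' M R l x) := by
  rw [ofBaseChangeTowerHom, AddMonoidHom.comp_apply, ModExt.ofBaseChange_postcomp,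
    ← ModExt.postcomp_comp]
  rfl

/-- The comparison map `Ext^l_R(R ⊗_A M, S) → Ext^l_A(M, S)`. -/
def ofBaseChangeTower (l : ℕ) : ExtAlong φ (BaseChange ι' M) l →ₗ[Sᵐᵒᵖ] ExtAlong ι M l where
  toFun := ofBaseChangeTowerHom h M l
  map_add' := map_add (ofBaseChangeTowerHom h M l)
  map_smul' s x := ofBaseChangeTowerHom_postcomp h M l s.unop x

/-- `Ext^l_R(R ⊗_A M, S) = Ext^l_A(M, S)` if `R` is right flat over `A`. -/
def ofBaseChangeTowerEquiv (hι : FlatAsRightModule ι') (l : ℕ) :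
    ExtAlong φ (BaseChange ι' M) l ≃ₗ[Sᵐᵒᵖ] ExtAlong ι M l :=
  LinearEquiv.ofBijective (ofBaseChangeTower h M l)
    ((ModExt.postcomp_bijective (N := M) (Restriction.transEquiv h) l).comp
      (ModExt.ofBaseChange_bijective ι' hι l M))

theorem trans_ofBaseChangeEquiv (hι : FlatAsRightModule ι') (l : ℕ)
    (x : ExtDual R (BaseChange ι' M) l) :
    trans h M l (ofBaseChangeEquiv ι' M hι l x) =
      ofBaseChangeTowerEquiv h M hι l (ofDual φ _ l x) :=
  (ofBaseChangeTowerHom_ofRing h M l x).symm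

end Trans

end ExtAlong

end ExtAlong

section Finite

variable {R : Type u} [Ring R]

theorem exists_dualBasis (P : Type u) [AddCommGroup P] [Module R P] [Module.Finite R P]
    [Module.Projective R P] : ∃ (k : ℕ) (x : Fin k → P) (f : Fin k → P →ₗ[R] R),
      ∀ p, ∑ i, f i p • x i = p := by
  obtain ⟨k, π, s, -, -, hπs⟩ := Module.Finite.exists_comp_eq_id_of_projective R P
  refine ⟨k, fun i => π (Pi.single i 1), fun i => LinearMap.proj i ∘ₗ s, fun p => ?_⟩
  conv_rhs => rw [← LinearMap.id_apply (R := R) p, ← hπs]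
  rw [LinearMap.comp_apply, pi_eq_sum_univ' (s p), map_sum]
  refine Finset.sum_congr rfl fun i _ => ?_
  simp only [LinearMap.comp_apply, LinearMap.proj_apply, map_smul]

theorem ExtDual.exists_dualBasis (P : Type u) [AddCommGroup P] [Module R P] [Module.Finite R P]
    [Module.Projective R P] : ∃ (k : ℕ) (x : Fin k → P) (e : Fin k → ExtDual R P 0),
      (∀ p, ∑ i, ExtDual.homEquiv (e i) p • x i = p) ∧
      ∀ g, g = ∑ i, MulOpposite.op (ExtDual.homEquiv g (x i)) • e i := by
  obtain ⟨k, x, f, hf⟩ := _root_.exists_dualBasis (R := R) P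
  refine ⟨k, x, fun i => ExtDual.homEquiv.symm (f i), by simpa using hf, fun g => ?_⟩
  apply ExtDual.homEquiv.injective
  ext p
  rw [map_sum, LinearMap.sum_apply]
  conv_lhs => rw [← hf p, map_sum]
  refine Finset.sum_congr rfl fun i _ => ?_
  rw [ExtDual.homEquiv_smul, map_smul]
  simp

theorem exists_finite_presentation [IsNoetherianRing R] (N : Type u) [AddCommGroup N] [Module R N]
    [Module.Finite R N] : ∃ (K P : Type u) (_ : AddCommGroup K) (_ : Module R K)
      (_ : AddCommGroup P) (_ : Module R P) (i : K →ₗ[R] P) (p : P →ₗ[R] N),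
      Module.Projective R P ∧ Module.Finite R P ∧ Module.Finite R K ∧
      Function.Injective i ∧ Function.Surjective p ∧ Function.Exact i p := by
  obtain ⟨k, p, hp⟩ := Module.Finite.exists_fin' R N
  exact ⟨LinearMap.ker p, Fin k → R, inferInstance, inferInstance, inferInstance, inferInstance,
    Submodule.subtype _, p, inferInstance, inferInstance, inferInstance,
    Submodule.injective_subtype _, hp, LinearMap.exact_subtype_ker_map p⟩

end Finite

section FlatBaseChange

variable {R S : Type u} [Ring R] [Ring S] (φ : R →+* S)

namespace ExtAlong

open BaseChange (mk lift lift_mk lift_tmul smul_mk map_mk map_exact map_surjective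
  lift_bijective_congr hom_ext map_tmul)

theorem lift_ofDual_map {N N' : Type u} [AddCommGroup N] [Module R N] [AddCommGroup N']
    [Module R N'] (l : ℕ) (f : N →ₗ[R] N')
    (x : BaseChange (RingHom.op φ) (ExtDual R N' l)) :
    lift (ofDual φ N l) (BaseChange.map _ (ExtDual.map l f) x) =
      map φ l f (lift (ofDual φ N' l) x) := by
  have h : (lift (ofDual φ N l)).comp (BaseChange.map _ (ExtDual.map l f)) =
      (map φ l f).comp (lift (ofDual φ N' l)) := hom_ext fun n => by
    simp only [LinearMap.comp_apply, map_mk, lift_mk, ofDual_map]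
  exact LinearMap.congr_fun h x

theorem lift_ofDual_δ {K P N : Type u} [AddCommGroup K] [Module R K] [AddCommGroup P]
    [Module R P] [AddCommGroup N] [Module R N] {i : K →ₗ[R] P} {p : P →ₗ[R] N}
    (hi : Function.Injective i) (hp : Function.Surjective p) (hip : Function.Exact i p) (l : ℕ)
    (x : BaseChange (RingHom.op φ) (ExtDual R K l)) :
    lift (ofDual φ N (l + 1)) (BaseChange.map _ (ExtDual.δ hi hp hip l) x) =
      ModExt.δ hi hp hip (Restriction φ S) l (lift (ofDual φ K l) x) := by
  induction x using BaseChange.induction with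
  | tmul s n =>
    rw [map_tmul, lift_tmul, lift_tmul]
    have h : ofDual φ N (l + 1) (ExtDual.δ hi hp hip l n) =
        ModExt.δ hi hp hip (Restriction φ S) l (ofDual φ K l n) :=
      (ModExt.δ_postcomp hi hp hip l (Restriction.ofRing φ) n).symm
    rw [h]
    exact (ModExt.δ_postcomp hi hp hip l (Restriction.mulRight φ s.unop) _).symm
  | add a b ha hb =>
    rw [map_add, map_add, map_add, ha, hb]
    exact (map_add (ModExt.δ hi hp hip (Restriction φ S) l) _ _).symm

theorem lift_ofDual_bijective_of_projective (P : Type u) [AddCommGroup P] [Module R P]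
    [Module.Finite R P] [Module.Projective R P] :
    Function.Bijective (lift (ofDual φ P 0)) := by
  obtain ⟨k, x, e, hf, he⟩ := ExtDual.exists_dualBasis (R := R) P
  let inv (y : ExtAlong φ P 0) : BaseChange (RingHom.op φ) (ExtDual R P 0) :=
    ∑ i, MulOpposite.op (homEquiv φ y (x i)) • mk (RingHom.op φ) _ (e i)
  refine Function.bijective_iff_has_inverse.2 ⟨inv, fun y => ?_, fun y => ?_⟩
  · induction y using BaseChange.induction with
    | tmul s g =>
      rw [← smul_mk]
      conv_rhs => rw [he g, map_sum, Finset.smul_sum]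
      refine Finset.sum_congr rfl fun i _ => ?_
      rw [(lift _).map_smul, homEquiv_smul, lift_mk, homEquiv_ofDual, (mk _ _).map_smulₛₗ,
        smul_smul]
      rfl
    | add a b ha hb =>
      conv_rhs => rw [← ha, ← hb, ← Finset.sum_add_distrib]
      refine Finset.sum_congr rfl fun i _ => ?_
      rw [← add_smul, map_add, map_add]
      rfl
  · apply (homEquiv φ).injective
    ext p
    rw [map_sum, map_sum, LinearMap.sum_apply]
    conv_rhs => rw [← hf p, map_sum]
    refine Finset.sum_congr rfl fun i _ => ?_
    rw [(lift _).map_smul, homEquiv_smul, lift_mk, homEquiv_ofDual, (homEquiv φ y).map_smulₛₗ]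
    rfl

theorem lift_ofDual_zero_injective [IsNoetherianRing R]
    (hφ : FlatAsRightModule (RingHom.op φ)) (N : Type u) [AddCommGroup N] [Module R N]
    [Module.Finite R N] : Function.Injective (lift (ofDual φ N 0)) := by
  obtain ⟨K, P, _, _, _, _, -, p, _, _, -, -, hp, -⟩ := exists_finite_presentation (R := R) N
  have h : Function.Injective (map φ 0 p ∘ lift (ofDual φ N 0)) := by
    rw [show map φ 0 p ∘ lift (ofDual φ N 0) =
      lift (ofDual φ P 0) ∘ BaseChange.map _ (ExtDual.map 0 p) from
      funext fun x => (lift_ofDual_map φ 0 p x).symm]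
    exact (lift_ofDual_bijective_of_projective φ P).1.comp
      (hφ _ _ _ (ExtDual.map_injective_of_surjective hp))
  exact h.of_comp

theorem lift_ofDual_zero_surjective [IsNoetherianRing R]
    (hφ : FlatAsRightModule (RingHom.op φ)) (N : Type u) [AddCommGroup N] [Module R N]
    [Module.Finite R N] : Function.Surjective (lift (ofDual φ N 0)) := by
  intro y
  obtain ⟨K, P, _, _, _, _, i, p, _, _, _, hi, hp, hip⟩ := exists_finite_presentation (R := R) N
  obtain ⟨z, hz⟩ := (lift_ofDual_bijective_of_projective φ P).2 (map φ 0 p y)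
  have hiz : BaseChange.map _ (ExtDual.map 0 i) z = 0 := by
    refine (injective_iff_map_eq_zero _).1 (lift_ofDual_zero_injective φ hφ K) _ ?_
    rw [lift_ofDual_map, hz]
    exact (ModExt.exact_precomp_precomp hi hp hip 0).apply_apply_eq_zero y
  obtain ⟨t, rfl⟩ := (hφ.map_exact (ExtDual.exact_map_map hi hp hip 0) z).1 hiz
  rw [lift_ofDual_map] at hz
  exact ⟨t, ModExt.precomp_injective_of_surjective hp hz⟩

theorem lift_ofDual_bijective [IsNoetherianRing R] (hφ : FlatAsRightModule (RingHom.op φ)) (l : ℕ)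
    (N : Type u) [AddCommGroup N] [Module R N] [Module.Finite R N] :
    Function.Bijective (lift (ofDual φ N l)) := by
  induction l generalizing N with
  | zero => exact ⟨lift_ofDual_zero_injective φ hφ N, lift_ofDual_zero_surjective φ hφ N⟩
  | succ l ih =>
    obtain ⟨K, P, _, _, _, _, i, p, _, _, _, hi, hp, hip⟩ := exists_finite_presentation (R := R) N
    have := ExtDual.subsingleton_of_projective (R := R) (N := P) l
    have := ModExt.subsingleton_of_projective (R := R) (N := P) (B := Restriction φ S) l
    have hδ : Function.Surjective (ExtDual.δ hi hp hip l) := fun y =>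
      (ExtDual.exact_δ_map hi hp hip l y).1 (Subsingleton.elim _ _)
    exact AddMonoidHom.bijective_of_surjective_of_bijective_of_right_exact
      (BaseChange.map (RingHom.op φ) (ExtDual.map l i)).toAddMonoidHom
      (BaseChange.map (RingHom.op φ) (ExtDual.δ hi hp hip l)).toAddMonoidHom
      (map φ l i).toAddMonoidHom (ModExt.δ hi hp hip (Restriction φ S) l)
      (lift (ofDual φ P l)).toAddMonoidHom (lift (ofDual φ K l)).toAddMonoidHom
      (lift (ofDual φ N (l + 1))).toAddMonoidHom
      (AddMonoidHom.ext fun x => (lift_ofDual_map φ l i x).symm)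
      (AddMonoidHom.ext fun x => (lift_ofDual_δ φ hi hp hip l x).symm)
      (map_exact (RingHom.op φ) (ExtDual.exact_map_δ hi hp hip l) hδ)
      (ModExt.exact_precomp_δ hi hp hip l) (ih P).2 (ih K) (map_surjective _ hδ)
      (fun y => (ModExt.exact_δ_precomp hi hp hip l y).1 (Subsingleton.elim _ _))

theorem lift_trans_bijective {A : Type u} [Ring A] {ι' : A →+* R} {ι : A →+* S} {φ : R →+* S}
    (h : ∀ a, φ (ι' a) = ι a) (M : Type u) [AddCommGroup M] [Module A M] [IsNoetherianRing R]
    (hι : FlatAsRightModule ι') (hφ : FlatAsRightModule (RingHom.op φ))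
    [Module.Finite R (BaseChange ι' M)] (l : ℕ) : Function.Bijective (lift (trans h M l)) :=
  lift_bijective_congr (ofBaseChangeEquiv ι' M hι l) (ofBaseChangeTowerEquiv h M hι l)
    (trans_ofBaseChangeEquiv h M hι l) (lift_ofDual_bijective φ hφ l _)

/-- Flat base change for `Ext^l_R(N, R)`. -/
def baseChangeEquiv [IsNoetherianRing R] (hφ : FlatAsRightModule φ)
    (hφ' : FlatAsRightModule (RingHom.op φ)) (N : Type u) [AddCommGroup N] [Module R N]
    [Module.Finite R N] (l : ℕ) :
    BaseChange (RingHom.op φ) (ExtDual R N l) ≃ₗ[Sᵐᵒᵖ] ExtDual S (BaseChange φ N) l :=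
  (LinearEquiv.ofBijective _ (lift_ofDual_bijective φ hφ' l N)).trans
    (ofBaseChangeEquiv φ N hφ l).symm

end ExtAlong

end FlatBaseChange

/-! ### Grades -/

theorem subsingleton_of_exact {A B C : Type*} [Zero C] {f : A → B} {g : B → C}
    (h : Function.Exact f g) [Subsingleton A] [Subsingleton C] : Subsingleton B :=
  ⟨fun x y => by
    obtain ⟨a, rfl⟩ := (h x).1 (Subsingleton.elim _ _)
    obtain ⟨b, rfl⟩ := (h y).1 (Subsingleton.elim _ _)
    rw [Subsingleton.elim a b]⟩

theorem exists_factor_of_surjective {R M N Q : Type*} [Ring R] [AddCommGroup M] [Module R M]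
    [AddCommGroup N] [Module R N] [AddCommGroup Q] [Module R Q] {g : M →ₗ[R] N} {f : M →ₗ[R] Q}
    (hg : Function.Surjective g) (h : ∀ x, g x = 0 → f x = 0) :
    ∃ t : N →ₗ[R] Q, ∀ x, t (g x) = f x := by
  refine ⟨(Submodule.liftQ (LinearMap.ker g) f h).comp
    (g.quotKerEquivOfSurjective hg).symm.toLinearMap, fun x => ?_⟩
  have hx : (g.quotKerEquivOfSurjective hg).symm (g x) = Submodule.Quotient.mk x :=
    (LinearEquiv.symm_apply_eq _).2 rfl
  rw [LinearMap.comp_apply, LinearEquiv.coe_coe, hx]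
  exact Submodule.liftQ_apply _ _ _

section Grade

variable (R : Type u) [Ring R]

/-- The grade of `N` is at least `l`. -/
def GradeGE (N : Type u) [AddCommGroup N] [Module R N] (l : ℕ) : Prop :=
  ∀ i < l, Subsingleton (ExtDual R N i)

variable {R}
variable {N N' N'' : Type u} [AddCommGroup N] [Module R N] [AddCommGroup N'] [Module R N']
  [AddCommGroup N''] [Module R N'']

theorem le_moduleGrade_iff {l : ℕ} : (l : ℕ∞) ≤ moduleGrade R N ↔ GradeGE R N l := by
  rw [moduleGrade]
  simp only [le_iInf_iff, Nat.cast_le, GradeGE]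
  refine forall_congr' fun i => ?_
  rw [← not_subsingleton_iff_nontrivial, ← not_lt]
  tauto

theorem GradeGE.mono {l m : ℕ} (h : GradeGE R N m) (hl : l ≤ m) : GradeGE R N l :=
  fun i hi => h i (hi.trans_le hl)

theorem GradeGE.congr {l : ℕ} (h : GradeGE R N l) (e : N ≃ₗ[R] N') : GradeGE R N' l := fun i hi =>
  have := h i hi
  (ExtDual.congr i e).toEquiv.subsingleton

theorem gradeGE_of_subsingleton [Subsingleton N] (l : ℕ) : GradeGE R N l := fun i _ =>
  ⟨fun x y => by
    have hid : (LinearMap.id : N →ₗ[R] N) = 0 := Subsingleton.elim _ _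
    rw [← ExtDual.map_id i x, ← ExtDual.map_id i y, hid, ExtDual.map_zero, ExtDual.map_zero]⟩

variable {f : N →ₗ[R] N'} {g : N' →ₗ[R] N''}

theorem GradeGE.extension (hf : Function.Injective f) (hg : Function.Surjective g)
    (hfg : Function.Exact f g) {l : ℕ} (h : GradeGE R N l) (h' : GradeGE R N'' l) :
    GradeGE R N' l := fun i hi =>
  have := h i hi
  have := h' i hi
  subsingleton_of_exact (ExtDual.exact_map_map hf hg hfg i)

theorem GradeGE.quotient (hf : Function.Injective f) (hg : Function.Surjective g)
    (hfg : Function.Exact f g) {l : ℕ} (h : GradeGE R N l) (h' : GradeGE R N' l) :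
    GradeGE R N'' l := fun i hi => by
  have := h' i hi
  cases i with
  | zero => exact (ExtDual.map_injective_of_surjective hg).subsingleton
  | succ i =>
    have := h i (by omega)
    exact subsingleton_of_exact (ExtDual.exact_δ_map hf hg hfg i)

end Grade

section RingIso

variable {R R' : Type u} [Ring R] [Ring R'] (σ : R ≃+* R')

/-- A ring isomorphism `R ≃ R'` identifies `R' ⊗_R N` with `N`. -/
def BaseChange.restrictionEquiv (N : Type u) [AddCommGroup N] [Module R' N] :
    BaseChange (σ : R →+* R') (Restriction (σ : R →+* R') N) ≃ₗ[R'] N :=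
  let f : Restriction (σ : R →+* R') N →ₛₗ[(σ : R →+* R')] N :=
    { toFun := id, map_add' := fun _ _ => rfl, map_smul' := fun _ _ => rfl }
  LinearEquiv.ofBijective (lift f) <| by
    refine (Function.Bijective.of_comp_iff _ (mk_bijective_of_ringEquiv σ _)).1 ?_
    rw [show lift f ∘ mk (σ : R →+* R') _ = id from funext (lift_mk f)]
    exact Function.bijective_id

theorem subsingleton_extDual_restriction_iff (N : Type u) [AddCommGroup N] [Module R' N] (l : ℕ) :
    Subsingleton (ExtDual R (Restriction (σ : R →+* R') N) l) ↔
      Subsingleton (ExtDual R' N l) := by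
  let e : R ≃ₗ[R] Restriction (σ : R →+* R') R' :=
    LinearEquiv.ofBijective (Restriction.ofRing (σ : R →+* R')) σ.bijective
  let toAlong : ExtDual R (Restriction (σ : R →+* R') N) l ≃
      ExtAlong (σ : R →+* R') (Restriction (σ : R →+* R') N) l :=
    Equiv.ofBijective _ (ModExt.postcomp_bijective e l)
  let ofExtDual : ExtDual R' N l ≃ ExtAlong (σ : R →+* R') (Restriction (σ : R →+* R') N) l :=
    ((ExtDual.congr l (BaseChange.restrictionEquiv σ N)).trans
      (ExtAlong.ofBaseChangeEquiv (σ : R →+* R') _ (FlatAsRightModule.of_ringEquiv σ) l)).toEquiv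
  exact (toAlong.trans ofExtDual.symm).subsingleton_congr

theorem gradeGE_restriction_iff (N : Type u) [AddCommGroup N] [Module R' N] (l : ℕ) :
    GradeGE R (Restriction (σ : R →+* R') N) l ↔ GradeGE R' N l :=
  forall₂_congr fun i _ => subsingleton_extDual_restriction_iff σ N i

end RingIso

/-! ### Duals of finite projective modules -/

section Bidual

variable {R : Type u} [Ring R]

instance ExtDual.finite_of_projective (P : Type u) [AddCommGroup P] [Module R P]
    [Module.Finite R P] [Module.Projective R P] : Module.Finite Rᵐᵒᵖ (ExtDual R P 0) := by
  obtain ⟨k, x, e, -, he⟩ := ExtDual.exists_dualBasis (R := R) P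
  refine Module.Finite.of_surjective (Fintype.linearCombination Rᵐᵒᵖ e) fun g => ?_
  exact ⟨fun i => MulOpposite.op (ExtDual.homEquiv g (x i)), (he g).symm⟩

instance ExtDual.projective (P : Type u) [AddCommGroup P] [Module R P]
    [Module.Finite R P] [Module.Projective R P] : Module.Projective Rᵐᵒᵖ (ExtDual R P 0) := by
  obtain ⟨k, x, e, -, he⟩ := ExtDual.exists_dualBasis (R := R) P
  let s : ExtDual R P 0 →ₗ[Rᵐᵒᵖ] (Fin k → Rᵐᵒᵖ) :=
    { toFun := fun g i => MulOpposite.op (ExtDual.homEquiv g (x i))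
      map_add' := fun g h => by ext i; simp
      map_smul' := fun r g => by
        ext i
        rw [ExtDual.homEquiv_smul]
        rfl }
  exact Module.Projective.of_split s (Fintype.linearCombination Rᵐᵒᵖ e)
    (LinearMap.ext fun g => (he g).symm)

instance ExtDual.finite [IsNoetherianRing R] [IsNoetherianRing Rᵐᵒᵖ] (N : Type u) [AddCommGroup N]
    [Module R N] [Module.Finite R N] (l : ℕ) : Module.Finite Rᵐᵒᵖ (ExtDual R N l) := by
  induction l generalizing N with
  | zero =>
    obtain ⟨k, p, hp⟩ := Module.Finite.exists_fin' R N
    have hinj := map_injective_of_surjective hp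
    exact Module.Finite.of_injective _ hinj
  | succ l ih =>
    obtain ⟨K, P, _, _, _, _, i, p, _, _, _, hi, hp, hip⟩ := exists_finite_presentation (R := R) N
    have := ih K
    have : Subsingleton (ExtDual R P (l + 1)) := ExtDual.subsingleton_of_projective l
    exact Module.Finite.of_surjective (ExtDual.δ hi hp hip l) fun y =>
      (ExtDual.exact_δ_map hi hp hip l y).1 (Subsingleton.elim _ _)

variable (R) in
/-- The isomorphism of `R` with its double opposite. -/
abbrev opOpHom : R →+* Rᵐᵒᵖᵐᵒᵖ := (RingEquiv.opOp R : R →+* Rᵐᵒᵖᵐᵒᵖ)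

/-- The double `Ext` module `Ext^l(Ext^l(N, R), R)`. -/
abbrev ExtExt (R : Type u) [Ring R] (N : Type u) [AddCommGroup N] [Module R N] (l : ℕ) : Type u :=
  ExtDual Rᵐᵒᵖ (ExtDual R N l) l

/-- Evaluation at `n`, as a linear form on the dual of `N`. -/
def evalHom {N : Type u} [AddCommGroup N] [Module R N] (n : N) :
    ExtDual R N 0 →ₗ[Rᵐᵒᵖ] Rᵐᵒᵖ where
  toFun x := MulOpposite.op (ExtDual.homEquiv x n)
  map_add' x y := by simp
  map_smul' r x := by rw [ExtDual.homEquiv_smul]; rfl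

theorem evalHom_apply {N : Type u} [AddCommGroup N] [Module R N] (n : N) (x : ExtDual R N 0) :
    evalHom n x = MulOpposite.op (ExtDual.homEquiv x n) := rfl

/-- The biduality map `N → N**`, semilinear along `R ≃ Rᵐᵒᵖᵐᵒᵖ`. -/
def bidual (N : Type u) [AddCommGroup N] [Module R N] : N →ₛₗ[opOpHom R] ExtExt R N 0 where
  toFun n := ExtDual.homEquiv.symm (evalHom n)
  map_add' m n := by
    rw [← map_add]
    congr 1
    ext1 x
    simp [evalHom_apply]
  map_smul' r n := by
    apply ExtDual.homEquiv.injective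
    ext1 x
    rw [ExtDual.homEquiv_smul]
    simp [evalHom_apply]

theorem homEquiv_bidual {N : Type u} [AddCommGroup N] [Module R N] (n : N) (x : ExtDual R N 0) :
    ExtDual.homEquiv (bidual N n) x = MulOpposite.op (ExtDual.homEquiv x n) := by
  have hb : bidual N n = ExtDual.homEquiv.symm (evalHom (R := R) n) := rfl
  rw [hb, AddEquiv.apply_symm_apply, evalHom_apply]

theorem map_map_bidual {N N' : Type u} [AddCommGroup N] [Module R N] [AddCommGroup N']
    [Module R N'] (f : N →ₗ[R] N') (n : N) :
    ExtDual.map 0 (ExtDual.map 0 f) (bidual N n) = bidual N' (f n) := by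
  apply ExtDual.homEquiv.injective
  ext1 x
  rw [ExtDual.homEquiv_map, LinearMap.comp_apply, homEquiv_bidual, homEquiv_bidual,
    ExtDual.homEquiv_map, LinearMap.comp_apply]

theorem bidual_bijective (P : Type u) [AddCommGroup P] [Module R P] [Module.Finite R P]
    [Module.Projective R P] : Function.Bijective (bidual (R := R) P) := by
  obtain ⟨k, x, e, hf, he⟩ := ExtDual.exists_dualBasis (R := R) P
  constructor
  · refine (injective_iff_map_eq_zero _).2 fun p hp => ?_
    rw [← hf p]
    refine Finset.sum_eq_zero fun i _ => ?_
    have hei := homEquiv_bidual p (e i)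
    rw [hp, map_zero, LinearMap.zero_apply, eq_comm, MulOpposite.op_eq_zero_iff] at hei
    rw [hei, zero_smul]
  · intro y
    refine ⟨∑ i, (ExtDual.homEquiv y (e i)).unop • x i, ?_⟩
    apply ExtDual.homEquiv.injective
    ext1 g
    rw [homEquiv_bidual]
    conv_rhs => rw [he g]
    rw [map_sum, map_sum, Finset.op_sum]
    refine Finset.sum_congr rfl fun i _ => ?_
    rw [map_smul, map_smul]
    rfl

end Bidual

/-! ### Finite projective resolutions -/

/-- A resolution by finite projective modules, cut into short exact sequences
`0 → X (n + 1) → P n → X n → 0`; it resolves `X 0`, and `X n` is the `n`-th syzygy. -/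
structure FiniteResolution (R : Type u) [Ring R] where
  X : ℕ → Type u
  P : ℕ → Type u
  [addCommGroupX : ∀ n, AddCommGroup (X n)]
  [moduleX : ∀ n, Module R (X n)]
  [addCommGroupP : ∀ n, AddCommGroup (P n)]
  [moduleP : ∀ n, Module R (P n)]
  [finiteX : ∀ n, Module.Finite R (X n)]
  [finiteP : ∀ n, Module.Finite R (P n)]
  [projectiveP : ∀ n, Module.Projective R (P n)]
  ι : ∀ n, X (n + 1) →ₗ[R] P n
  π : ∀ n, P n →ₗ[R] X n
  ι_injective : ∀ n, Function.Injective (ι n)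
  π_surjective : ∀ n, Function.Surjective (π n)
  exact : ∀ n, Function.Exact (ι n) (π n)

namespace FiniteResolution

attribute [instance] addCommGroupX moduleX addCommGroupP moduleP finiteX finiteP projectiveP

variable {R : Type u} [Ring R]

/-- A chosen surjection onto a finite module from a finite free module. -/
def cover (N : Type u) [AddCommGroup N] [Module R N] [Module.Finite R N] :
    (Fin (Module.Finite.exists_fin' R N).choose → R) →ₗ[R] N :=
  (Module.Finite.exists_fin' R N).choose_spec.choose

theorem cover_surjective (N : Type u) [AddCommGroup N] [Module R N] [Module.Finite R N] :
    Function.Surjective (cover (R := R) N) :=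
  (Module.Finite.exists_fin' R N).choose_spec.choose_spec

variable [IsNoetherianRing R]

/-- The iterated kernels of `cover`, starting from `N`. -/
def syzygy (N : ModuleCat.{u} R) [Module.Finite R N] :
    ℕ → {M : ModuleCat.{u} R // Module.Finite R M}
  | 0 => ⟨N, inferInstance⟩
  | n + 1 =>
    have := (syzygy N n).2
    ⟨ModuleCat.of R (LinearMap.ker (cover (R := R) (syzygy N n).1)), inferInstance⟩

/-- The resolution of a finite module over a noetherian ring by its iterated covers. -/
def ofFinite (N : ModuleCat.{u} R) [Module.Finite R N] : FiniteResolution R :=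
  have (n : ℕ) : Module.Finite R (syzygy N n).1 := (syzygy N n).2
  { X := fun n => (syzygy N n).1
    P := fun n => Fin (Module.Finite.exists_fin' R (syzygy N n).1).choose → R
    ι := fun n => (LinearMap.ker (cover (R := R) (syzygy N n).1)).subtype
    π := fun n => cover (syzygy N n).1
    ι_injective := fun _ => Submodule.injective_subtype _
    π_surjective := fun _ => cover_surjective _
    exact := fun _ => LinearMap.exact_subtype_ker_map _ }

end FiniteResolution

theorem exists_finiteResolution {R : Type u} [Ring R] [IsNoetherianRing R] (N : Type u)
    [AddCommGroup N] [Module R N] [Module.Finite R N] :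
    ∃ F : FiniteResolution R, Nonempty (F.X 0 ≃ₗ[R] N) :=
  ⟨.ofFinite (ModuleCat.of R N), ⟨LinearEquiv.refl R N⟩⟩

namespace ExtDual

variable {R : Type u} [Ring R]
variable {N N' N'' : Type u} [AddCommGroup N] [Module R N] [AddCommGroup N'] [Module R N']
  [AddCommGroup N''] [Module R N'']
variable {f : N →ₗ[R] N'} {g : N' →ₗ[R] N''} (hf : Function.Injective f)
  (hg : Function.Surjective g) (hfg : Function.Exact f g)

theorem δ_surjective_of_projective [Module.Projective R N'] (l : ℕ) :
    Function.Surjective (δ hf hg hfg l) := fun y =>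
  have := subsingleton_of_projective (R := R) (N := N') l
  (exact_δ_map hf hg hfg l y).1 (Subsingleton.elim _ _)

theorem δ_injective_of_subsingleton (l : ℕ) [Subsingleton (ExtDual R N' l)] :
    Function.Injective (δ hf hg hfg l) := by
  refine (injective_iff_map_eq_zero _).2 fun x hx => ?_
  obtain ⟨y, rfl⟩ := (exact_map_δ hf hg hfg l x).1 hx
  rw [Subsingleton.elim y 0, LinearMap.map_zero]

/-- Dimension shifting along a short exact sequence with projective middle term. -/
def shift [Module.Projective R N'] (l : ℕ) :
    ExtDual R N (l + 1) ≃ₗ[Rᵐᵒᵖ] ExtDual R N'' (l + 2) :=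
  have := subsingleton_of_projective (R := R) (N := N') l
  LinearEquiv.ofBijective (δ hf hg hfg (l + 1))
    ⟨δ_injective_of_subsingleton hf hg hfg (l + 1), δ_surjective_of_projective hf hg hfg (l + 1)⟩

end ExtDual

theorem exact_rangeRestrict {R M N P : Type*} [Ring R] [AddCommGroup M] [Module R M]
    [AddCommGroup N] [Module R N] [AddCommGroup P] [Module R P] {f : M →ₗ[R] N} {g : N →ₗ[R] P}
    (h : Function.Exact f g) : Function.Exact f g.rangeRestrict :=
  (LinearMap.range g).injective_subtype.comp_exact_iff_exact.1 h

theorem ExtDual.map_rangeRestrict_comp_map_subtype {R : Type u} [Ring R] {N N' : Type u}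
    [AddCommGroup N] [Module R N] [AddCommGroup N'] [Module R N'] (f : N →ₗ[R] N') (l : ℕ) :
    map l f.rangeRestrict ∘ₗ map l (LinearMap.range f).subtype = map l f := by
  ext x
  rw [LinearMap.comp_apply, ← map_comp, LinearMap.subtype_comp_codRestrict]

section ExtVanishing

variable {T : Type u} [Ring T] {L : Type u} [AddCommGroup L] [Module T L]

theorem ModExt.postcomp_sum {B B' : Type u} [AddCommGroup B] [Module T B] [AddCommGroup B']
    [Module T B'] {k : ℕ} (f : Fin k → B →ₗ[T] B') (l : ℕ) (x : ModExt T L B l) :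
    postcomp L l (∑ i, f i) x = ∑ i, postcomp L l (f i) x :=
  map_sum (AddMonoidHom.mk' (fun g : B →ₗ[T] B' => postcomp L l g x)
    fun _ _ => postcomp_add l _ _ x) f Finset.univ

theorem GradeGE.subsingleton_modExt {k l : ℕ} (hL : GradeGE T L l) (hk : k < l) (P : Type u)
    [AddCommGroup P] [Module T P] [Module.Finite T P] [Module.Projective T P] :
    Subsingleton (ModExt T L P k) := by
  have hk : Subsingleton (ModExt T L T k) := hL k hk
  obtain ⟨n, x, f, hf⟩ := exists_dualBasis (R := T) P
  have hid : ∑ i, (LinearMap.toSpanSingleton T P (x i)) ∘ₗ f i = LinearMap.id := by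
    ext p
    simp [hf]
  refine subsingleton_of_forall_eq 0 fun y => ?_
  rw [← ModExt.postcomp_id k y, ← hid, ModExt.postcomp_sum]
  refine Finset.sum_eq_zero fun i _ => ?_
  rw [ModExt.postcomp_comp, Subsingleton.elim (ModExt.postcomp L k (f i) y) 0, map_zero]

end ExtVanishing

theorem ExtDual.hom_zero_eq_zero {R : Type u} [Ring R] {Y L : Type u} [AddCommGroup Y]
    [Module R Y] [Module.Finite R Y] [AddCommGroup L] [Module Rᵐᵒᵖ L] (hL : GradeGE Rᵐᵒᵖ L 1)
    (t : L →ₗ[Rᵐᵒᵖ] ExtDual R Y 0) : t = 0 := by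
  obtain ⟨n, p, hp⟩ := Module.Finite.exists_fin' R Y
  have := hL.subsingleton_modExt zero_lt_one (ExtDual R (Fin n → R) 0)
  have hpt : ExtDual.map 0 p ∘ₗ t = 0 :=
    (ModExt.homEquiv (R := Rᵐᵒᵖ) (N := L)).symm.injective (Subsingleton.elim _ _)
  ext x : 1
  exact ExtDual.map_injective_of_surjective hp
    ((LinearMap.congr_fun hpt x).trans (LinearMap.map_zero _).symm)

namespace FiniteResolution

variable {R : Type u} [Ring R] (F : FiniteResolution R)

theorem map_π_injective (k : ℕ) : Function.Injective (ExtDual.map 0 (F.π k)) :=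
  ExtDual.map_injective_of_surjective (F.π_surjective k)

theorem exact_map_π_map_ι (k : ℕ) :
    Function.Exact (ExtDual.map 0 (F.π k)) (ExtDual.map 0 (F.ι k)) :=
  ExtDual.exact_map_map (F.ι_injective k) (F.π_surjective k) (F.exact k) 0

/-- The connecting map from the dual of a syzygy to the first `Ext` of the preceding one. -/
def dualδ (k : ℕ) : ExtDual R (F.X (k + 1)) 0 →ₗ[Rᵐᵒᵖ] ExtDual R (F.X k) 1 :=
  ExtDual.δ (F.ι_injective k) (F.π_surjective k) (F.exact k) 0

theorem dualδ_surjective (k : ℕ) : Function.Surjective (F.dualδ k) :=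
  ExtDual.δ_surjective_of_projective _ _ _ 0

theorem exact_map_ι_dualδ (k : ℕ) : Function.Exact (ExtDual.map 0 (F.ι k)) (F.dualδ k) :=
  ExtDual.exact_map_δ _ _ _ 0

theorem nonempty_extDual_syzygy_equiv (k m n : ℕ) (h : n = m + k) :
    Nonempty (ExtDual R (F.X k) (m + 1) ≃ₗ[Rᵐᵒᵖ] ExtDual R (F.X 0) (n + 1)) := by
  induction k generalizing m with
  | zero => obtain rfl : n = m := h; exact ⟨LinearEquiv.refl _ _⟩
  | succ k ih =>
    obtain ⟨e⟩ := ih (m + 1) (by omega)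
    exact ⟨(ExtDual.shift (F.ι_injective k) (F.π_surjective k) (F.exact k) m).trans e⟩

section HomVanishing

variable {F} {L : Type u} [AddCommGroup L] [Module Rᵐᵒᵖ L] {i : ℕ}

theorem subsingleton_modExt_dual_syzygy (hX : GradeGE R (F.X 0) (i + 1))
    (hL : GradeGE Rᵐᵒᵖ L (i + 2)) {j k : ℕ} (hj : j ≤ i) (hk : k + j ≤ i + 2) :
    Subsingleton (ModExt Rᵐᵒᵖ L (ExtDual R (F.X j) 0) k) := by
  induction j generalizing k with
  | zero =>
    have := hX 0 (by omega)
    have hid : (LinearMap.id : ExtDual R (F.X 0) 0 →ₗ[Rᵐᵒᵖ] _) = 0 :=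
      LinearMap.ext fun x => Subsingleton.elim _ _
    refine subsingleton_of_forall_eq 0 fun y => ?_
    rw [← ModExt.postcomp_id k y, hid, ModExt.postcomp_zero]
  | succ j ih =>
    have := hL.subsingleton_modExt (k := k) (by omega) (ExtDual R (F.P j) 0)
    have := ih (k := k + 1) (by omega) (by omega)
    obtain ⟨e⟩ := F.nonempty_extDual_syzygy_equiv j 0 j (by omega)
    have := hX (j + 1) (by omega)
    have : Subsingleton (ExtDual R (F.X j) 1) := e.toEquiv.subsingleton
    have hι : Function.Surjective (ExtDual.map 0 (F.ι j)) := fun y =>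
      (F.exact_map_ι_dualδ j y).1 (Subsingleton.elim _ _)
    exact subsingleton_of_exact
      (ModExt.exact_postcomp_covδ (F.map_π_injective j) hι (F.exact_map_π_map_ι j) k)

theorem subsingleton_modExt_range_map_ι (hX : GradeGE R (F.X 0) (i + 1))
    (hL : GradeGE Rᵐᵒᵖ L (i + 2)) :
    Subsingleton (ModExt Rᵐᵒᵖ L (LinearMap.range (ExtDual.map 0 (F.ι i))) 1) := by
  have := hL.subsingleton_modExt (k := 1) (by omega) (ExtDual R (F.P i) 0)
  have := subsingleton_modExt_dual_syzygy hX hL (k := 2) le_rfl (by omega)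
  exact subsingleton_of_exact (ModExt.exact_postcomp_covδ (F.map_π_injective i)
    (LinearMap.surjective_rangeRestrict _)
    (exact_rangeRestrict (F.exact_map_π_map_ι i)) 1)

theorem hom_extDual_eq_zero (hX : GradeGE R (F.X 0) i) (hL : GradeGE Rᵐᵒᵖ L (i + 1))
    (f : L →ₗ[Rᵐᵒᵖ] ExtDual R (F.X 0) i) : f = 0 := by
  cases i with
  | zero => exact ExtDual.hom_zero_eq_zero hL f
  | succ i =>
    obtain ⟨e⟩ := F.nonempty_extDual_syzygy_equiv i 0 i (by omega)
    let D := LinearMap.range (ExtDual.map 0 (F.ι i))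
    have hD : Function.Exact D.subtype (F.dualδ i) := by
      rw [LinearMap.exact_iff, Submodule.range_subtype]
      exact (F.exact_map_ι_dualδ i).linearMap_ker_eq
    -- `f` lifts to the dual of the `i + 1`-st syzygy, since `Ext¹(L, D)` vanishes
    have := subsingleton_modExt_range_map_ι hX hL
    obtain ⟨y, hy⟩ := (ModExt.exact_postcomp_covδ (N := L) D.injective_subtype
      (F.dualδ_surjective i) hD 0 (ModExt.homEquiv.symm (e.symm.toLinearMap ∘ₗ f))).1
        (Subsingleton.elim _ _)
    have hf := congrArg ModExt.homEquiv hy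
    rw [ModExt.homEquiv_postcomp, ExtDual.hom_zero_eq_zero (hL.mono (by omega)) (ModExt.homEquiv y),
      LinearMap.comp_zero, AddEquiv.apply_symm_apply] at hf
    ext x : 1
    exact e.symm.injective ((LinearMap.congr_fun hf x).symm.trans (map_zero _).symm)

end HomVanishing

end FiniteResolution

theorem ExtDual.hom_eq_zero {R : Type u} [Ring R] [IsNoetherianRing R] {Y : Type u}
    [AddCommGroup Y] [Module R Y] [Module.Finite R Y] {i : ℕ} (hY : GradeGE R Y i) {L : Type u}
    [AddCommGroup L] [Module Rᵐᵒᵖ L] (hL : GradeGE Rᵐᵒᵖ L (i + 1))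
    (f : L →ₗ[Rᵐᵒᵖ] ExtDual R Y i) : f = 0 := by
  obtain ⟨F, ⟨e⟩⟩ := exists_finiteResolution (R := R) Y
  have hf := FiniteResolution.hom_extDual_eq_zero (hY.congr e.symm) hL
    ((ExtDual.congr i e).toLinearMap ∘ₗ f)
  ext x : 1
  exact (ExtDual.congr i e).injective ((LinearMap.congr_fun hf x).trans (_root_.map_zero _).symm)

/-! ### The filtration of a finite module by double duals -/

theorem exists_injective_exact {R A B E P X Y : Type*} [Ring R] [AddCommGroup A] [Module R A]
    [AddCommGroup B] [Module R B] [AddCommGroup E] [Module R E] [AddCommGroup P] [Module R P]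
    [AddCommGroup X] [Module R X] [AddCommGroup Y] [Module R Y] {s : A →ₗ[R] B} {δ : B →ₗ[R] E}
    {r : B →ₗ[R] P} {q : P →ₗ[R] X} {β : X →ₗ[R] Y} (hδ : Function.Surjective δ)
    (hr : Function.Injective r) (hq : Function.Surjective q) (hsδ : Function.Exact s δ)
    (hrsq : Function.Exact (r ∘ₗ s) q) (hrqβ : Function.Exact r (β ∘ₗ q)) :
    ∃ g : E →ₗ[R] X, Function.Injective g ∧ Function.Exact g β := by
  obtain ⟨g, hg⟩ := exists_factor_of_surjective (f := q ∘ₗ r) hδ fun x hx => by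
    obtain ⟨a, rfl⟩ := (hsδ x).1 hx
    exact hrsq.apply_apply_eq_zero a
  refine ⟨g, (injective_iff_map_eq_zero _).2 fun x hx => ?_, fun x => ⟨fun hx => ?_, ?_⟩⟩
  · obtain ⟨b, rfl⟩ := hδ x
    obtain ⟨a, ha⟩ := (hrsq (r b)).1 ((hg b).symm.trans hx)
    exact (hsδ b).2 ⟨a, hr ha⟩
  · obtain ⟨y, rfl⟩ := hq x
    obtain ⟨b, rfl⟩ := (hrqβ y).1 hx
    exact ⟨δ b, hg b⟩
  · rintro ⟨y, rfl⟩
    obtain ⟨b, rfl⟩ := hδ y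
    rw [hg]
    exact hrqβ.apply_apply_eq_zero b

namespace FiniteResolution

variable {R : Type u} [Ring R] (F : FiniteResolution R)

/-- The differential of the dual of the resolution. -/
abbrev dualD (k : ℕ) : ExtDual R (F.P k) 0 →ₗ[Rᵐᵒᵖ] ExtDual R (F.P (k + 1)) 0 :=
  ExtDual.map 0 (F.ι k ∘ₗ F.π (k + 1))

theorem dualD_eq (k : ℕ) :
    F.dualD k = ExtDual.map 0 (F.π (k + 1)) ∘ₗ ExtDual.map 0 (F.ι k) :=
  LinearMap.ext (ExtDual.map_comp 0 _ _)

/-- The cokernel of a differential of the dual of the resolution. -/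
abbrev DualCoker (k : ℕ) : Type u := ExtDual R (F.P (k + 1)) 0 ⧸ LinearMap.range (F.dualD k)

theorem exact_map_π_dualD (k : ℕ) : Function.Exact (ExtDual.map 0 (F.π k)) (F.dualD k) := by
  rw [dualD_eq]
  exact (F.map_π_injective (k + 1)).comp_exact_iff_exact.2 (F.exact_map_π_map_ι k)

theorem dualD_dualD (k : ℕ) (x : ExtDual R (F.P k) 0) : F.dualD (k + 1) (F.dualD k x) = 0 := by
  rw [dualD_eq F k]
  exact (F.exact_map_π_dualD (k + 1)).apply_apply_eq_zero _

/-- The surjection from the cokernel of a dual differential onto the image of the next one. -/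
def dualCokerToRange (k : ℕ) : F.DualCoker k →ₗ[Rᵐᵒᵖ] LinearMap.range (F.dualD (k + 1)) :=
  (LinearMap.range (F.dualD k)).liftQ (F.dualD (k + 1)).rangeRestrict (by
    rintro _ ⟨x, rfl⟩
    exact Subtype.ext (F.dualD_dualD k x))

theorem dualCokerToRange_surjective (k : ℕ) : Function.Surjective (F.dualCokerToRange k) := by
  rintro ⟨_, x, rfl⟩
  exact ⟨Submodule.Quotient.mk x, rfl⟩

theorem exists_extDual_one_exact (k : ℕ) : ∃ a : ExtDual R (F.X k) 1 →ₗ[Rᵐᵒᵖ] F.DualCoker k,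
    Function.Injective a ∧ Function.Exact a (F.dualCokerToRange k) := by
  refine exists_injective_exact (q := (LinearMap.range (F.dualD k)).mkQ) (F.dualδ_surjective k)
    (F.map_π_injective (k + 1)) (Submodule.mkQ_surjective _) (F.exact_map_ι_dualδ k) ?_ ?_
  · rw [← dualD_eq]
    exact LinearMap.exact_map_mkQ_range _
  · exact exact_rangeRestrict (F.exact_map_π_dualD (k + 1))

theorem exact_subtype_mkQ_dualD (k : ℕ) :
    Function.Exact (LinearMap.range (F.dualD k)).subtype (LinearMap.range (F.dualD k)).mkQ :=
  LinearMap.exact_subtype_mkQ _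

/-- Dimension shifting from the image of a dual differential to its cokernel. -/
def dualCokerShift (k l : ℕ) :
    ExtDual Rᵐᵒᵖ (LinearMap.range (F.dualD k)) (l + 1) ≃ₗ[Rᵐᵒᵖᵐᵒᵖ]
      ExtDual Rᵐᵒᵖ (F.DualCoker k) (l + 2) :=
  ExtDual.shift (Submodule.injective_subtype _) (Submodule.mkQ_surjective _)
    (F.exact_subtype_mkQ_dualD k) l

theorem exists_exact_dualCoker_succ (k : ℕ)
    (hE : Subsingleton (ExtDual Rᵐᵒᵖ (ExtDual R (F.X 0) (k + 1)) k)) :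
    ∃ (g : ExtDual Rᵐᵒᵖ (F.DualCoker (k + 1)) (k + 2) →ₗ[Rᵐᵒᵖᵐᵒᵖ]
        ExtDual Rᵐᵒᵖ (F.DualCoker k) (k + 1))
      (q : ExtDual Rᵐᵒᵖ (F.DualCoker k) (k + 1) →ₗ[Rᵐᵒᵖᵐᵒᵖ] ExtExt R (F.X 0) (k + 1))
      (t : ExtExt R (F.X 0) (k + 1) →ₗ[Rᵐᵒᵖᵐᵒᵖ] ExtDual Rᵐᵒᵖ (F.DualCoker (k + 1)) (k + 3)),
      Function.Injective g ∧ Function.Exact g q ∧ Function.Exact q t := by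
  obtain ⟨a₀, ha₀, hab₀⟩ := F.exists_extDual_one_exact k
  obtain ⟨e⟩ := F.nonempty_extDual_syzygy_equiv k 0 k (by omega)
  let a := a₀ ∘ₗ e.symm.toLinearMap
  have ha : Function.Injective a := ha₀.comp e.symm.injective
  have hab : Function.Exact a (F.dualCokerToRange k) :=
    e.symm.surjective.comp_exact_iff_exact.2 hab₀
  have hb := F.dualCokerToRange_surjective k
  let s := F.dualCokerShift (k + 1) k
  let s' := F.dualCokerShift (k + 1) (k + 1)
  refine ⟨ExtDual.map (k + 1) (F.dualCokerToRange k) ∘ₗ s.symm.toLinearMap,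
    ExtDual.map (k + 1) a, s'.toLinearMap ∘ₗ ExtDual.δ ha hb hab (k + 1), ?_, ?_, ?_⟩
  · have hinj : Function.Injective (ExtDual.map (k + 1) (F.dualCokerToRange k)) :=
      (injective_iff_map_eq_zero _).2 fun x hx => by
        obtain ⟨y, rfl⟩ := (ExtDual.exact_δ_map ha hb hab k x).1 hx
        rw [Subsingleton.elim y 0, map_zero]
    exact hinj.comp s.symm.injective
  · exact s.symm.surjective.comp_exact_iff_exact.2 (ExtDual.exact_map_map ha hb hab (k + 1))
  · exact s'.injective.comp_exact_iff_exact.2 (ExtDual.exact_map_δ ha hb hab (k + 1))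

end FiniteResolution

variable (R : Type u) [Ring R] in
/-- The isomorphism of the double opposite of `R` with `R`, as a ring homomorphism. -/
abbrev opOpSymm : Rᵐᵒᵖᵐᵒᵖ →+* R := ((RingEquiv.opOp R).symm : Rᵐᵒᵖᵐᵒᵖ →+* R)

/-- The biduality map, linear over the double opposite. -/
def bidualOp {R : Type u} [Ring R] (N : Type u) [AddCommGroup N] [Module R N] :
    Restriction (opOpSymm R) N →ₗ[Rᵐᵒᵖᵐᵒᵖ] ExtExt R N 0 where
  toFun := bidual N
  map_add' := map_add (bidual N)
  map_smul' r := (bidual N).map_smulₛₗ r.unop.unop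

theorem map_map_comp_bidualOp {R : Type u} [Ring R] {N N' : Type u} [AddCommGroup N] [Module R N]
    [AddCommGroup N'] [Module R N'] (f : N →ₗ[R] N') :
    ExtDual.map 0 (ExtDual.map 0 f) ∘ₗ bidualOp N =
      bidualOp N' ∘ₗ Restriction.map (opOpSymm R) f :=
  LinearMap.ext (map_map_bidual f)

/-- Biduality for finite projective modules. -/
def bidualEquiv {R : Type u} [Ring R] (P : Type u) [AddCommGroup P] [Module R P]
    [Module.Finite R P] [Module.Projective R P] :
    Restriction (opOpSymm R) P ≃ₗ[Rᵐᵒᵖᵐᵒᵖ] ExtExt R P 0 :=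
  LinearEquiv.ofBijective (bidualOp P) (bidual_bijective P)

theorem FiniteResolution.exists_exact_bidualOp {R : Type u} [Ring R] (F : FiniteResolution R) :
    ∃ (g : ExtDual Rᵐᵒᵖ (F.DualCoker 0) 1 →ₗ[Rᵐᵒᵖᵐᵒᵖ] Restriction (opOpSymm R) (F.X 0))
      (t : ExtExt R (F.X 0) 0 →ₗ[Rᵐᵒᵖᵐᵒᵖ] ExtDual Rᵐᵒᵖ (F.DualCoker 0) 2),
      Function.Injective g ∧ Function.Exact g (bidualOp (F.X 0)) ∧
        Function.Exact (bidualOp (F.X 0)) t := by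
  -- dualize `0 → X₀* → P₀* → B → 0` and `0 → B → P₁* → coker → 0`, with `B` the image of `dualD 0`
  let B := LinearMap.range (F.dualD 0)
  let r := (F.dualD 0).rangeRestrict
  have hr : Function.Surjective r := (F.dualD 0).surjective_rangeRestrict
  have hex : Function.Exact (ExtDual.map 0 (F.π 0)) r :=
    exact_rangeRestrict (F.exact_map_π_dualD 0)
  let q := Restriction.map (opOpSymm R) (F.π 0) ∘ₗ (bidualEquiv (F.P 0)).symm.toLinearMap
  have hq : Function.Surjective q :=
    (F.π_surjective 0).comp (bidualEquiv (F.P 0)).symm.surjective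
  have hβq : bidualOp (F.X 0) ∘ₗ q = ExtDual.map 0 (ExtDual.map 0 (F.π 0)) := by
    rw [← LinearMap.comp_assoc, ← map_map_comp_bidualOp]
    exact LinearMap.ext fun x =>
      congrArg (ExtDual.map 0 (ExtDual.map 0 (F.π 0))) ((bidualEquiv (F.P 0)).apply_symm_apply x)
  have hrsq : Function.Exact (ExtDual.map 0 r ∘ₗ ExtDual.map 0 B.subtype) q := by
    have hιπ : Function.Exact (F.ι 0 ∘ₗ F.π 1) (F.π 0) :=
      (F.π_surjective 1).comp_exact_iff_exact.2 (F.exact 0)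
    have hP : Function.Exact (Restriction.map (opOpSymm R) (F.ι 0 ∘ₗ F.π 1))
        (Restriction.map (opOpSymm R) (F.π 0)) := hιπ
    rw [ExtDual.map_rangeRestrict_comp_map_subtype]
    refine (Function.Exact.iff_of_ladder_linearEquiv (e₁ := bidualEquiv (F.P 1))
      (e₂ := bidualEquiv (F.P 0)) (e₃ := LinearEquiv.refl _ _) ?_ ?_).2 hP
    · exact map_map_comp_bidualOp (F.ι 0 ∘ₗ F.π 1)
    · exact LinearMap.ext fun x => congrArg (Restriction.map (opOpSymm R) (F.π 0))
        ((bidualEquiv (F.P 0)).symm_apply_apply x)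
  have hrqβ := ExtDual.exact_map_map (F.map_π_injective 0) hr hex 0
  have hδ := ExtDual.exact_map_δ (F.map_π_injective 0) hr hex 0
  rw [← hβq] at hrqβ hδ
  obtain ⟨g, hg, hgβ⟩ := exists_injective_exact (ExtDual.δ_surjective_of_projective
      B.injective_subtype B.mkQ_surjective (F.exact_subtype_mkQ_dualD 0) 0)
    (ExtDual.map_injective_of_surjective hr) hq (ExtDual.exact_map_δ _ _ _ 0) hrsq hrqβ
  exact ⟨g, (F.dualCokerShift 0 0).toLinearMap ∘ₗ ExtDual.δ (F.map_π_injective 0) hr hex 0, hg,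
    hgβ, (F.dualCokerShift 0 0).injective.comp_exact_iff_exact.2
      (hq.comp_exact_iff_exact.1 hδ)⟩

/-! ### Modules over Auslander regular rings -/

section AuslanderRegular

variable {R : Type u} [Ring R]

theorem exists_injective_of_comp_eq_zero {L G G' E : Type*} [AddCommGroup L] [Module R L]
    [AddCommGroup G] [Module R G] [AddCommGroup G'] [Module R G'] [AddCommGroup E] [Module R E]
    {g : G' →ₗ[R] G} {q : G →ₗ[R] E} {s : L →ₗ[R] G} (hg : Function.Injective g)
    (hgq : Function.Exact g q) (hs : Function.Injective s) (hqs : q ∘ₗ s = 0) :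
    ∃ s' : L →ₗ[R] G', Function.Injective s' := by
  have hsg (x : L) : s x ∈ LinearMap.range g := (hgq _).1 (LinearMap.congr_fun hqs x)
  have hcod : Function.Injective (s.codRestrict _ hsg) := fun x y h => hs (congrArg Subtype.val h)
  exact ⟨(LinearEquiv.ofInjective g hg).symm.toLinearMap ∘ₗ s.codRestrict _ hsg,
    (LinearEquiv.ofInjective g hg).symm.injective.comp hcod⟩

theorem ExtDual.subsingleton_of_subsingleton {N : Type u} [AddCommGroup N] [Module R N]
    [Subsingleton N] (l : ℕ) : Subsingleton (ExtDual R N l) :=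
  gradeGE_of_subsingleton (R := R) (N := N) (l + 1) l (Nat.lt_succ_self l)

theorem GradeGE.comap_mkQ {N : Type u} [AddCommGroup N] [Module R N] {D : Submodule R N}
    {Q : Submodule R (N ⧸ D)} {l : ℕ} (hD : GradeGE R D l) (hQ : GradeGE R Q l) :
    GradeGE R (Q.comap D.mkQ) l := by
  have hle : D ≤ Q.comap D.mkQ := (D.ker_mkQ.symm.le).trans (LinearMap.ker_le_comap _)
  let g : Q.comap D.mkQ →ₗ[R] Q := D.mkQ.restrict fun _ hx => hx
  have hg : Function.Surjective g := by
    rintro ⟨y, hy⟩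
    obtain ⟨x, rfl⟩ := D.mkQ_surjective y
    exact ⟨⟨x, hy⟩, rfl⟩
  have hex : Function.Exact (Submodule.inclusion hle) g := by
    intro x
    rw [← Subtype.coe_inj]
    refine (Submodule.Quotient.mk_eq_zero _).trans ⟨fun hx => ⟨⟨x, hx⟩, rfl⟩, ?_⟩
    rintro ⟨y, rfl⟩
    exact y.2
  exact GradeGE.extension (Submodule.inclusion_injective hle) hg hex hD hQ

theorem GlobalDimensionLE.subsingleton_extDual_op {d : ℕ} (h : GlobalDimensionLE R d) {l : ℕ}
    (hl : d < l)
    (N : Type u) [AddCommGroup N] [Module Rᵐᵒᵖ N] : Subsingleton (ExtDual Rᵐᵒᵖ N l) :=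
  ModExt.subsingleton_of_projectiveDimensionLE (h.2 _) hl

namespace IsAuslanderRegular

variable (hR : IsAuslanderRegular R)
include hR

theorem gradeGE_of_injective_extDual {N : Type u} [AddCommGroup N] [Module R N]
    [Module.Finite R N] {l : ℕ} {L : Type u} [AddCommGroup L] [Module Rᵐᵒᵖ L]
    (f : L →ₗ[Rᵐᵒᵖ] ExtDual R N l) (hf : Function.Injective f) : GradeGE Rᵐᵒᵖ L l :=
  (le_moduleGrade_iff.1 ((hR.regular_left N).2 l (LinearMap.range f))).congr
    (LinearEquiv.ofInjective f hf).symm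

theorem gradeGE_of_injective_extDual_op {N : Type u} [AddCommGroup N] [Module Rᵐᵒᵖ N]
    [Module.Finite Rᵐᵒᵖ N] {l : ℕ} {L : Type u} [AddCommGroup L] [Module Rᵐᵒᵖᵐᵒᵖ L]
    (f : L →ₗ[Rᵐᵒᵖᵐᵒᵖ] ExtDual Rᵐᵒᵖ N l) (hf : Function.Injective f) : GradeGE Rᵐᵒᵖᵐᵒᵖ L l :=
  (le_moduleGrade_iff.1 ((hR.regular_right N).2 l (LinearMap.range f))).congr
    (LinearEquiv.ofInjective f hf).symm

theorem gradeGE_extDual (N : Type u) [AddCommGroup N] [Module R N] [Module.Finite R N] (l : ℕ) :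
    GradeGE Rᵐᵒᵖ (ExtDual R N l) l :=
  hR.gradeGE_of_injective_extDual LinearMap.id Function.injective_id

theorem exists_injective_extDual_dualCoker (F : FiniteResolution R) {L : Type u} [AddCommGroup L]
    [Module Rᵐᵒᵖᵐᵒᵖ L] (f : L →ₗ[Rᵐᵒᵖᵐᵒᵖ] Restriction (opOpSymm R) (F.X 0))
    (hf : Function.Injective f) (k : ℕ)
    (hL : ∀ i ≤ k, ∀ t : L →ₗ[Rᵐᵒᵖᵐᵒᵖ] ExtExt R (F.X 0) i, t = 0) :
    ∃ s : L →ₗ[Rᵐᵒᵖᵐᵒᵖ] ExtDual Rᵐᵒᵖ (F.DualCoker k) (k + 1), Function.Injective s := by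
  induction k with
  | zero =>
    obtain ⟨g, -, hg, hgb, -⟩ := F.exists_exact_bidualOp
    exact exists_injective_of_comp_eq_zero hg hgb hf (hL 0 le_rfl _)
  | succ k ih =>
    obtain ⟨s, hs⟩ := ih fun i hi => hL i (by omega)
    obtain ⟨g, q, -, hg, hgq, -⟩ := F.exists_exact_dualCoker_succ k
      (hR.gradeGE_extDual (F.X 0) (k + 1) k (by omega))
    exact exists_injective_of_comp_eq_zero hg hgq hs (hL (k + 1) le_rfl _)

theorem exists_injective_restriction (F : FiniteResolution R) (k : ℕ) :
    ∃ s : ExtDual Rᵐᵒᵖ (F.DualCoker k) (k + 1) →ₗ[Rᵐᵒᵖᵐᵒᵖ] Restriction (opOpSymm R) (F.X 0),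
      Function.Injective s := by
  induction k with
  | zero =>
    obtain ⟨g, -, hg, -⟩ := F.exists_exact_bidualOp
    exact ⟨g, hg⟩
  | succ k ih =>
    obtain ⟨s, hs⟩ := ih
    obtain ⟨g, -, -, hg, -⟩ := F.exists_exact_dualCoker_succ k
      (hR.gradeGE_extDual (F.X 0) (k + 1) k (by omega))
    exact ⟨s ∘ₗ g, hs.comp hg⟩

variable {N N' N'' : Type u} [AddCommGroup N] [Module R N] [AddCommGroup N'] [Module R N']
  [AddCommGroup N''] [Module R N'']

theorem gradeGE_of_injective [Module.Finite R N] {l : ℕ} (h : GradeGE R N l) (f : N' →ₗ[R] N)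
    (hf : Function.Injective f) : GradeGE R N' l := by
  cases l with
  | zero => exact fun i hi => absurd hi (Nat.not_lt_zero i)
  | succ k =>
    have := hR.noetherian_left
    have := hR.noetherian_right
    obtain ⟨F, ⟨e⟩⟩ := exists_finiteResolution (R := R) N
    have hX := h.congr e.symm
    rw [← gradeGE_restriction_iff (RingEquiv.opOp R).symm N']
    obtain ⟨s, hs⟩ := hR.exists_injective_extDual_dualCoker F
      (L := Restriction (opOpSymm R) N') (Restriction.map (opOpSymm R) (e.symm.toLinearMap ∘ₗ f))
      (e.symm.injective.comp hf) k fun i hi t => by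
        have := hX i (by omega)
        have := ExtDual.subsingleton_of_subsingleton (R := Rᵐᵒᵖ) (N := ExtDual R (F.X 0) i) i
        exact LinearMap.ext fun x => Subsingleton.elim _ _
    exact hR.gradeGE_of_injective_extDual_op s hs

theorem gradeGE_of_surjective [Module.Finite R N] {l : ℕ} (h : GradeGE R N l) (f : N →ₗ[R] N')
    (hf : Function.Surjective f) : GradeGE R N' l :=
  (hR.gradeGE_of_injective h _ (LinearMap.ker f).injective_subtype).quotient
    (LinearMap.ker f).injective_subtype hf (LinearMap.exact_subtype_ker_map f) h

theorem subsingleton_of_extExt {d : ℕ} (hd : GlobalDimensionLE R d) [Module.Finite R N] {l : ℕ}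
    (hN : ∀ i, l ≤ i → Subsingleton (ExtExt R N i)) (f : N' →ₗ[R] N) (hf : Function.Injective f)
    (h : GradeGE R N' l) : Subsingleton N' := by
  have := hR.noetherian_left
  have := hR.noetherian_right
  obtain ⟨F, ⟨e⟩⟩ := exists_finiteResolution (R := R) N
  obtain ⟨s, hs⟩ := hR.exists_injective_extDual_dualCoker F
    (L := Restriction (opOpSymm R) N') (Restriction.map (opOpSymm R) (e.symm.toLinearMap ∘ₗ f))
    (e.symm.injective.comp hf) d fun i _ t => by
      by_cases hil : l ≤ i
      · have := hN i hil
        have := (ExtDual.congr i (ExtDual.congr i e)).toEquiv.subsingleton_congr.2 this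
        exact LinearMap.ext fun x => Subsingleton.elim _ _
      · refine ExtDual.hom_eq_zero (hR.gradeGE_extDual (F.X 0) i) ?_ t
        exact ((gradeGE_restriction_iff (RingEquiv.opOp R).symm N' l).2 h).mono (by omega)
  have := hd.subsingleton_extDual_op (Nat.lt_succ_self d) (F.DualCoker d)
  exact hs.subsingleton

theorem subsingleton_extExt [Module.Finite R N] {l : ℕ}
    (hN : ∀ (L : Type u) [AddCommGroup L] [Module R L] (f : L →ₗ[R] N), Function.Injective f →
      GradeGE R L l → Subsingleton L) (i : ℕ) (hi : l ≤ i) : Subsingleton (ExtExt R N i) := by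
  have := hR.noetherian_left
  have := hR.noetherian_right
  cases i with
  | zero =>
    have := hN N LinearMap.id Function.injective_id fun i hi' => by omega
    have := ExtDual.subsingleton_of_subsingleton (R := R) (N := N) 0
    exact ExtDual.subsingleton_of_subsingleton 0
  | succ i =>
    obtain ⟨F, ⟨e⟩⟩ := exists_finiteResolution (R := R) N
    obtain ⟨s, hs⟩ := hR.exists_injective_restriction F i
    let G := ExtDual Rᵐᵒᵖ (F.DualCoker i) (i + 1)
    let s' : Restriction (opOpHom R) G →ₗ[R] F.X 0 :=
      { toFun := s, map_add' := map_add s, map_smul' := fun r x => s.map_smul (opOpHom R r) x }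
    have hG : Subsingleton G := by
      refine hN (Restriction (opOpHom R) G) (e.toLinearMap ∘ₗ s') (e.injective.comp hs) ?_
      refine GradeGE.mono ((gradeGE_restriction_iff (RingEquiv.opOp R) G _).2 ?_) hi
      exact hR.gradeGE_of_injective_extDual_op LinearMap.id Function.injective_id
    obtain ⟨g, q, t, -, -, hqt⟩ := F.exists_exact_dualCoker_succ i
      (hR.gradeGE_extDual (F.X 0) (i + 1) i (by omega))
    have ht : Function.Injective t := (injective_iff_map_eq_zero _).2 fun x hx => by
      obtain ⟨y, rfl⟩ := (hqt x).1 hx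
      exact (congrArg q (hG.elim y 0)).trans (map_zero q)
    have hid := ExtDual.hom_eq_zero (hR.gradeGE_extDual (F.X 0) (i + 1))
      ((hR.gradeGE_of_injective_extDual_op t ht).mono (Nat.le_succ _)) LinearMap.id
    have : Subsingleton (ExtExt R (F.X 0) (i + 1)) :=
      subsingleton_of_forall_eq 0 fun x => LinearMap.congr_fun hid x
    exact (ExtDual.congr _ (ExtDual.congr _ e)).toEquiv.subsingleton_congr.1 this

theorem gradeGE_sup [Module.Finite R N] {l : ℕ} {L L' : Submodule R N} (h : GradeGE R L l)
    (h' : GradeGE R L' l) : GradeGE R (L ⊔ L' : Submodule R N) l := by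
  have := hR.noetherian_left
  have hp : GradeGE R (L × L') l := GradeGE.extension LinearMap.inl_injective
    LinearMap.snd_surjective Function.Exact.inl_snd h h'
  have hr : LinearMap.range (L.subtype.coprod L'.subtype) = L ⊔ L' := by
    rw [LinearMap.range_coprod, Submodule.range_subtype, Submodule.range_subtype]
  exact hr ▸ hR.gradeGE_of_surjective hp (L.subtype.coprod L'.subtype).rangeRestrict
    (LinearMap.surjective_rangeRestrict _)

theorem gradeGE_dimFiltration [Module.Finite R N] (l : ℕ) :
    GradeGE R (dimFiltration R N l) l := by
  have := hR.noetherian_left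
  refine le_moduleGrade_iff.1 <|
    CompleteLattice.WellFoundedGT.isSupClosedCompact (Submodule R N) inferInstance
    {L : Submodule R N | (l : ℕ∞) ≤ moduleGrade R L}
    ⟨⊥, le_moduleGrade_iff.2 (gradeGE_of_subsingleton l)⟩
    fun L hL L' hL' => le_moduleGrade_iff.2
      (hR.gradeGE_sup (le_moduleGrade_iff.1 hL) (le_moduleGrade_iff.1 hL'))

omit hR in
theorem le_dimFiltration {l : ℕ} {L : Submodule R N} (h : GradeGE R L l) :
    L ≤ dimFiltration R N l :=
  le_sSup (le_moduleGrade_iff.2 h)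

theorem gradeGE_iff_le_dimFiltration [Module.Finite R N] {l : ℕ} {L : Submodule R N} :
    GradeGE R L l ↔ L ≤ dimFiltration R N l := by
  have := hR.noetherian_left
  exact ⟨le_dimFiltration, fun h => hR.gradeGE_of_injective (hR.gradeGE_dimFiltration l)
    (Submodule.inclusion h) (Submodule.inclusion_injective h)⟩

theorem dimFiltration_succ_le [Module.Finite R N] (l : ℕ) :
    dimFiltration R N (l + 1) ≤ dimFiltration R N l :=
  le_dimFiltration ((hR.gradeGE_dimFiltration (l + 1)).mono (Nat.le_succ l))

theorem subsingleton_of_injective_quotient_dimFiltration [Module.Finite R N] {l : ℕ}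
    (f : N' →ₗ[R] N ⧸ dimFiltration R N l) (hf : Function.Injective f) (h : GradeGE R N' l) :
    Subsingleton N' := by
  let D := dimFiltration R N l
  have hle : (LinearMap.range f).comap D.mkQ ≤ D := le_dimFiltration <|
    (hR.gradeGE_dimFiltration l).comap_mkQ (h.congr (LinearEquiv.ofInjective f hf))
  have hrange : LinearMap.range f = ⊥ := by
    rw [← Submodule.map_comap_eq_of_surjective D.mkQ_surjective (LinearMap.range f), eq_bot_iff,
      ← Submodule.mkQ_map_self D]
    exact Submodule.map_mono hle
  rw [LinearMap.range_eq_bot] at hrange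
  exact subsingleton_of_forall_eq 0 fun x => hf (by rw [hrange, LinearMap.zero_apply, map_zero])

theorem subsingleton_extExt_quotient_dimFiltration [Module.Finite R N] {l i : ℕ} (hi : l ≤ i) :
    Subsingleton (ExtExt R (N ⧸ dimFiltration R N l) i) :=
  hR.subsingleton_extExt
    (fun _ _ _ f hf h => hR.subsingleton_of_injective_quotient_dimFiltration f hf h) i hi

end IsAuslanderRegular

/-! ### Flat base change -/

variable {S : Type u} [Ring S] (φ : R →+* S) (hφ : FlatAsRightModule φ) (hφ' : FlatAsLeftModule φ)
  {N : Type u} [AddCommGroup N] [Module R N] [Module.Finite R N]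
include hφ hφ'

theorem BaseChange.gradeGE [IsNoetherianRing R] {l : ℕ} (h : GradeGE R N l) :
    GradeGE S (BaseChange φ N) l := fun i hi => by
  have := h i hi
  exact (ExtAlong.baseChangeEquiv φ hφ hφ' N i).toEquiv.symm.subsingleton

theorem BaseChange.subsingleton_extExt [IsNoetherianRing R] [IsNoetherianRing Rᵐᵒᵖ] {i : ℕ}
    (h : Subsingleton (ExtExt R N i)) : Subsingleton (ExtExt S (BaseChange φ N) i) := by
  have e₁ := ExtDual.congr i (ExtAlong.baseChangeEquiv φ hφ hφ' N i)
  have e₂ := ExtAlong.baseChangeEquiv (RingHom.op φ) hφ' (hφ.op_op)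
    (ExtDual R N i) i
  exact (e₁.trans e₂.symm).toEquiv.subsingleton

theorem range_baseChange_dimFiltration (hR : IsAuslanderRegular R) (hS : IsAuslanderRegular S)
    {d : ℕ} (hd : GlobalDimensionLE S d) (l : ℕ) :
    LinearMap.range (BaseChange.map φ (dimFiltration R N l).subtype) =
      dimFiltration S (BaseChange φ N) l := by
  have := hR.noetherian_left
  have := hR.noetherian_right
  have := hS.noetherian_left
  apply le_antisymm
  · refine IsAuslanderRegular.le_dimFiltration (hS.gradeGE_of_surjective
      (BaseChange.gradeGE φ hφ hφ' (hR.gradeGE_dimFiltration l)) _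
      (LinearMap.surjective_rangeRestrict _))
  · let p := BaseChange.map φ (dimFiltration R N l).mkQ
    have hex := BaseChange.map_exact φ (LinearMap.exact_subtype_mkQ (dimFiltration R N l))
      (Submodule.mkQ_surjective _)
    let D := dimFiltration S (BaseChange φ N) l
    let f : D →ₗ[S] BaseChange φ (N ⧸ dimFiltration R N l) := p ∘ₗ D.subtype
    have hr := hS.gradeGE_of_surjective (hS.gradeGE_dimFiltration l) f.rangeRestrict
      (LinearMap.surjective_rangeRestrict _)
    have := hS.subsingleton_of_extExt hd (fun i hi => BaseChange.subsingleton_extExt φ hφ hφ'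
      (hR.subsingleton_extExt_quotient_dimFiltration (N := N) hi)) (LinearMap.range f).subtype
      (Submodule.injective_subtype _) hr
    intro x hx
    refine (hex x).1 ?_
    exact congrArg Subtype.val (Subsingleton.elim (f.rangeRestrict ⟨x, hx⟩) 0)

end AuslanderRegular

/-! ### Inverse systems of Banach modules -/

section MittagLeffler

/-- The shift operator `x ↦ (ρ n (x (n + 1)))ₙ` on the sequences in an inverse system `(F, ρ)`; its
fixed points are the elements of the inverse limit. -/
def invShift {F : ℕ → Type*} [∀ n, AddCommGroup (F n)] (ρ : ∀ n, F (n + 1) →+ F n)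
    (x : ∀ n, F n) : ∀ n, F n := fun n => ρ n (x (n + 1))

variable {F : ℕ → Type*} [∀ n, NormedAddCommGroup (F n)] (ρ : ∀ n, F (n + 1) →+ F n)

/-- The sum of the norms of the images of an element of `F n` in `F n, F (n - 1), …, F 0`. It
replaces the norm of `F n` in the Mittag-Leffler argument, since the transition maps do not increase
it. -/
def pushNorm : ∀ n, F n → ℝ
  | 0, y => ‖y‖
  | n + 1, y => ‖y‖ + pushNorm n (ρ n y)

theorem pushNorm_nonneg (n : ℕ) (y : F n) : 0 ≤ pushNorm ρ n y := by
  induction n with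
  | zero => exact norm_nonneg y
  | succ n ih => exact add_nonneg (norm_nonneg y) (ih _)

theorem norm_le_pushNorm (n : ℕ) (y : F n) : ‖y‖ ≤ pushNorm ρ n y := by
  cases n with
  | zero => exact le_rfl
  | succ n => exact le_add_of_nonneg_right (pushNorm_nonneg ρ n _)

theorem pushNorm_map_le (n : ℕ) (y : F (n + 1)) : pushNorm ρ n (ρ n y) ≤ pushNorm ρ (n + 1) y :=
  le_add_of_nonneg_left (norm_nonneg y)

theorem pushNorm_zero (n : ℕ) : pushNorm ρ n 0 = 0 := by
  induction n with
  | zero => exact norm_zero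
  | succ n ih => rw [pushNorm, map_zero, ih, norm_zero, add_zero]

variable {ρ} in
theorem continuous_pushNorm (hρ : ∀ n, Continuous (ρ n)) (n : ℕ) : Continuous (pushNorm ρ n) := by
  induction n with
  | zero => exact continuous_norm
  | succ n ih => exact continuous_norm.add (ih.comp (hρ n))

theorem pushNorm_iterate_le {b : ℕ → ℝ} {e : ∀ n, F n} (he : ∀ n, pushNorm ρ n (e n) ≤ b n)
    (k n : ℕ) : pushNorm ρ n ((invShift ρ)^[k] e n) ≤ b (n + k) := by
  induction k generalizing n with
  | zero => exact he n
  | succ k ih =>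
    rw [Function.iterate_succ_apply']
    refine (pushNorm_map_le ρ n _).trans ((ih (n + 1)).trans ?_)
    rw [Nat.add_right_comm, Nat.add_assoc]

variable {ρ} in
theorem exists_eq_add_map_succ [∀ n, CompleteSpace (F n)] (hρ : ∀ n, Continuous (ρ n))
    {b : ℕ → ℝ} {c : ℝ} (hb : HasSum b c) {e : ∀ n, F n} (he : ∀ n, pushNorm ρ n (e n) ≤ b n) :
    ∃ y : ∀ n, F n, (∀ n, y n = e n + ρ n (y (n + 1))) ∧ ‖y 0‖ ≤ c := by
  have norm_le : ∀ n k, ‖(invShift ρ)^[k] e n‖ ≤ b (n + k) := fun n k =>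
    (norm_le_pushNorm ρ n _).trans (pushNorm_iterate_le ρ he k n)
  have summable : ∀ n, Summable fun k => (invShift ρ)^[k] e n := fun n =>
    .of_norm_bounded (hb.summable.comp_injective (add_right_injective n)) (norm_le n)
  refine ⟨fun n => ∑' k, (invShift ρ)^[k] e n, fun n => ?_,
    tsum_of_norm_bounded hb fun k => (norm_le 0 k).trans_eq (by rw [zero_add])⟩
  have map_tsum : ρ n (∑' k, (invShift ρ)^[k] e (n + 1)) =
      ∑' k, (invShift ρ)^[k + 1] e n := by
    simp only [Function.iterate_succ_apply']
    exact (((summable (n + 1)).hasSum.map (ρ n) (hρ n)).tsum_eq).symm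
  rw [map_tsum]
  exact (summable n).tsum_eq_zero_add

variable {ρ} in
theorem exists_pushNorm_add_sub_lt (hρ : ∀ n, Continuous (ρ n)) {n : ℕ} {N : AddSubgroup (F n)}
    {y : F n} (hy : y ∈ closure (((ρ n).range ⊔ N : AddSubgroup (F n)) : Set (F n))) {ε : ℝ}
    (hε : 0 < ε) : ∃ w : F (n + 1), ∃ ν ∈ N, pushNorm ρ n (y + ρ n w - ν) < ε := by
  have ball_open : IsOpen {z : F n | pushNorm ρ n (y - z) < ε} :=
    isOpen_lt ((continuous_pushNorm hρ n).comp (continuous_const.sub continuous_id))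
      continuous_const
  obtain ⟨z, hz, hz'⟩ := mem_closure_iff.1 hy _ ball_open <| by
    simpa only [Set.mem_ofPred_eq, sub_self, pushNorm_zero]
  obtain ⟨_, ⟨w, rfl⟩, ν, hν, rfl⟩ := AddSubgroup.mem_sup.1 hz'
  refine ⟨-w, ν, hν, ?_⟩
  rwa [map_neg, ← sub_eq_add_neg, sub_sub]

theorem exists_sub_map_succ_sub_mem [∀ n, CompleteSpace (F n)] (hρ : ∀ n, Continuous (ρ n))
    (N : ∀ n, AddSubgroup (F n))
    (hN : ∀ n, Dense (((ρ n).range ⊔ N n : AddSubgroup (F n)) : Set (F n)))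
    (d : ∀ n, F n) (v : F 0) {ε : ℝ} (hε : 0 < ε) :
    ∃ x : ∀ n, F n, (∀ n, x n - ρ n (x (n + 1)) - d n ∈ N n) ∧ ‖x 0 - v‖ ≤ ε := by
  choose W V hV hW using fun n y =>
    exists_pushNorm_add_sub_lt hρ (hN n y) (show 0 < ε / 2 / 2 ^ n by positivity)
  -- `w` solves the equations up to summable errors, which `y` then corrects
  let w : ∀ n, F n := fun n => Nat.rec v (fun n z => W n (d n - z)) n
  obtain ⟨y, hy, hy₀⟩ := exists_eq_add_map_succ hρ (hasSum_geometric_two' ε)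
    fun n => (hW n (d n - w n)).le
  refine ⟨fun n => w n + y n, fun n => ?_, ?_⟩
  · have defect : w n + y n - ρ n (w (n + 1) + y (n + 1)) - d n = -V n (d n - w n) := by
      rw [hy n, map_add]
      abel
    rw [defect]
    exact neg_mem (hV n _)
  · rwa [show w 0 + y 0 - v = y 0 from add_sub_cancel_left v (y 0)]

end MittagLeffler

section DenseSubmodule

theorem surjective_of_norm_sub_le {E : Type*} [NormedAddCommGroup E] [CompleteSpace E]
    {g : E →+ E} {c : NNReal} (hc : c < 1) (hg : ∀ x, ‖x - g x‖ ≤ c * ‖x‖) :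
    Function.Surjective g := by
  intro y
  have contracting : ContractingWith c fun x => y + (x - g x) :=
    ⟨hc, LipschitzWith.of_dist_le_mul fun x z => by
      rw [dist_add_left, dist_eq_norm, dist_eq_norm, sub_sub_sub_comm, ← map_sub]
      exact hg _⟩
  have fixed : y + (contracting.fixedPoint - g contracting.fixedPoint) =
    contracting.fixedPoint := contracting.fixedPoint_isFixedPt
  refine ⟨contracting.fixedPoint, ?_⟩
  rwa [add_sub, sub_eq_iff_eq_add, add_comm, add_right_inj, eq_comm] at fixed

variable {R : Type*} [NormedRing R] {σ : Type*}

theorem norm_sub_sum_smul_le [Fintype σ] [DecidableEq σ] {p : σ → σ → R} {δ : ℝ}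
    (hp : ∀ i, ‖Pi.single i 1 - p i‖ ≤ δ) (x : σ → R) :
    ‖x - ∑ i, x i • p i‖ ≤ Fintype.card σ * δ * ‖x‖ :=
  calc ‖x - ∑ i, x i • p i‖ = ‖∑ i, x i • (Pi.single i 1 - p i)‖ := by
        simp only [smul_sub, Finset.sum_sub_distrib, ← pi_eq_sum_univ']
    _ ≤ ∑ _ : σ, ‖x‖ * δ := norm_sum_le_of_le _ fun i _ =>
        (norm_smul_le _ _).trans <|
          mul_le_mul (norm_le_pi_norm x i) (hp i) (norm_nonneg _) (norm_nonneg _)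
    _ = Fintype.card σ * δ * ‖x‖ := by
        rw [Finset.sum_const, Finset.card_univ, nsmul_eq_mul]
        ring

theorem eq_top_of_dense_of_finite [Finite σ] [CompleteSpace R] {P : Submodule R (σ → R)}
    (hP : Dense (P : Set (σ → R))) : P = ⊤ := by
  classical
  have := Fintype.ofFinite σ
  let r := Fintype.card σ
  choose p hp hpe using fun i : σ =>
    hP.exists_dist_lt (Pi.single i 1 : σ → R) (show (0 : ℝ) < 1 / (r + 1) by positivity)
  let g : (σ → R) →+ (σ → R) := (Fintype.linearCombination R p).toAddMonoidHom
  have ratio_lt_one : (r : NNReal) * (1 / (r + 1)) < 1 := by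
    rw [mul_one_div, div_lt_one (by positivity)]
    exact lt_add_one _
  have g_surjective : Function.Surjective g :=
    surjective_of_norm_sub_le ratio_lt_one fun x => by
      push_cast
      exact norm_sub_sum_smul_le (fun i => (dist_eq_norm _ (p i)).symm.trans_le (hpe i).le) x
  refine eq_top_iff.2 fun y _ => ?_
  obtain ⟨x, rfl⟩ := g_surjective y
  exact sum_mem fun i _ => P.smul_mem _ (hp i)

end DenseSubmodule

section CoherentSystem

/-- The conclusions of Theorems A and B for the inverse systems of finite modules over an inverse
system of rings: the first derived limit vanishes, and each module is generated by the global
sections. -/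
def TheoremsAB {R : ℕ → Type u} [∀ n, Ring (R n)] (φ : ∀ n, R (n + 1) →+* R n) : Prop :=
  ∀ (M : ℕ → Type u) [∀ n, AddCommGroup (M n)] [∀ n, Module (R n) (M n)]
    [∀ n, Module.Finite (R n) (M n)] (res : ∀ n, M (n + 1) →ₛₗ[φ n] M n),
    (∀ n, Submodule.span (R n) (Set.range (res n)) = ⊤) →
    (∀ d : ∀ n, M n, ∃ x : ∀ n, M n, ∀ n, x n - res n (x (n + 1)) = d n) ∧
      ∀ n, Submodule.span (R n)
        {y | ∃ x : ∀ n, M n, (∀ k, res k (x (k + 1)) = x k) ∧ x n = y} = ⊤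

variable {R : ℕ → Type u} [∀ n, NormedRing (R n)] {φ : ∀ n, R (n + 1) →+* R n}
  {M : ℕ → Type u} [∀ n, AddCommGroup (M n)] [∀ n, Module (R n) (M n)]
  {res : ∀ n, M (n + 1) →ₛₗ[φ n] M n}

variable (res) in
theorem exists_continuous_lift_fun (k : ℕ → ℕ) (π : ∀ n, (Fin (k n) → R n) →ₗ[R n] M n)
    (hπ : ∀ n, Function.Surjective (π n)) (hc : ∀ n, Continuous (φ n)) (n : ℕ) :
    ∃ ρ : (Fin (k (n + 1)) → R (n + 1)) →ₛₗ[φ n] (Fin (k n) → R n), Continuous ρ ∧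
      ∀ x, π n (ρ x) = res n (π (n + 1) x) := by
  choose a ha using fun i : Fin (k (n + 1)) => hπ n (res n (π (n + 1) (Pi.single i 1)))
  let ρ : (Fin (k (n + 1)) → R (n + 1)) →ₛₗ[φ n] (Fin (k n) → R n) :=
    { toFun := fun x => ∑ i, φ n (x i) • a i
      map_add' := fun x y => by
        simp only [Pi.add_apply, map_add, add_smul, Finset.sum_add_distrib]
      map_smul' := fun s x => by
        simp only [Pi.smul_apply, smul_eq_mul, map_mul, mul_smul, Finset.smul_sum] }
  refine ⟨ρ, ?_, fun x => ?_⟩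
  · change Continuous fun x : Fin (k (n + 1)) → R (n + 1) => ∑ i, φ n (x i) • a i
    exact continuous_finsetSum _ fun i _ =>
      ((hc n).comp (continuous_apply i)).smul continuous_const
  · conv_rhs => rw [pi_eq_sum_univ' x]
    simp only [ρ, LinearMap.coe_mk, AddHom.coe_mk, map_sum, map_smul, ha, LinearMap.map_smulₛₗ]

theorem dense_range_sup_ker {n : ℕ} (hφ : DenseRange (φ n))
    (hres : Submodule.span (R n) (Set.range (res n)) = ⊤)
    {k : ℕ → ℕ} {π : ∀ n, (Fin (k n) → R n) →ₗ[R n] M n}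
    (hπ : Function.Surjective (π (n + 1)))
    {ρ : (Fin (k (n + 1)) → R (n + 1)) →ₛₗ[φ n] (Fin (k n) → R n)}
    (hρ : ∀ x, π n (ρ x) = res n (π (n + 1) x)) :
    Dense ((ρ.toAddMonoidHom.range ⊔ (LinearMap.ker (π n)).toAddSubgroup : AddSubgroup _) :
      Set (Fin (k n) → R n)) := by
  set H := ρ.toAddMonoidHom.range ⊔ (LinearMap.ker (π n)).toAddSubgroup
  let C : Submodule (R n) (Fin (k n) → R n) :=
    { H.topologicalClosure with
      smul_mem' := fun s y hy => by
        refine map_mem_closure₂ continuous_smul (hφ s) hy ?_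
        rintro _ ⟨t, rfl⟩ b hb
        obtain ⟨_, ⟨w, rfl⟩, ν, hν, rfl⟩ := AddSubgroup.mem_sup.1 hb
        rw [smul_add]
        exact add_mem (AddSubgroup.mem_sup_left ⟨t • w, ρ.map_smulₛₗ t w⟩)
          (AddSubgroup.mem_sup_right (Submodule.smul_mem (LinearMap.ker (π n)) _ hν)) }
  have H_le : ∀ y ∈ H, y ∈ C := fun y hy => subset_closure hy
  have ker_le : LinearMap.ker (π n) ≤ C := fun y hy => H_le y (AddSubgroup.mem_sup_right hy)
  have map_eq_top : C.map (π n) = ⊤ := by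
    rw [eq_top_iff, ← hres, Submodule.span_le]
    rintro _ ⟨m, rfl⟩
    obtain ⟨x, rfl⟩ := hπ m
    exact ⟨ρ x, H_le _ (AddSubgroup.mem_sup_left ⟨x, rfl⟩), hρ x⟩
  have C_eq_top : C = ⊤ := by
    rw [← sup_eq_left.2 ker_le, ← Submodule.comap_map_eq, map_eq_top, Submodule.comap_top]
  exact fun y => (C_eq_top.ge trivial : y ∈ C)

variable [∀ n, CompleteSpace (R n)] (hc : ∀ n, Continuous (φ n)) (hφ : ∀ n, DenseRange (φ n))
  (hres : ∀ n, Submodule.span (R n) (Set.range (res n)) = ⊤)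
include hc hφ hres

theorem exists_sub_res_eq_near {k : ℕ → ℕ} {π : ∀ n, (Fin (k n) → R n) →ₗ[R n] M n}
    (hπ : ∀ n, Function.Surjective (π n)) (d : ∀ n, M n) (v : Fin (k 0) → R 0) {ε : ℝ}
    (hε : 0 < ε) :
    ∃ x : ∀ n, M n, (∀ n, x n - res n (x (n + 1)) = d n) ∧ ∃ u, π 0 u = x 0 ∧ ‖u - v‖ ≤ ε := by
  choose ρ hρc hρ using exists_continuous_lift_fun res k π hπ hc
  choose d' hd' using fun n => hπ n (d n)
  obtain ⟨x, hx, hx₀⟩ := exists_sub_map_succ_sub_mem (fun n => (ρ n).toAddMonoidHom) hρc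
    (fun n => (LinearMap.ker (π n)).toAddSubgroup)
    (fun n => dense_range_sup_ker (hφ n) (hres n) (hπ (n + 1)) (hρ n)) d' v hε
  refine ⟨fun n => π n (x n), fun n => ?_, x 0, rfl, hx₀⟩
  have π_eq_zero : π n (x n - ρ n (x (n + 1)) - d' n) = 0 := hx n
  rwa [map_sub, map_sub, hρ, hd', sub_eq_zero] at π_eq_zero

theorem span_globalSections_zero_eq_top [∀ n, Module.Finite (R n) (M n)] :
    Submodule.span (R 0) {y | ∃ x : ∀ n, M n, (∀ k, res k (x (k + 1)) = x k) ∧ x 0 = y} = ⊤ := by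
  choose k π hπ using fun n => Module.Finite.exists_fin' (R n) (M n)
  set P := Submodule.span (R 0) {y | ∃ x : ∀ n, M n, (∀ k, res k (x (k + 1)) = x k) ∧ x 0 = y}
  have comap_eq_top : P.comap (π 0) = ⊤ := by
    refine eq_top_of_dense_of_finite fun v => Metric.mem_closure_iff.2 fun ε hε => ?_
    obtain ⟨x, hx, u, hu, huv⟩ :=
      exists_sub_res_eq_near hc hφ hres hπ (fun _ => 0) v (half_pos hε)
    refine ⟨u, Submodule.subset_span ⟨x, fun k => (sub_eq_zero.1 (hx k)).symm, hu.symm⟩, ?_⟩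
    rw [dist_comm, dist_eq_norm]
    exact huv.trans_lt (half_lt_self hε)
  rw [← Submodule.map_comap_eq_of_surjective (hπ 0) P, comap_eq_top, Submodule.map_top,
    LinearMap.range_eq_top.2 (hπ 0)]

omit hres in
theorem theoremsAB_of_denseRange : TheoremsAB φ := by
  intro M _ _ _ res hres
  constructor
  · intro d
    choose k π hπ using fun n => Module.Finite.exists_fin' (R n) (M n)
    obtain ⟨x, hx, -⟩ := exists_sub_res_eq_near hc hφ hres hπ d 0 one_pos
    exact ⟨x, hx⟩
  · intro n
    induction n generalizing R M with
    | zero => exact span_globalSections_zero_eq_top hc hφ hres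
    | succ n ih =>
      rw [eq_top_iff, ← ih (fun n => hc (n + 1)) (fun n => hφ (n + 1)) (fun n => M (n + 1))
        (fun n => res (n + 1)) (fun n => hres (n + 1))]
      refine Submodule.span_mono ?_
      rintro _ ⟨x, hx, rfl⟩
      exact ⟨fun k => Nat.casesOn (motive := M) k (res 0 (x 0)) x, Nat.rec rfl fun k _ => hx k, rfl⟩

end CoherentSystem

/-! ### Inverse systems of Fréchet–Stein type -/

section Relations

variable {A : Type u} [Ring A] {S : Type u} [Ring S] {G : Type u} [AddCommGroup G] [Module A G]

/-- The `S`-module of relations among `1 ⊗ m₀, …, 1 ⊗ mᵣ₋₁` in `S ⊗_A G` that is spanned by the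
images of the relations with coefficients in `A` among `m₀, …, mᵣ₋₁`. It is used in the equational
criterion for flatness. -/
def relationSpan (ψ : A →+* S) {r : ℕ} (m : Fin r → G) : Submodule S (Fin r → S) :=
  Submodule.span S ((fun a i => ψ (a i)) '' {a : Fin r → A | ∑ i, a i • m i = 0})

theorem sum_tmul_eq_zero_of_mem_relationSpan {ψ : A →+* S} {r : ℕ} {m : Fin r → G}
    {s : Fin r → S} (hs : s ∈ relationSpan ψ m) : ∑ i, BaseChange.tmul ψ (s i) (m i) = 0 := by
  have relationSpan_le : relationSpan ψ m ≤
      LinearMap.ker (Fintype.linearCombination S fun i => BaseChange.mk ψ G (m i)) := by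
    refine Submodule.span_le.2 ?_
    rintro _ ⟨a, ha, rfl⟩
    rw [SetLike.mem_coe, LinearMap.mem_ker, Fintype.linearCombination_apply]
    simp only [← LinearMap.map_smulₛₗ, ← map_sum]
    rw [ha, map_zero]
  simpa only [LinearMap.mem_ker, Fintype.linearCombination_apply, BaseChange.smul_mk] using
    relationSpan_le hs

theorem flatAsRightModule_of_mem_relationSpan {ψ : A →+* S}
    (hψ : ∀ (G : Type u) [AddCommGroup G] [Module A G] (r : ℕ) (m : Fin r → G) (s : Fin r → S),
      ∑ i, BaseChange.tmul ψ (s i) (m i) = 0 → s ∈ relationSpan ψ m) : FlatAsRightModule ψ := by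
  intro N N' _ _ _ _ f hf
  refine (injective_iff_map_eq_zero _).2 fun x hx => ?_
  obtain ⟨r, s, m, rfl⟩ := BaseChange.exists_sum (φ := ψ) x
  refine sum_tmul_eq_zero_of_mem_relationSpan (Submodule.span_mono (Set.image_mono fun a ha => ?_)
    (hψ N' r (fun i => f (m i)) s (by simpa only [map_sum, BaseChange.map_tmul] using hx)))
  exact hf (by simpa using ha)

end Relations

section Kernel

variable {R S : Type u} [Ring R] [Ring S] {φ : R →+* S}

variable (φ) in
/-- The ring homomorphism `φ` applied to each coordinate, as a semilinear map `R^r → S^r`. -/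
def coordinateMap (r : ℕ) : (Fin r → R) →ₛₗ[φ] (Fin r → S) where
  toFun x i := φ (x i)
  map_add' _ _ := funext fun _ => map_add φ _ _
  map_smul' _ _ := funext fun _ => map_mul φ _ _

theorem BaseChange.lift_coordinateMap_surjective (r : ℕ) :
    Function.Surjective (BaseChange.lift (coordinateMap φ r)) := by
  refine fun x => ⟨∑ i, BaseChange.tmul φ (x i) (Pi.single i 1), ?_⟩
  have map_single (i : Fin r) :
      coordinateMap φ r (Pi.single i 1) = Pi.single i (1 : S) :=
    funext fun j => (Pi.apply_single (fun _ => φ) (fun _ => _root_.map_zero φ) i 1 j).trans <| by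
      rw [map_one]
  simp only [map_sum, BaseChange.lift_tmul, map_single]
  exact (pi_eq_sum_univ' x).symm

/-- The map induced on the kernels by a commutative square whose vertical maps are semilinear. -/
def kerMap {P M : Type u} {P' M' : Type u} [AddCommGroup P] [Module R P] [AddCommGroup M]
    [Module R M] [AddCommGroup P'] [Module S P'] [AddCommGroup M'] [Module S M'] {f : P →ₗ[R] M}
    {g : P' →ₗ[S] M'} {c : P →ₛₗ[φ] P'} {ρ : M →ₛₗ[φ] M'} (h : ∀ x, g (c x) = ρ (f x)) :
    LinearMap.ker f →ₛₗ[φ] LinearMap.ker g :=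
  (c.domRestrict (LinearMap.ker f)).codRestrict (LinearMap.ker g) fun x => by
    rw [LinearMap.mem_ker, LinearMap.domRestrict_apply, h, LinearMap.mem_ker.1 x.2, map_zero]

theorem FlatAsRightModule.lift_kerMap_surjective (hφ : FlatAsRightModule φ)
    {P M : Type u} {P' M' : Type u} [AddCommGroup P] [Module R P] [AddCommGroup M]
    [Module R M] [AddCommGroup P'] [Module S P'] [AddCommGroup M'] [Module S M'] {f : P →ₗ[R] M}
    {g : P' →ₗ[S] M'} {c : P →ₛₗ[φ] P'} {ρ : M →ₛₗ[φ] M'} (h : ∀ x, g (c x) = ρ (f x))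
    (hc : Function.Surjective (BaseChange.lift c))
    (hρ : Function.Injective (BaseChange.lift ρ)) :
    Function.Surjective (BaseChange.lift (kerMap h)) := by
  rintro ⟨x, hx⟩
  obtain ⟨X, rfl⟩ := hc x
  have lift_square : BaseChange.lift ρ (BaseChange.map φ f X) = g (BaseChange.lift c X) :=
    LinearMap.congr_fun (BaseChange.hom_ext (f := BaseChange.lift ρ ∘ₗ BaseChange.map φ f)
      (g := g ∘ₗ BaseChange.lift c) fun y => by
        simp only [LinearMap.comp_apply, BaseChange.map_mk, BaseChange.lift_mk, h]) X
  have map_eq_zero : BaseChange.map φ f X = 0 :=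
    hρ (lift_square.trans ((LinearMap.mem_ker.1 hx).trans (map_zero _).symm))
  obtain ⟨Z, rfl⟩ := (hφ.map_exact (LinearMap.exact_subtype_ker_map f) X).1 map_eq_zero
  refine ⟨Z, Subtype.ext ?_⟩
  exact LinearMap.congr_fun (BaseChange.hom_ext
    (f := (LinearMap.ker g).subtype ∘ₗ BaseChange.lift (kerMap h))
    (g := BaseChange.lift c ∘ₗ BaseChange.map φ (LinearMap.ker f).subtype) fun y => by
      simp only [LinearMap.comp_apply, BaseChange.map_mk, BaseChange.lift_mk]
      rfl) Z

end Kernel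

/-- The formal properties of the inverse system of Banach algebras `A_{q_n}` of a Fréchet–Stein
algebra `A` on which the theory of coadmissible modules rests. Rings and modules carry no topology
here: completeness enters through `TheoremsAB` only. -/
structure IsSteinSystem {A : Type u} [Ring A] {R : ℕ → Type u} [∀ n, Ring (R n)]
    (φ : ∀ n, R (n + 1) →+* R n) (ι : ∀ n, A →+* R n) : Prop where
  comp : ∀ n a, φ n (ι (n + 1) a) = ι n a
  noetherian : ∀ n, IsNoetherianRing (R n)
  flat : ∀ n, FlatAsRightModule (φ n)
  existsUnique : ∀ x : ∀ n, R n, (∀ n, φ n (x (n + 1)) = x n) → ∃! a, ∀ n, ι n a = x n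
  theoremsAB : TheoremsAB φ

section SteinSystem

variable {A : Type u} [Ring A] {R : ℕ → Type u} [∀ n, Ring (R n)]
  {φ : ∀ n, R (n + 1) →+* R n} {ι : ∀ n, A →+* R n}
variable {M : ℕ → Type u} [∀ n, AddCommGroup (M n)] [∀ n, Module (R n) (M n)]
variable {G : Type u} [AddCommGroup G] [Module A G]

/-- `G` is the inverse limit of the modules `M n`. -/
structure IsLimitModule (res : ∀ n, M (n + 1) →ₛₗ[φ n] M n) (p : ∀ n, G →ₛₗ[ι n] M n) :
    Prop where
  comp : ∀ n g, res n (p (n + 1) g) = p n g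
  existsUnique : ∀ x : ∀ n, M n, (∀ n, res n (x (n + 1)) = x n) → ∃! g, ∀ n, p n g = x n

theorem IsLimitModule.eq_zero {res : ∀ n, M (n + 1) →ₛₗ[φ n] M n} {p : ∀ n, G →ₛₗ[ι n] M n}
    (h : IsLimitModule res p) {g : G} (hg : ∀ n, p n g = 0) : g = 0 :=
  (h.existsUnique (fun _ => 0) fun _ => map_zero _).unique hg fun _ => map_zero _

open BaseChange

namespace IsSteinSystem

variable (h : IsSteinSystem φ ι)
include h

theorem mem_relationSpan {res : ∀ n, M (n + 1) →ₛₗ[φ n] M n}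
    (hres : ∀ n, Function.Injective (lift (res n))) {p : ∀ n, G →ₛₗ[ι n] M n}
    (hp : ∀ n g, res n (p (n + 1) g) = p n g) (p_injective : ∀ g, (∀ n, p n g = 0) → g = 0)
    {r : ℕ} {m : Fin r → G} {n : ℕ} {s : Fin r → R n} (hs : ∑ i, s i • p n (m i) = 0) :
    s ∈ relationSpan (ι n) m := by
  have := h.noetherian
  let α : ∀ k, (Fin r → R k) →ₗ[R k] M k := fun k => Fintype.linearCombination (R k) (p k ∘ m)
  have α_comp : ∀ k x, α k (coordinateMap (φ k) r x) = res k (α (k + 1) x) := fun k x => by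
    simp only [α, Fintype.linearCombination_apply, Function.comp_apply, map_sum,
      LinearMap.map_smulₛₗ, hp]
    rfl
  -- the kernels of `α` form a system whose global sections are the relations over `A`
  have span_kerMap : ∀ k, Submodule.span (R k) (Set.range (kerMap (α_comp k))) = ⊤ := fun k => by
    rw [← range_lift, LinearMap.range_eq_top]
    exact (h.flat k).lift_kerMap_surjective _ (lift_coordinateMap_surjective r) (hres k)
  have s_mem : s ∈ (⊤ : Submodule (R n) (LinearMap.ker (α n))).map (LinearMap.ker (α n)).subtype :=
    ⟨⟨s, hs⟩, trivial, rfl⟩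
  rw [← (h.theoremsAB _ _ span_kerMap).2 n, Submodule.map_span] at s_mem
  refine Submodule.span_mono ?_ s_mem
  rintro _ ⟨_, ⟨x, hx, rfl⟩, rfl⟩
  choose a ha using fun i : Fin r => (h.existsUnique (fun k => (x k).1 i)
    fun k => congrFun (congrArg Subtype.val (hx k)) i).exists
  refine ⟨a, p_injective _ fun k => ?_, funext fun i => ha i n⟩
  simp only [map_sum, LinearMap.map_smulₛₗ, ha]
  exact (x k).2

theorem lift_bijective [∀ n, Module.Finite (R n) (M n)] {res : ∀ n, M (n + 1) →ₛₗ[φ n] M n}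
    (hres : ∀ n, Function.Bijective (lift (res n))) {p : ∀ n, G →ₛₗ[ι n] M n}
    (hG : IsLimitModule res p) (n : ℕ) : Function.Bijective (lift (p n)) := by
  constructor
  · refine (injective_iff_map_eq_zero _).2 fun x hx => ?_
    obtain ⟨r, s, g, rfl⟩ := exists_sum (φ := ι n) x
    rw [map_sum] at hx
    exact sum_tmul_eq_zero_of_mem_relationSpan
      (h.mem_relationSpan (fun k => (hres k).1) hG.comp (fun _ => hG.eq_zero) hx)
  · have span_res : ∀ k, Submodule.span (R k) (Set.range (res k)) = ⊤ := fun k => by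
      rw [← range_lift, LinearMap.range_eq_top]
      exact (hres k).2
    rw [← LinearMap.range_eq_top, range_lift, eq_top_iff, ← (h.theoremsAB M res span_res).2 n]
    refine Submodule.span_mono ?_
    rintro _ ⟨x, hx, rfl⟩
    obtain ⟨g, hg⟩ := (hG.existsUnique x hx).exists
    exact ⟨g, hg n⟩

theorem eq_zero_of_mk_finsupp_eq_zero {X : Type u} (f : X →₀ A)
    (hf : ∀ n, BaseChange.mk (ι n) (X →₀ A) f = 0) : f = 0 := by
  refine Finsupp.ext fun x => (h.existsUnique (fun _ => 0) fun _ => map_zero _).unique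
    (fun n => ?_) fun _ => _root_.map_zero _
  let coordinate : (X →₀ A) →ₛₗ[ι n] R n :=
    { toFun := fun f => ι n (f x)
      map_add' := fun _ _ => map_add _ _ _
      map_smul' := fun _ _ => map_mul _ _ _ }
  exact (lift_mk coordinate f).symm.trans (by rw [hf n, _root_.map_zero])

theorem mem_relationSpan_of_finsupp {X : Type u} {r : ℕ} {m : Fin r → X →₀ A} {n : ℕ}
    {s : Fin r → R n} (hs : ∑ i, tmul (ι n) (s i) (m i) = 0) : s ∈ relationSpan (ι n) m :=
  h.mem_relationSpan (M := fun k => BaseChange (ι k) (X →₀ A))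
    (res := fun k => trans (h.comp k) (X →₀ A)) (p := fun k => BaseChange.mk (ι k) (X →₀ A))
    (fun k => (lift_trans_bijective (h.comp k) _).1) (fun k => trans_mk (h.comp k) _)
    h.eq_zero_of_mk_finsupp_eq_zero (by simpa only [smul_mk] using hs)

theorem mem_relationSpan_of_sum_tmul_eq_zero {r : ℕ} {m : Fin r → G} {n : ℕ} {s : Fin r → R n}
    (hs : ∑ i, tmul (ι n) (s i) (m i) = 0) : s ∈ relationSpan (ι n) m := by
  let π : (G →₀ A) →ₗ[A] G := Finsupp.linearCombination A id
  have hπ : Function.Surjective π := Finsupp.linearCombination_id_surjective A G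
  choose z hz using fun i => hπ (m i)
  have map_exact := BaseChange.map_exact (ι n) (N := LinearMap.ker π) π.exact_subtype_ker_map hπ
  obtain ⟨Z, hZ⟩ := (map_exact (∑ i, tmul (ι n) (s i) (z i))).1
    (by simpa only [map_sum, map_tmul, hz] using hs)
  -- in the free module the relation becomes one between lifts of the `m i` and elements of `ker π`
  obtain ⟨k, t, v, rfl⟩ := exists_sum (φ := ι n) Z
  have free_relation := h.mem_relationSpan_of_finsupp
    (m := Fin.append z fun j => (v j : G →₀ A)) (s := Fin.append s fun j => -t j) (by
      simp only [Fin.sum_univ_add, Fin.append_left, Fin.append_right, ← smul_mk, neg_smul,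
        Finset.sum_neg_distrib]
      simp only [smul_mk]
      rw [← hZ, map_sum]
      exact add_neg_cancel _)
  have truncated_relation := Submodule.mem_map_of_mem
    (f := LinearMap.funLeft (R n) (R n) (Fin.castAdd k)) free_relation
  rw [relationSpan, Submodule.map_span, Set.image_image, show LinearMap.funLeft (R n) (R n)
    (Fin.castAdd k) (Fin.append s fun j => -t j) = s from
    funext fun i => Fin.append_left s (fun j => -t j) i]
    at truncated_relation
  refine Submodule.span_mono ?_ truncated_relation
  rintro _ ⟨a, ha, rfl⟩
  refine ⟨fun i => a (Fin.castAdd k i), ?_, rfl⟩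
  have π_eq_zero : ∀ j, π (v j : G →₀ A) = 0 := fun j => (v j).2
  simpa only [Set.mem_ofPred_eq, Fin.sum_univ_add, Fin.append_left, Fin.append_right, map_add,
    map_sum, map_smul, hz, π_eq_zero, smul_zero, Finset.sum_const_zero, add_zero,
    _root_.map_zero] using
    congrArg π ha

theorem flat_ι (n : ℕ) : FlatAsRightModule (ι n) :=
  flatAsRightModule_of_mem_relationSpan fun _ _ _ _ _ _ => h.mem_relationSpan_of_sum_tmul_eq_zero

end IsSteinSystem

end SteinSystem

/-! ### Coadmissible modules over Stein systems -/

section Coadmissible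

variable {A : Type u} [Ring A] {R : ℕ → Type u} [∀ n, Ring (R n)]
  {φ : ∀ n, R (n + 1) →+* R n} {ι : ∀ n, A →+* R n}

open BaseChange

/-- Coadmissible modules in a coordinate-free form: the modules `R n ⊗_A N` are finite and their
limit is `N`. -/
structure IsCoadmissibleOver (hc : ∀ n a, φ n (ι (n + 1) a) = ι n a) (N : Type u) [AddCommGroup N]
    [Module A N] : Prop where
  finite : ∀ n, Module.Finite (R n) (BaseChange (ι n) N)
  isLimit : IsLimitModule (M := fun n => BaseChange (ι n) N) (fun n => trans (hc n) N)
    (fun n => BaseChange.mk (ι n) N)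

variable {G : Type u} [AddCommGroup G] [Module A G]

theorem IsCoadmissibleOver.subsingleton_iff {hc : ∀ n a, φ n (ι (n + 1) a) = ι n a}
    (hG : IsCoadmissibleOver hc G) : Subsingleton G ↔ ∀ n, Subsingleton (BaseChange (ι n) G) :=
  ⟨fun _ _ => inferInstance, fun _ => subsingleton_of_forall_eq 0 fun _ =>
    hG.isLimit.eq_zero fun _ => Subsingleton.elim _ _⟩

theorem IsSteinSystem.isCoadmissibleOver_of_isLimit (h : IsSteinSystem φ ι) {M : ℕ → Type u}
    [∀ n, AddCommGroup (M n)] [∀ n, Module (R n) (M n)] [∀ n, Module.Finite (R n) (M n)]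
    {res : ∀ n, M (n + 1) →ₛₗ[φ n] M n} (hres : ∀ n, Function.Bijective (lift (res n)))
    {p : ∀ n, G →ₛₗ[ι n] M n} (hG : IsLimitModule res p) : IsCoadmissibleOver h.comp G := by
  let e : ∀ n, BaseChange (ι n) G ≃ₗ[R n] M n := fun n =>
    LinearEquiv.ofBijective (lift (p n)) (h.lift_bijective hres hG n)
  have e_mk : ∀ n g, e n (BaseChange.mk (ι n) G g) = p n g := fun n g => lift_mk (p n) g
  have e_trans : ∀ n x, e n (trans (h.comp n) G x) = res n (e (n + 1) x) := fun n x => by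
    induction x using induction with
    | tmul s g =>
      rw [← smul_mk, (trans (h.comp n) G).map_smulₛₗ, map_smul, trans_mk, map_smul,
        (res n).map_smulₛₗ, e_mk, e_mk, hG.comp]
    | add x y hx hy => simp only [map_add, hx, hy]
  refine ⟨fun n => Module.Finite.equiv (e n).symm, fun n g => trans_mk (h.comp n) G g,
    fun x hx => ?_⟩
  obtain ⟨g, hg, g_unique⟩ := hG.existsUnique (fun n => e n (x n)) fun n => by rw [← e_trans, hx]
  refine ⟨g, fun n => (e n).injective ((e_mk n g).trans (hg n)),
    fun g' hg' => g_unique g' fun n => ?_⟩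
  rw [← e_mk]
  exact congrArg (e n) (hg' n)

variable (ι) in
/-- The submodule of `G` cut out by submodules of the modules `R n ⊗_A G`. -/
def subLimit (G : Type u) [AddCommGroup G] [Module A G]
    (L : ∀ n, Submodule (R n) (BaseChange (ι n) G)) : Submodule A G :=
  ⨅ n, (L n).comap (BaseChange.mk (ι n) G)

theorem mem_subLimit {L : ∀ n, Submodule (R n) (BaseChange (ι n) G)} {g : G} :
    g ∈ subLimit ι G L ↔ ∀ n, BaseChange.mk (ι n) G g ∈ L n := by
  simp only [subLimit, Submodule.mem_iInf, Submodule.mem_comap]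

/-- The projection from the limit of the submodules `L n` to `L n`. -/
def subLimitProj (L : ∀ n, Submodule (R n) (BaseChange (ι n) G)) (n : ℕ) :
    subLimit ι G L →ₛₗ[ι n] L n :=
  ((BaseChange.mk (ι n) G).domRestrict (subLimit ι G L)).codRestrict (L n) fun x =>
    mem_subLimit.1 x.2 n

namespace IsSteinSystem

variable (h : IsSteinSystem φ ι) (hG : IsCoadmissibleOver h.comp G)
  (L : ∀ n, Submodule (R n) (BaseChange (ι n) G))
  (hL : ∀ n, Submodule.span (R n) (trans (h.comp n) G '' L (n + 1)) = L n)

/-- The transition maps between the submodules `L n`. -/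
def subLimitTrans (n : ℕ) : L (n + 1) →ₛₗ[φ n] L n :=
  ((trans (h.comp n) G).domRestrict (L (n + 1))).codRestrict (L n) fun x => by
    rw [← hL n]
    exact Submodule.subset_span ⟨x, x.2, rfl⟩

theorem span_range_subLimitTrans (n : ℕ) :
    Submodule.span (R n) (Set.range (h.subLimitTrans L hL n)) = ⊤ := by
  apply Submodule.map_injective_of_injective (L n).injective_subtype
  rw [Submodule.map_span, Submodule.map_top, Submodule.range_subtype, ← Set.range_comp]
  conv_rhs => rw [← hL n, Set.image_eq_range]
  rfl

theorem lift_subLimitTrans_bijective (n : ℕ) :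
    Function.Bijective (lift (h.subLimitTrans L hL n)) := by
  constructor
  · have subtype_comp_lift : (L n).subtype ∘ₗ lift (h.subLimitTrans L hL n) =
        lift (trans (h.comp n) G) ∘ₗ map (φ n) (L (n + 1)).subtype := hom_ext fun x => by
      simp only [LinearMap.comp_apply, lift_mk, map_mk]
      rfl
    have comp_injective :
        Function.Injective (lift (trans (h.comp n) G) ∘ₗ map (φ n) (L (n + 1)).subtype) :=
      (lift_trans_bijective (h.comp n) G).1.comp
        (h.flat n _ _ _ (L (n + 1)).injective_subtype)
    rw [← subtype_comp_lift, LinearMap.coe_comp] at comp_injective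
    exact comp_injective.of_comp
  · rw [← LinearMap.range_eq_top, range_lift, h.span_range_subLimitTrans L hL n]

include hG

theorem isLimitModule_subLimit :
    IsLimitModule (h.subLimitTrans L hL) (subLimitProj (ι := ι) L) := by
  refine ⟨fun n g => Subtype.ext (trans_mk (h.comp n) G _), fun x hx => ?_⟩
  obtain ⟨g, hg, g_unique⟩ :=
    hG.isLimit.existsUnique (fun n => x n) fun n => congrArg Subtype.val (hx n)
  have g_mem : g ∈ subLimit ι G L := mem_subLimit.2 fun n => by
    rw [show BaseChange.mk (ι n) G g = x n from hg n]
    exact (x n).2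
  exact ⟨⟨g, g_mem⟩, fun n => Subtype.ext (hg n), fun g' hg' =>
    Subtype.ext (g_unique g' fun n => congrArg Subtype.val (hg' n))⟩

theorem finite_submodule_baseChange (n : ℕ) : Module.Finite (R n) (L n) := by
  have := h.noetherian n
  have := hG.finite n
  infer_instance

include hL

theorem isCoadmissibleOver_subLimit : IsCoadmissibleOver h.comp (subLimit ι G L) :=
  have := h.finite_submodule_baseChange hG L
  h.isCoadmissibleOver_of_isLimit (h.lift_subLimitTrans_bijective L hL)
    (h.isLimitModule_subLimit hG L hL)

theorem range_map_subLimit (n : ℕ) :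
    LinearMap.range (map (ι n) (subLimit ι G L).subtype) = L n := by
  have := h.finite_submodule_baseChange hG L
  have lift_surjective : Function.Surjective (lift (subLimitProj (ι := ι) L n)) :=
    (h.lift_bijective (h.lift_subLimitTrans_bijective L hL)
      (h.isLimitModule_subLimit hG L hL) n).2
  have subtype_comp_lift : (L n).subtype ∘ₗ lift (subLimitProj (ι := ι) L n) =
      map (ι n) (subLimit ι G L).subtype := hom_ext fun x => by
    rw [LinearMap.comp_apply, lift_mk, map_mk]
    rfl
  rw [← subtype_comp_lift, LinearMap.range_comp, LinearMap.range_eq_top.2 lift_surjective,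
    Submodule.map_top, Submodule.range_subtype]

theorem ker_map_mkQ_subLimit (n : ℕ) :
    LinearMap.ker (map (ι n) (subLimit ι G L).mkQ) = L n := by
  rw [(map_exact (ι n) (LinearMap.exact_subtype_mkQ (subLimit ι G L))
    (Submodule.mkQ_surjective _)).linearMap_ker_eq, h.range_map_subLimit hG L hL n]

theorem exists_mk_mkQ_subLimit_eq (x : ∀ n, BaseChange (ι n) (G ⧸ subLimit ι G L))
    (hx : ∀ n, trans (h.comp n) _ (x (n + 1)) = x n) :
    ∃ g : G, ∀ n, BaseChange.mk (ι n) _ ((subLimit ι G L).mkQ g) = x n := by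
  have := h.finite_submodule_baseChange hG L
  have map_eq_zero_iff : ∀ n y, map (ι n) (subLimit ι G L).mkQ y = 0 ↔ y ∈ L n := fun n y => by
    rw [← LinearMap.mem_ker, h.ker_map_mkQ_subLimit hG L hL n]
  choose y hy using fun n => map_surjective (ι n) (subLimit ι G L).mkQ_surjective (x n)
  have defect_mem : ∀ n, y n - trans (h.comp n) G (y (n + 1)) ∈ L n := fun n => by
    rw [← map_eq_zero_iff, map_sub, ← trans_map, hy, hy, hx, sub_self]
  -- the first derived limit of the modules `L n` vanishes, so `y` can be corrected by `l`
  obtain ⟨l, hl⟩ := (h.theoremsAB (fun n => L n) (h.subLimitTrans L hL)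
    (h.span_range_subLimitTrans L hL)).1 fun n => ⟨_, defect_mem n⟩
  obtain ⟨g, hg, -⟩ := hG.isLimit.existsUnique (fun n => y n - l n) fun n => by
    have defect_eq : (l n : BaseChange (ι n) G) - trans (h.comp n) G (l (n + 1)) =
      y n - trans (h.comp n) G (y (n + 1)) := congrArg Subtype.val (hl n)
    rw [map_sub, sub_eq_sub_iff_sub_eq_sub, ← neg_sub, ← defect_eq, neg_sub]
  refine ⟨g, fun n => ?_⟩
  rw [← map_mk, show BaseChange.mk (ι n) G g = y n - l n from hg n, map_sub,
    (map_eq_zero_iff n (l n)).2 (l n).2, sub_zero, hy]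

theorem isCoadmissibleOver_quotient : IsCoadmissibleOver h.comp (G ⧸ subLimit ι G L) := by
  have := hG.finite
  have mkQ_surjective := (subLimit ι G L).mkQ_surjective
  refine ⟨fun n => Module.Finite.of_surjective _ (map_surjective (ι n) mkQ_surjective),
    fun n g => trans_mk (h.comp n) _ g, fun x hx => ?_⟩
  obtain ⟨g, hg⟩ := h.exists_mk_mkQ_subLimit_eq hG L hL x hx
  refine ⟨(subLimit ι G L).mkQ g, hg, fun z hz => ?_⟩
  obtain ⟨g', rfl⟩ := mkQ_surjective z
  rw [← sub_eq_zero, ← map_sub]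
  refine (Submodule.Quotient.mk_eq_zero _).2 (mem_subLimit.2 fun n => ?_)
  rw [← h.ker_map_mkQ_subLimit hG L hL n, LinearMap.mem_ker, map_mk, map_sub, map_sub,
    sub_eq_zero]
  exact (hz n).trans (hg n).symm

end IsSteinSystem

end Coadmissible

/-! ### `Ext` groups of coadmissible modules -/

section ExtCoadmissible

variable {A : Type u} [Ring A] {R : ℕ → Type u} [∀ n, Ring (R n)]
  {φ : ∀ n, R (n + 1) →+* R n} {ι : ∀ n, A →+* R n}

open BaseChange

variable (ι) in
/-- The product of the rings `R n`, as an `A`-module. -/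
abbrev RestrictionPi : Type u := ∀ n, Restriction (ι n) (R n)

variable (ι) in
/-- The map from `A` to the product of the rings `R n`. -/
def toRestrictionPi : A →ₗ[A] RestrictionPi ι := LinearMap.pi fun n => Restriction.ofRing (ι n)

/-- The `n`-th coordinate of an element of the product of the rings `R n`, as a linear map. -/
abbrev RestrictionPi.proj (n : ℕ) : RestrictionPi ι →ₗ[A] Restriction (ι n) (R n) :=
  LinearMap.proj (R := A) (φ := fun n => Restriction (ι n) (R n)) n

/-- The map `(xₙ) ↦ (xₙ - φₙ(xₙ₊₁))`, whose kernel is the inverse limit of the rings `R n`. -/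
def oneSubShift (hc : ∀ n a, φ n (ι (n + 1) a) = ι n a) : RestrictionPi ι →ₗ[A] RestrictionPi ι :=
  LinearMap.pi fun n =>
    RestrictionPi.proj n - Restriction.ofTower (hc n) ∘ₗ RestrictionPi.proj (n + 1)

variable (ι) in
/-- `Ext^l_A(N, -)` commutes with the product of the rings `R n`. -/
def extPiEquiv (N : Type u) [AddCommGroup N] [Module A N] (l : ℕ) :
    ModExt A N (RestrictionPi ι) l ≃+ ∀ n, ExtAlong (ι n) N l :=
  AddEquiv.ofBijective (ModExt.piMap (R := A) (fun n => Restriction (ι n) (R n)) N l)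
    (ModExt.piMap_bijective _ l N)

variable {N : Type u} [AddCommGroup N] [Module A N] (l : ℕ)

theorem extPiEquiv_postcomp_toRestrictionPi (x : ExtDual A N l) (n : ℕ) :
    extPiEquiv ι N l (ModExt.postcomp N l (toRestrictionPi ι) x) n =
      ExtAlong.ofDual (ι n) N l x :=
  (ModExt.postcomp_comp l _ _ x).symm

theorem extPiEquiv_postcomp_oneSubShift (hc : ∀ n a, φ n (ι (n + 1) a) = ι n a)
    (x : ModExt A N (RestrictionPi ι) l) (n : ℕ) :
    extPiEquiv ι N l (ModExt.postcomp N l (oneSubShift hc) x) n =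
      extPiEquiv ι N l x n - ExtAlong.trans (hc n) N l (extPiEquiv ι N l x (n + 1)) :=
  calc
    _ = ModExt.postcomp N l (RestrictionPi.proj n ∘ₗ oneSubShift hc) x :=
      (ModExt.postcomp_comp l _ _ x).symm
    _ = ModExt.postcomp N l (RestrictionPi.proj n) x -
        ModExt.postcomp N l (Restriction.ofTower (hc n) ∘ₗ RestrictionPi.proj (n + 1)) x :=
      ModExt.postcomp_sub l _ _ x
    _ = _ := congrArg (_ - ·) (ModExt.postcomp_comp l _ _ x)

namespace IsSteinSystem

variable (h : IsSteinSystem φ ι)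

section
include h

theorem toRestrictionPi_injective : Function.Injective (toRestrictionPi ι) :=
  (injective_iff_map_eq_zero _).2 fun _ ha =>
    (h.existsUnique (fun _ => 0) fun _ => _root_.map_zero _).unique (fun n => congrFun ha n)
      fun _ => _root_.map_zero _

theorem oneSubShift_surjective : Function.Surjective (oneSubShift h.comp) := by
  intro d
  obtain ⟨x, hx⟩ := (h.theoremsAB R (fun n => (φ n).toSemilinearMap) fun n => by
    rw [eq_top_iff, ← Ideal.span_singleton_one]
    exact Submodule.span_mono (Set.singleton_subset_iff.2 ⟨1, (φ n).map_one⟩)).1 d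
  exact ⟨x, funext hx⟩

theorem exact_toRestrictionPi_oneSubShift :
    Function.Exact (toRestrictionPi ι) (oneSubShift h.comp) := by
  refine fun x => ⟨fun hx => ?_, ?_⟩
  · obtain ⟨a, ha, -⟩ := h.existsUnique x fun n => (sub_eq_zero.1 (congrFun hx n)).symm
    exact ⟨a, funext ha⟩
  · rintro ⟨a, rfl⟩
    exact funext fun n => sub_eq_zero.2 (h.comp n a).symm

end

variable (h' : IsSteinSystem (fun n => RingHom.op (φ n)) (fun n => RingHom.op (ι n)))
  (hN : IsCoadmissibleOver h.comp N)
include h' hN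

theorem finite_extAlong (n : ℕ) : Module.Finite (R n)ᵐᵒᵖ (ExtAlong (ι n) N l) := by
  have := h.noetherian n
  have := h'.noetherian n
  have := hN.finite n
  exact Module.Finite.equiv (ExtAlong.ofBaseChangeEquiv (ι n) N (h.flat_ι n) l)

theorem lift_extAlong_trans_bijective (n : ℕ) :
    Function.Bijective (lift (ExtAlong.trans (h.comp n) N l)) :=
  have := h.noetherian (n + 1)
  have := hN.finite (n + 1)
  ExtAlong.lift_trans_bijective (h.comp n) N (h.flat_ι (n + 1)) (h'.flat n) l

theorem postcomp_oneSubShift_surjective :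
    Function.Surjective (ModExt.postcomp N l (oneSubShift h.comp)) := by
  have := h.finite_extAlong l h' hN
  have span_range_trans : ∀ n,
      Submodule.span (R n)ᵐᵒᵖ (Set.range (ExtAlong.trans (h.comp n) N l)) = ⊤ := fun n => by
    rw [← range_lift, LinearMap.range_eq_top]
    exact (h.lift_extAlong_trans_bijective l h' hN n).2
  intro y
  obtain ⟨z, hz⟩ := (h'.theoremsAB (fun n => ExtAlong (ι n) N l)
    (fun n => ExtAlong.trans (h.comp n) N l) span_range_trans).1 (extPiEquiv ι N l y)
  refine ⟨(extPiEquiv ι N l).symm z, (extPiEquiv ι N l).injective (funext fun n => ?_)⟩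
  rw [extPiEquiv_postcomp_oneSubShift, AddEquiv.apply_symm_apply, hz]

theorem postcomp_toRestrictionPi_injective :
    Function.Injective (ModExt.postcomp N l (toRestrictionPi ι)) := by
  cases l with
  | zero => exact ModExt.postcomp_injective_of_injective h.toRestrictionPi_injective
  | succ l =>
    refine (injective_iff_map_eq_zero _).2 fun x hx => ?_
    obtain ⟨y, rfl⟩ := (ModExt.exact_covδ_postcomp h.toRestrictionPi_injective
      h.oneSubShift_surjective h.exact_toRestrictionPi_oneSubShift l x).1 hx
    exact (ModExt.exact_postcomp_covδ h.toRestrictionPi_injective h.oneSubShift_surjective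
      h.exact_toRestrictionPi_oneSubShift l y).2 (h.postcomp_oneSubShift_surjective l h' hN y)

theorem isLimitModule_extDual : IsLimitModule (ι := fun n => RingHom.op (ι n))
    (M := fun n => ExtAlong (ι n) N l) (fun n => ExtAlong.trans (h.comp n) N l)
    (fun n => ExtAlong.ofDual (ι n) N l) := by
  refine ⟨fun n g => ?_, fun x hx => ?_⟩
  · have ofTower_comp_ofRing : Restriction.ofTower (h.comp n) ∘ₗ Restriction.ofRing (ι (n + 1)) =
        Restriction.ofRing (ι n) := LinearMap.ext fun a => h.comp n a
    exact (ModExt.postcomp_comp l _ _ g).symm.trans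
      (congrArg (fun f => ModExt.postcomp N l f g) ofTower_comp_ofRing)
  · have postcomp_eq_zero :
        ModExt.postcomp N l (oneSubShift h.comp) ((extPiEquiv ι N l).symm x) = 0 := by
      refine (extPiEquiv ι N l).injective (funext fun n => ?_)
      rw [extPiEquiv_postcomp_oneSubShift, AddEquiv.apply_symm_apply, hx, sub_self,
        _root_.map_zero, Pi.zero_apply]
    obtain ⟨g, hg⟩ := (ModExt.exact_postcomp_postcomp h.toRestrictionPi_injective
      h.oneSubShift_surjective h.exact_toRestrictionPi_oneSubShift l _).1 postcomp_eq_zero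
    have extPiEquiv_eq : extPiEquiv ι N l (ModExt.postcomp N l (toRestrictionPi ι) g) = x := by
      rw [hg, AddEquiv.apply_symm_apply]
    refine ⟨g, fun n => (extPiEquiv_postcomp_toRestrictionPi l g n).symm.trans
      (congrFun extPiEquiv_eq n), fun g' hg' => ?_⟩
    refine h.postcomp_toRestrictionPi_injective l h' hN ((extPiEquiv ι N l).injective ?_)
    exact extPiEquiv_eq ▸ funext fun n =>
      (extPiEquiv_postcomp_toRestrictionPi l g' n).trans (hg' n)

theorem isCoadmissibleOver_extDual : IsCoadmissibleOver (φ := fun n => RingHom.op (φ n))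
    (ι := fun n => RingHom.op (ι n)) h'.comp (ExtDual A N l) :=
  have := h.finite_extAlong l h' hN
  h'.isCoadmissibleOver_of_isLimit (M := fun n => ExtAlong (ι n) N l)
    (h.lift_extAlong_trans_bijective l h' hN) (h.isLimitModule_extDual l h' hN)

/-- `Ext^l_A(N, A) ⊗_A R n = Ext^l_{R n}(R n ⊗_A N, R n)` for coadmissible `N`. -/
def baseChangeExtDualEquiv (n : ℕ) : BaseChange (RingHom.op (ι n)) (ExtDual A N l) ≃ₗ[(R n)ᵐᵒᵖ]
    ExtDual (R n) (BaseChange (ι n) N) l :=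
  have := h.finite_extAlong l h' hN
  (LinearEquiv.ofBijective _ (h'.lift_bijective (M := fun n => ExtAlong (ι n) N l)
    (h.lift_extAlong_trans_bijective l h' hN) (h.isLimitModule_extDual l h' hN) n)).trans
      (ExtAlong.ofBaseChangeEquiv (ι n) N (h.flat_ι n) l).symm

theorem subsingleton_extDual_iff : Subsingleton (ExtDual A N l) ↔
    ∀ n, Subsingleton (ExtDual (R n) (BaseChange (ι n) N) l) := by
  rw [(h.isCoadmissibleOver_extDual l h' hN).subsingleton_iff]
  exact forall_congr' fun n =>
    (h.baseChangeExtDualEquiv l h' hN n).toEquiv.subsingleton_congr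

theorem gradeGE_iff : GradeGE A N l ↔ ∀ n, GradeGE (R n) (BaseChange (ι n) N) l := by
  simp only [GradeGE, fun i => h.subsingleton_extDual_iff i h' hN]
  exact ⟨fun H n i hi => H i hi n, fun H i hi n => H n i hi⟩

theorem subsingleton_extExt_iff (h'' : IsSteinSystem (fun n => RingHom.op (RingHom.op (φ n)))
    (fun n => RingHom.op (RingHom.op (ι n)))) : Subsingleton (ExtExt A N l) ↔
    ∀ n, Subsingleton (ExtExt (R n) (BaseChange (ι n) N) l) :=
  (h'.subsingleton_extDual_iff l h'' (h.isCoadmissibleOver_extDual l h' hN)).trans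
    (forall_congr' fun n =>
      (ExtDual.congr l (h.baseChangeExtDualEquiv l h' hN n)).toEquiv.subsingleton_congr.symm)

end IsSteinSystem

end ExtCoadmissible

/-! ### The dimension filtration of a coadmissible module -/

namespace IsAuslanderRegular

variable {R : Type u} [Ring R]
  {N N' : Type u} [AddCommGroup N] [Module R N] [AddCommGroup N'] [Module R N'] [Module.Finite R N']

theorem dimFiltration_zero : dimFiltration R N 0 = ⊤ :=
  top_le_iff.1 (le_dimFiltration fun _ hi => absurd hi (Nat.not_lt_zero _))

variable (hR : IsAuslanderRegular R)
include hR

theorem comap_dimFiltration {f : N →ₗ[R] N'} (hf : Function.Injective f) (l : ℕ) :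
    (dimFiltration R N' l).comap f = dimFiltration R N l := by
  have := hR.noetherian_left
  have : Module.Finite R N := Module.Finite.of_injective f hf
  apply le_antisymm
  · refine le_dimFiltration (hR.gradeGE_of_injective (hR.gradeGE_dimFiltration (N := N') l)
      (f.restrict (p := (dimFiltration R N' l).comap f) fun x hx => hx) fun x y hxy => ?_)
    exact Subtype.ext (hf (congrArg (fun z : dimFiltration R N' l => (z : N')) hxy))
  · rw [← Submodule.map_le_iff_le_comap]
    exact le_dimFiltration ((hR.gradeGE_dimFiltration (N := N) l).congr
      (Submodule.equivMapOfInjective f hf _))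

theorem map_dimFiltration (e : N ≃ₗ[R] N') (l : ℕ) :
    (dimFiltration R N l).map e.toLinearMap = dimFiltration R N' l := by
  rw [← hR.comap_dimFiltration e.injective l]
  exact Submodule.map_comap_eq_of_surjective e.surjective _

theorem dimFiltration_eq_bot {d : ℕ} (hd : GlobalDimensionLE R d) {l : ℕ}
    (hN : ∀ i, l ≤ i → Subsingleton (ExtExt R N' i)) : dimFiltration R N' l = ⊥ :=
  Submodule.subsingleton_iff_eq_bot.1 (hR.subsingleton_of_extExt hd hN
    (dimFiltration R N' l).subtype (Submodule.injective_subtype _) (hR.gradeGE_dimFiltration l))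

end IsAuslanderRegular

theorem moduleGrade_eq_iSup (R N : Type u) [Ring R] [AddCommGroup N] [Module R N] :
    moduleGrade R N = ⨆ (l : ℕ) (_ : GradeGE R N l), (l : ℕ∞) := by
  simp only [← le_moduleGrade_iff]
  refine le_antisymm (ENat.forall_natCast_le_iff_le.1 fun l hl => ?_) (iSup₂_le fun _ hl => hl)
  exact le_iSup₂ (f := fun (l : ℕ) (_ : (l : ℕ∞) ≤ moduleGrade R N) => (l : ℕ∞)) l hl

section DimensionFiltration

variable {A : Type u} [Ring A] {R : ℕ → Type u} [∀ n, Ring (R n)]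
  {φ : ∀ n, R (n + 1) →+* R n} {ι : ∀ n, A →+* R n}
  {G N : Type u} [AddCommGroup G] [Module A G] [AddCommGroup N] [Module A N]

open BaseChange

variable (ι) in
/-- The dimension filtration of a coadmissible module `G`: the submodule cut out by the dimension
filtrations of the modules `R n ⊗_A G`. -/
def limitDimFiltration (G : Type u) [AddCommGroup G] [Module A G] (l : ℕ) : Submodule A G :=
  subLimit ι G fun n => dimFiltration (R n) (BaseChange (ι n) G) l

theorem mem_limitDimFiltration {l : ℕ} {x : G} : x ∈ limitDimFiltration ι G l ↔
    ∀ n, BaseChange.mk (ι n) G x ∈ dimFiltration (R n) (BaseChange (ι n) G) l :=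
  mem_subLimit

theorem limitDimFiltration_zero : limitDimFiltration ι G 0 = ⊤ :=
  top_le_iff.1 fun _ _ => mem_limitDimFiltration.2 fun _ => by
    rw [IsAuslanderRegular.dimFiltration_zero]
    trivial

namespace IsSteinSystem

variable (h : IsSteinSystem φ ι) (hG : IsCoadmissibleOver h.comp G) {d : ℕ} {l : ℕ}

include hG in
theorem limitDimFiltration_eq_bot
    (hl : ∀ n, dimFiltration (R n) (BaseChange (ι n) G) l = ⊥) :
    limitDimFiltration ι G l = ⊥ :=
  (Submodule.eq_bot_iff _).2 fun _ hx => hG.isLimit.eq_zero fun n =>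
    (Submodule.mem_bot (R n)).1 (hl n ▸ mem_limitDimFiltration.1 hx n)

variable (hR : ∀ n, IsAuslanderRegular (R n))
include hR

include hG in
theorem limitDimFiltration_succ_le (l : ℕ) :
    limitDimFiltration ι G (l + 1) ≤ limitDimFiltration ι G l := fun _ hx =>
  mem_limitDimFiltration.2 fun n =>
    have := hG.finite
    (hR n).dimFiltration_succ_le l (mem_limitDimFiltration.1 hx n)

include hG in
theorem limitDimFiltration_eq_bot_of_lt (hd : ∀ n, GlobalDimensionLE (R n) d) (hl : d < l) :
    limitDimFiltration ι G l = ⊥ :=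
  h.limitDimFiltration_eq_bot hG fun n =>
    have := hG.finite
    (hR n).dimFiltration_eq_bot (hd n) fun _ hi =>
      (hd n).subsingleton_extDual_op (hl.trans_le hi) _

include h hG in
theorem comap_limitDimFiltration {f : N →ₗ[A] G} (hf : Function.Injective f) (l : ℕ) :
    (limitDimFiltration ι G l).comap f = limitDimFiltration ι N l := by
  have := hG.finite
  ext x
  simp only [Submodule.mem_comap, mem_limitDimFiltration,
    ← fun n => (hR n).comap_dimFiltration (h.flat_ι n _ _ f hf) l, map_mk]

variable (h' : IsSteinSystem (fun n => RingHom.op (φ n)) (fun n => RingHom.op (ι n)))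

include h' hG in
theorem gradeGE_iff_range_le (hN : IsCoadmissibleOver h.comp N) {f : N →ₗ[A] G}
    (hf : Function.Injective f) (l : ℕ) :
    GradeGE A N l ↔ LinearMap.range f ≤ limitDimFiltration ι G l := by
  have := hG.finite
  have gradeGE_baseChange_iff : ∀ n, GradeGE (R n) (BaseChange (ι n) N) l ↔
      ∀ x, BaseChange.mk (ι n) G (f x) ∈ dimFiltration (R n) (BaseChange (ι n) G) l := fun n => by
    have e := LinearEquiv.ofInjective _ (h.flat_ι n _ _ f hf)
    trans GradeGE (R n) (LinearMap.range (map (ι n) f)) l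
    · exact ⟨fun H => H.congr e, fun H => H.congr e.symm⟩
    · rw [(hR n).gradeGE_iff_le_dimFiltration, BaseChange.range_map, Submodule.span_le,
        LinearMap.coe_range, Set.image_subset_iff, Set.range_subset_iff]
      rfl
  simp only [h.gradeGE_iff l h' hN, gradeGE_baseChange_iff, LinearMap.range_le_iff_comap,
    Submodule.eq_top_iff', Submodule.mem_comap, mem_limitDimFiltration]
  exact forall_comm

include h' hG in
theorem gradeGE_iff_limitDimFiltration_eq_top (l : ℕ) :
    GradeGE A G l ↔ limitDimFiltration ι G l = ⊤ := by
  rw [h.gradeGE_iff_range_le hG hR h' hG (f := LinearMap.id) Function.injective_id,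
    LinearMap.range_id, top_le_iff]

variable (hd : ∀ n, GlobalDimensionLE (R n) d)
include h' hd hG

variable (l) in
theorem span_trans_dimFiltration (n : ℕ) :
    Submodule.span (R n) (trans (h.comp n) G ''
      dimFiltration (R (n + 1)) (BaseChange (ι (n + 1)) G) l) =
    dimFiltration (R n) (BaseChange (ι n) G) l := by
  have := hG.finite
  let e : BaseChange (φ n) (BaseChange (ι (n + 1)) G) ≃ₗ[R n] BaseChange (ι n) G :=
    LinearEquiv.ofBijective _ (lift_trans_bijective (h.comp n) G)
  have e_mk : ∀ y, e (BaseChange.mk (φ n) _ y) = trans (h.comp n) G y := lift_mk _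
  rw [← (hR n).map_dimFiltration e, ← range_baseChange_dimFiltration (φ n) (h.flat n) (h'.flat n)
    (hR (n + 1)) (hR n) (hd n), BaseChange.range_map, Submodule.range_subtype,
    Submodule.map_span, Set.image_image]
  exact congrArg _ (Set.image_congr fun y _ => (e_mk y).symm)

variable (l) in
theorem isCoadmissibleOver_limitDimFiltration :
    IsCoadmissibleOver h.comp (limitDimFiltration ι G l) :=
  h.isCoadmissibleOver_subLimit hG _ (h.span_trans_dimFiltration hG l hR h' hd)

variable (l) in
theorem range_map_limitDimFiltration (n : ℕ) :
    LinearMap.range (map (ι n) (limitDimFiltration ι G l).subtype) =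
      dimFiltration (R n) (BaseChange (ι n) G) l := by
  unfold limitDimFiltration
  exact h.range_map_subLimit hG (fun n => dimFiltration (R n) (BaseChange (ι n) G) l)
    (h.span_trans_dimFiltration hG l hR h' hd) n

variable (l) in
theorem isCoadmissibleOver_quotient_limitDimFiltration :
    IsCoadmissibleOver h.comp (G ⧸ limitDimFiltration ι G l) :=
  h.isCoadmissibleOver_quotient hG _ (h.span_trans_dimFiltration hG l hR h' hd)

variable (l) in
theorem ker_map_mkQ_limitDimFiltration (n : ℕ) :
    LinearMap.ker (map (ι n) (limitDimFiltration ι G l).mkQ) =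
      dimFiltration (R n) (BaseChange (ι n) G) l := by
  unfold limitDimFiltration
  exact h.ker_map_mkQ_subLimit hG (fun n => dimFiltration (R n) (BaseChange (ι n) G) l)
    (h.span_trans_dimFiltration hG l hR h' hd) n

variable (l) in
/-- `R n ⊗_A G/Δ^l(G) = (R n ⊗_A G)/Δ^l(R n ⊗_A G)`. -/
def baseChangeQuotientEquiv (n : ℕ) :
    BaseChange (ι n) (G ⧸ limitDimFiltration ι G l) ≃ₗ[R n]
      BaseChange (ι n) G ⧸ dimFiltration (R n) (BaseChange (ι n) G) l :=
  (LinearMap.quotKerEquivOfSurjective _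
    (map_surjective (ι n) (limitDimFiltration ι G l).mkQ_surjective)).symm.trans
    (Submodule.quotEquivOfEq _ _ (h.ker_map_mkQ_limitDimFiltration hG l hR h' hd n))

theorem moduleGrade_quotient_limitDimFiltration (hl : GradeGE A G l)
    (nontrivial : Nontrivial (G ⧸ limitDimFiltration ι G (l + 1))) :
    moduleGrade A (G ⧸ limitDimFiltration ι G (l + 1)) = l := by
  have := hG.finite
  have hQ := h.isCoadmissibleOver_quotient_limitDimFiltration hG (l + 1) hR h' hd
  have gradeGE : GradeGE A (G ⧸ limitDimFiltration ι G (l + 1)) l :=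
    (h.gradeGE_iff l h' hQ).2 fun n => (hR n).gradeGE_of_surjective
      ((h.gradeGE_iff l h' hG).1 hl n) _ (map_surjective (ι n) (Submodule.mkQ_surjective _))
  refine le_antisymm (not_lt.1 fun grade_gt => ?_) (le_moduleGrade_iff.2 gradeGE)
  have gradeGE_succ : GradeGE A (G ⧸ limitDimFiltration ι G (l + 1)) (l + 1) :=
    le_moduleGrade_iff.1 (by exact_mod_cast Order.add_one_le_of_lt grade_gt)
  refine not_subsingleton (G ⧸ limitDimFiltration ι G (l + 1)) (hQ.subsingleton_iff.2 fun n => ?_)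
  let e := h.baseChangeQuotientEquiv hG (l + 1) hR h' hd n
  exact (hR n).subsingleton_of_injective_quotient_dimFiltration e.toLinearMap e.injective
    ((h.gradeGE_iff (l + 1) h' hQ).1 gradeGE_succ n)

variable (h'' : IsSteinSystem (fun n => RingHom.op (RingHom.op (φ n)))
  (fun n => RingHom.op (RingHom.op (ι n))))
include h''

theorem limitDimFiltration_succ_eq_bot_of_isPureModule (hp : IsPureModule A G)
    (hl : moduleGrade A G = l) : limitDimFiltration ι G (l + 1) = ⊥ := by
  have := hG.finite
  refine h.limitDimFiltration_eq_bot hG fun n => (hR n).dimFiltration_eq_bot (hd n) fun i hi => ?_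
  refine (h.subsingleton_extExt_iff i h' hG h'').1 (hp i ?_) n
  rw [hl]
  exact_mod_cast (Nat.lt_of_succ_le hi).ne'

theorem isPureModule_quotient_limitDimFiltration (hl : GradeGE A G l)
    (nontrivial : Nontrivial (G ⧸ limitDimFiltration ι G (l + 1))) :
    IsPureModule A (G ⧸ limitDimFiltration ι G (l + 1)) := by
  have := hG.finite
  have hQ := h.isCoadmissibleOver_quotient_limitDimFiltration hG (l + 1) hR h' hd
  have grade_eq := h.moduleGrade_quotient_limitDimFiltration hG hR h' hd hl nontrivial
  intro i hi
  have i_ne : i ≠ l := fun hil => hi (by rw [grade_eq, hil])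
  rcases lt_or_gt_of_ne i_ne with hil | hil
  · have := le_moduleGrade_iff.1 grade_eq.ge i hil
    exact ExtDual.subsingleton_of_subsingleton i
  · refine (h.subsingleton_extExt_iff i h' hQ h'').2 fun n => ?_
    have e := h.baseChangeQuotientEquiv hG (l + 1) hR h' hd n
    exact (ExtDual.congr i (ExtDual.congr i e)).toEquiv.subsingleton_congr.2
      ((hR n).subsingleton_extExt_quotient_dimFiltration hil)

end IsSteinSystem

end DimensionFiltration

/-! ### The Banach algebras of a Fréchet–Stein algebra -/

section Banach

variable {K : Type w} [NontriviallyNormedField K] {A : Type u} [Ring A] [Algebra K A]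

namespace AlgSeminorm

variable (q : AlgSeminorm K A)

/-- A constant for the submultiplicativity of an algebra seminorm. -/
def mulConst : ℝ := q.exists_mul_le.choose

theorem mulConst_pos : 0 < q.mulConst := q.exists_mul_le.choose_spec.1

theorem norm_mul_le_compl (x y : q.Compl) : ‖x * y‖ ≤ q.mulConst * (‖x‖ * ‖y‖) := by
  induction x, y using UniformSpace.Completion.induction_on₂ with
  | hp =>
    exact isClosed_le (continuous_norm.comp (continuous_fst.mul continuous_snd))
      (continuous_const.mul ((continuous_norm.comp continuous_fst).mul
        (continuous_norm.comp continuous_snd)))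
  | ih a b =>
    rw [← UniformSpace.Completion.coe_mul, UniformSpace.Completion.norm_coe,
      UniformSpace.Completion.norm_coe, UniformSpace.Completion.norm_coe]
    exact q.exists_mul_le.choose_spec.2 a b

/-- The completion for an algebra seminorm, with a rescaled submultiplicative norm. -/
def Banach (q : AlgSeminorm K A) : Type u := q.Compl

instance : Ring q.Banach := inferInstanceAs (Ring q.Compl)

/-- The identity from the completion to its rescaled version. -/
def toBanach (x : q.Compl) : q.Banach := x

/-- The identity from the rescaled version of the completion. -/
def ofBanach (x : q.Banach) : q.Compl := x

/-- The rescaled norm. -/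
def ringNorm : RingNorm q.Banach where
  toFun x := q.mulConst * ‖q.ofBanach x‖
  map_zero' := by
    have norm_ofBanach_zero : ‖q.ofBanach 0‖ = 0 := norm_zero (E := q.Compl)
    rw [norm_ofBanach_zero, mul_zero]
  add_le' x y := by
    rw [← mul_add]
    exact mul_le_mul_of_nonneg_left (norm_add_le (q.ofBanach x) (q.ofBanach y)) q.mulConst_pos.le
  neg' x := congrArg (q.mulConst * ·) (norm_neg (q.ofBanach x))
  mul_le' x y := by
    rw [mul_mul_mul_comm, mul_assoc]
    exact mul_le_mul_of_nonneg_left (q.norm_mul_le_compl (q.ofBanach x) (q.ofBanach y))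
      q.mulConst_pos.le
  eq_zero_of_map_eq_zero' x hx :=
    (norm_eq_zero (a := q.ofBanach x)).1 ((mul_eq_zero.1 hx).resolve_left q.mulConst_pos.ne')

instance : NormedRing q.Banach := q.ringNorm.toNormedRing

theorem dist_toBanach (x y : q.Compl) :
    dist (q.toBanach x) (q.toBanach y) = q.mulConst * dist x y := by
  rw [dist_eq_norm, dist_eq_norm]
  rfl

theorem lipschitz_toBanach : LipschitzWith (NNReal.mk q.mulConst q.mulConst_pos.le) q.toBanach :=
  LipschitzWith.of_dist_le_mul fun x y => (q.dist_toBanach x y).le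

theorem antilipschitz_toBanach :
    AntilipschitzWith (NNReal.mk q.mulConst⁻¹ (inv_pos.2 q.mulConst_pos).le) q.toBanach :=
  AntilipschitzWith.of_le_mul_dist fun x y => by
    rw [q.dist_toBanach, NNReal.coe_mk, inv_mul_cancel_left₀ q.mulConst_pos.ne']

theorem continuous_toBanach : Continuous q.toBanach := q.lipschitz_toBanach.continuous

theorem continuous_ofBanach : Continuous q.ofBanach :=
  (q.antilipschitz_toBanach.to_rightInverse (g := q.ofBanach) fun _ => rfl).continuous

instance : CompleteSpace q.Banach :=
  ((q.antilipschitz_toBanach.isUniformInducing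
    q.lipschitz_toBanach.uniformContinuous).completeSpace_congr fun x => ⟨x, rfl⟩).1 inferInstance

end AlgSeminorm

namespace AlgSeminormSeq

variable (Q : AlgSeminormSeq K A)

theorem continuous_φ (n : ℕ) : Continuous (Q.φ n) := UniformSpace.Completion.continuous_map

theorem denseRange_ι (n : ℕ) : DenseRange (Q.ι n) :=
  UniformSpace.Completion.denseRange_coe (α := (Q.q n).Source)

theorem denseRange_φ (n : ℕ) : DenseRange (Q.φ n) :=
  (Q.denseRange_ι n).mono (by
    rintro _ ⟨a, rfl⟩
    exact ⟨Q.ι (n + 1) a, φ_ι n a⟩)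

/-- The transition maps of the rescaled Banach algebras. -/
def φBanach (n : ℕ) : (Q.q (n + 1)).Banach →+* (Q.q n).Banach := Q.φ n

theorem continuous_φBanach (n : ℕ) : Continuous (Q.φBanach n) :=
  ((Q.q n).continuous_toBanach.comp (Q.continuous_φ n)).comp (Q.q (n + 1)).continuous_ofBanach

theorem denseRange_φBanach (n : ℕ) : DenseRange (Q.φBanach n) :=
  (Function.Surjective.denseRange (f := (Q.q n).toBanach) fun x => ⟨x, rfl⟩).comp
    (Q.denseRange_φ n) (Q.q n).continuous_toBanach

theorem theoremsAB : TheoremsAB Q.φ :=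
  theoremsAB_of_denseRange (R := fun n => (Q.q n).Banach) (φ := Q.φBanach) Q.continuous_φBanach
    Q.denseRange_φBanach

end AlgSeminormSeq

section Op

variable {R S : Type*} [Ring R] [Ring S] [TopologicalSpace R] [TopologicalSpace S] {f : R →+* S}

theorem continuous_ringHom_op (hf : Continuous f) : Continuous (RingHom.op f) :=
  MulOpposite.continuous_op.comp (hf.comp MulOpposite.continuous_unop)

omit [TopologicalSpace R] in
theorem denseRange_ringHom_op (hf : DenseRange f) : DenseRange (RingHom.op f) :=
  ((MulOpposite.op_surjective.denseRange (f := (MulOpposite.op : S → Sᵐᵒᵖ))).comp hf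
    MulOpposite.continuous_op).mono (by
      rintro _ ⟨a, rfl⟩
      exact ⟨MulOpposite.op a, rfl⟩)

end Op

theorem IsSteinSystem.op {R : ℕ → Type u} [∀ n, Ring (R n)] {φ : ∀ n, R (n + 1) →+* R n}
    {ι : ∀ n, A →+* R n} (h : IsSteinSystem φ ι) (noetherian : ∀ n, IsNoetherianRing (R n)ᵐᵒᵖ)
    (flat : ∀ n, FlatAsRightModule (RingHom.op (φ n)))
    (theoremsAB : TheoremsAB (R := fun n => (R n)ᵐᵒᵖ) fun n => RingHom.op (φ n)) :
    IsSteinSystem (fun n => RingHom.op (φ n)) (fun n => RingHom.op (ι n)) where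
  comp n a := congrArg MulOpposite.op (h.comp n a.unop)
  noetherian := noetherian
  flat := flat
  existsUnique x hx := by
    obtain ⟨a, ha, a_unique⟩ :=
      h.existsUnique (fun n => (x n).unop) fun n => congrArg MulOpposite.unop (hx n)
    exact ⟨MulOpposite.op a, fun n => congrArg MulOpposite.op (ha n), fun b hb =>
      congrArg MulOpposite.op (a_unique b.unop fun n => congrArg MulOpposite.unop (hb n))⟩
  theoremsAB := theoremsAB

namespace AlgSeminormSeq

variable (Q : AlgSeminormSeq K A)

theorem theoremsAB_op : TheoremsAB (R := fun n => (Q.alg n)ᵐᵒᵖ) fun n => RingHom.op (Q.φ n) :=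
  theoremsAB_of_denseRange (R := fun n => (Q.q n).Banachᵐᵒᵖ)
    (φ := fun n => RingHom.op (Q.φBanach n))
    (fun n => continuous_ringHom_op (Q.continuous_φBanach n))
    fun n => denseRange_ringHom_op (Q.denseRange_φBanach n)

theorem theoremsAB_op_op : TheoremsAB (R := fun n => (Q.alg n)ᵐᵒᵖᵐᵒᵖ) fun n =>
    RingHom.op (RingHom.op (Q.φ n)) :=
  theoremsAB_of_denseRange (R := fun n => (Q.q n).Banachᵐᵒᵖᵐᵒᵖ)
    (φ := fun n => RingHom.op (RingHom.op (Q.φBanach n)))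
    (fun n => continuous_ringHom_op (continuous_ringHom_op (Q.continuous_φBanach n)))
    fun n => denseRange_ringHom_op (denseRange_ringHom_op (Q.denseRange_φBanach n))

theorem norm_ι (n : ℕ) (a : A) : ‖Q.ι n a‖ = (Q.q n).toSeminorm a :=
  UniformSpace.Completion.norm_coe (E := (Q.q n).Source) a

theorem norm_φ_le (n : ℕ) (x : Q.alg (n + 1)) : ‖Q.φ n x‖ ≤ ‖x‖ := by
  induction x using UniformSpace.Completion.induction_on with
  | hp => exact isClosed_le (continuous_norm.comp (Q.continuous_φ n)) continuous_norm
  | ih a =>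
    have norm_φ_ι_le (b : A) : ‖Q.φ n (Q.ι (n + 1) b)‖ ≤ ‖Q.ι (n + 1) b‖ := by
      rw [φ_ι, norm_ι, norm_ι]
      exact Q.le_succ n b
    exact norm_φ_ι_le a

theorem norm_ι_sub_le {x : ∀ n, Q.alg n} (hx : ∀ n, Q.φ n (x (n + 1)) = x n) (a : A) {m n : ℕ}
    (hmn : m ≤ n) : ‖Q.ι m a - x m‖ ≤ ‖Q.ι n a - x n‖ := by
  induction n, hmn using Nat.le_induction with
  | base => exact le_rfl
  | succ n _ ih =>
    refine ih.trans ?_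
    rw [← hx n, ← φ_ι, ← map_sub]
    exact Q.norm_φ_le n _

theorem exists_tendsto_ι {x : ∀ n, Q.alg n} (hx : ∀ n, Q.φ n (x (n + 1)) = x n) :
    ∃ a : ℕ → A, ∀ m, Filter.Tendsto (fun n => Q.ι m (a n)) Filter.atTop (nhds (x m)) := by
  choose a ha using fun n : ℕ =>
    (Q.denseRange_ι n).exists_dist_lt (x n) (ε := (1 / 2) ^ n) (by positivity)
  refine ⟨a, fun m => ?_⟩
  rw [tendsto_iff_norm_sub_tendsto_zero]
  refine squeeze_zero' (Filter.Eventually.of_forall fun _ => norm_nonneg _) ?_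
    (tendsto_pow_atTop_nhds_zero_of_lt_one (r := (1 / 2 : ℝ)) (by norm_num) (by norm_num))
  filter_upwards [Filter.eventually_ge_atTop m] with n hmn
  refine (Q.norm_ι_sub_le hx (a n) hmn).trans ?_
  rw [← dist_eq_norm, dist_comm]
  exact (ha n).le

namespace IsTwoSidedFrechetStein

variable {Q} [UniformSpace A] [IsUniformAddGroup A] (hQ : Q.IsTwoSidedFrechetStein)
include hQ

omit [IsUniformAddGroup A] in
theorem ι_injective {a b : A} (hab : ∀ n, Q.ι n a = Q.ι n b) : a = b := by
  have := hQ.t2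
  by_contra a_ne_b
  obtain ⟨n, hn⟩ := hQ.withSeminorms.separating_of_T1 (a - b) (sub_ne_zero.2 a_ne_b)
  refine hn ?_
  rw [← Q.norm_ι n, map_sub, hab n, sub_self, norm_zero]

theorem continuous_ι (n : ℕ) : Continuous (Q.ι n) := by
  refine continuous_of_continuousAt_zero (Q.ι n) ?_
  rw [ContinuousAt, map_zero, tendsto_zero_iff_norm_tendsto_zero]
  simpa only [Q.norm_ι, map_zero] using (hQ.withSeminorms.continuous_seminorm n).tendsto 0

theorem cauchySeq_of_forall_ι {a : ℕ → A} (ha : ∀ m, CauchySeq fun n => Q.ι m (a n)) :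
    CauchySeq a := by
  have cauchySeq_source : ∀ m, CauchySeq (α := (Q.q m).Source) a := fun m =>
    ((UniformSpace.Completion.isUniformInducing_coe (Q.q m).Source).cauchy_map_iff
      (F := @Filter.map ℕ (Q.q m).Source a Filter.atTop)).1 (ha m)
  refine ⟨inferInstance, ?_⟩
  rw [congrArg (fun u => @uniformity A u)
    ((SeminormFamily.withSeminorms_iff_uniformSpace_eq_iInf _).1 hQ.withSeminorms),
    iInf_uniformity]
  exact le_iInf fun m => (cauchySeq_source m).2

theorem existsUnique_ι_eq (x : ∀ n, Q.alg n) (hx : ∀ n, Q.φ n (x (n + 1)) = x n) :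
    ∃! a, ∀ n, Q.ι n a = x n := by
  have := hQ.complete
  obtain ⟨a, ha⟩ := Q.exists_tendsto_ι hx
  obtain ⟨b, hb⟩ :=
    cauchySeq_tendsto_of_complete (hQ.cauchySeq_of_forall_ι fun m => (ha m).cauchySeq)
  have ι_b : ∀ n, Q.ι n b = x n := fun n =>
    tendsto_nhds_unique (((hQ.continuous_ι n).tendsto b).comp hb) (ha n)
  exact ⟨b, ι_b, fun c hc => hQ.ι_injective fun n => (hc n).trans (ι_b n).symm⟩

theorem isSteinSystem : IsSteinSystem Q.φ Q.ι where
  comp := φ_ι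
  noetherian := hQ.noetherian_left
  flat := hQ.flat_right
  existsUnique := hQ.existsUnique_ι_eq
  theoremsAB := Q.theoremsAB

theorem isSteinSystem_op :
    IsSteinSystem (fun n => RingHom.op (Q.φ n)) (fun n => RingHom.op (Q.ι n)) :=
  hQ.isSteinSystem.op hQ.noetherian_right hQ.flat_left Q.theoremsAB_op

theorem isSteinSystem_op_op :
    IsSteinSystem (fun n => RingHom.op (RingHom.op (Q.φ n)))
      (fun n => RingHom.op (RingHom.op (Q.ι n))) :=
  hQ.isSteinSystem_op.op (fun n =>
      have := hQ.noetherian_left n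
      isNoetherianRing_of_ringEquiv _ (RingEquiv.opOp (Q.alg n)))
    (fun n => (hQ.flat_right n).op_op) Q.theoremsAB_op_op

end IsTwoSidedFrechetStein

end AlgSeminormSeq

end Banach

/-! ### Coherent sheaves and the main theorem -/

section Coadmissible

variable {K : Type w} [NontriviallyNormedField K] {A : Type u} [Ring A] [Algebra K A]

namespace AlgSeminormSeq

open BaseChange

variable {Q : AlgSeminormSeq K A}

/-- The transition maps of a coherent sheaf, as semilinear maps. -/
def CoherentSheaf.resHom (F : Q.CoherentSheaf) (n : ℕ) : F.obj (n + 1) →ₛₗ[Q.φ n] F.obj n where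
  toFun := F.res n
  map_add' x y := by simp only [res, tmul_add, map_add]
  map_smul' r x := by
    simp only [res]
    rw [tmul_smul, one_mul, ← map_smul, smul_tmul, mul_one]

theorem CoherentSheaf.lift_resHom_bijective (F : Q.CoherentSheaf) (n : ℕ) :
    Function.Bijective (lift (F.resHom n)) := by
  have lift_resHom : lift (F.resHom n) = (F.iso n).toLinearMap := hom_ext fun x => lift_mk _ x
  rw [lift_resHom]
  exact (F.iso n).bijective

variable (h : IsSteinSystem Q.φ Q.ι) {M : Type u} [AddCommGroup M] [Module A M]

include h in
theorem isCoadmissibleOver_of_isCoadmissible (hM : Q.IsCoadmissible M) :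
    IsCoadmissibleOver h.comp M := by
  obtain ⟨F, ⟨e⟩⟩ := hM
  let p : ∀ n, M →ₛₗ[Q.ι n] F.obj n := fun n =>
    { toFun := fun m => (e m).1 n
      map_add' := fun x y => by rw [map_add]; rfl
      map_smul' := fun a x => by rw [map_smul]; rfl }
  refine h.isCoadmissibleOver_of_isLimit (M := F.obj) F.lift_resHom_bijective (p := p)
    ⟨fun n m => (e m).2 n, fun x hx => ⟨e.symm ⟨x, hx⟩, fun n => ?_, fun m hm => ?_⟩⟩
  · exact congrFun (congrArg Subtype.val (e.apply_symm_apply ⟨x, hx⟩)) n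
  · rw [← LinearEquiv.symm_apply_apply e m]
    exact congrArg e.symm (Subtype.ext (funext hm))

include h in
theorem isCoadmissible_of_isCoadmissibleOver (hM : IsCoadmissibleOver h.comp M) :
    Q.IsCoadmissible M := by
  have := hM.finite
  let F : Q.CoherentSheaf :=
    { obj := fun n => BaseChange (Q.ι n) M
      iso := fun n => LinearEquiv.ofBijective _ (lift_trans_bijective (h.comp n) M) }
  have res_eq : ∀ n x, F.res n x = trans (h.comp n) M x := fun n x =>
    lift_mk (trans (h.comp n) M) x
  let f : M →ₗ[A] F.globalSections :=
    { toFun := fun m => ⟨fun n => BaseChange.mk (Q.ι n) M m,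
        fun n => (res_eq n _).trans (hM.isLimit.comp n m)⟩
      map_add' := fun x y => Subtype.ext (funext fun n => map_add _ _ _)
      map_smul' := fun a x =>
        Subtype.ext (funext fun n => (BaseChange.mk (Q.ι n) M).map_smulₛₗ a x) }
  refine ⟨F, ⟨LinearEquiv.ofBijective f ⟨(injective_iff_map_eq_zero f).2 fun m hm => ?_,
    fun x => ?_⟩⟩⟩
  · exact hM.isLimit.eq_zero fun n => congrFun (congrArg Subtype.val hm) n
  · obtain ⟨m, hm⟩ :=
      (hM.isLimit.existsUnique x.1 fun n => (res_eq n _).symm.trans (x.2 n)).exists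
    exact ⟨m, Subtype.ext (funext hm)⟩

theorem isCoadmissible_iff : Q.IsCoadmissible M ↔ IsCoadmissibleOver h.comp M :=
  ⟨isCoadmissibleOver_of_isCoadmissible h, isCoadmissible_of_isCoadmissibleOver h⟩

theorem dimFil_eq_limitDimFiltration : Q.dimFil M = limitDimFiltration Q.ι M :=
  funext fun _ => Submodule.ext fun _ => mem_limitDimFiltration.symm

end AlgSeminormSeq

end Coadmissible

theorem proposition8p7_general
    (K : Type w) [NontriviallyNormedField K]
    (A : Type u) [Ring A] [Algebra K A] [UniformSpace A] [IsUniformAddGroup A]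
    (Q : AlgSeminormSeq K A) (hQ : Q.IsTwoSidedFrechetStein)
    (d : ℕ) (hreg : ∀ n, IsAuslanderRegular (Q.alg n))
    (hdim : ∀ n, GlobalDimensionLE (Q.alg n) d)
    (M : Type u) [AddCommGroup M] [Module A M] (hM : Q.IsCoadmissible M) :
    (Q.dimFil M 0 = ⊤ ∧ (∀ l, Q.dimFil M (l + 1) ≤ Q.dimFil M l) ∧ Q.dimFil M (d + 1) = ⊥ ∧
      (∀ l, Q.IsCoadmissible (Q.dimFil M l)) ∧
      ∀ l n, Function.Injective (BaseChange.map (Q.ι n) (Q.dimFil M l).subtype) ∧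
        LinearMap.range (BaseChange.map (Q.ι n) (Q.dimFil M l).subtype) =
          dimFiltration (Q.alg n) (BaseChange (Q.ι n) M) l) ∧
    (∀ N : Submodule A M, Q.IsCoadmissible N →
      ∀ l : ℕ, (l : ℕ∞) ≤ moduleGrade A N ↔ N ≤ Q.dimFil M l) ∧
    (moduleGrade A M = ⨆ (l : ℕ) (_ : Q.dimFil M l = ⊤), (l : ℕ∞)) ∧
    (IsPureModule A M → ∀ j : ℕ, moduleGrade A M = j →
      Q.dimFil M j = ⊤ ∧ Q.dimFil M (j + 1) = ⊥) ∧
    (∀ l : ℕ,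
      Subsingleton (Q.dimFil M l ⧸ (Q.dimFil M (l + 1)).submoduleOf (Q.dimFil M l)) ∨
      (IsPureModule A (Q.dimFil M l ⧸ (Q.dimFil M (l + 1)).submoduleOf (Q.dimFil M l)) ∧
        moduleGrade A (Q.dimFil M l ⧸ (Q.dimFil M (l + 1)).submoduleOf (Q.dimFil M l)) = l)) := by
  have h := hQ.isSteinSystem
  have h' := hQ.isSteinSystem_op
  have h'' := hQ.isSteinSystem_op_op
  have hG := (AlgSeminormSeq.isCoadmissible_iff h).1 hM
  have hD := fun l => h.isCoadmissibleOver_limitDimFiltration hG l hreg h' hdim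
  have gradeGE_iff_le (N : Submodule A M) (hN : IsCoadmissibleOver h.comp N) (l : ℕ) :
      GradeGE A N l ↔ N ≤ limitDimFiltration Q.ι M l := by
    rw [h.gradeGE_iff_range_le hG hreg h' hN N.injective_subtype, Submodule.range_subtype]
  have gradeGE_iff_eq_top := h.gradeGE_iff_limitDimFiltration_eq_top hG hreg h'
  have dimFil_eq := AlgSeminormSeq.dimFil_eq_limitDimFiltration (Q := Q) (M := M)
  generalize Q.dimFil M = D at dimFil_eq ⊢
  subst dimFil_eq
  simp only [AlgSeminormSeq.isCoadmissible_iff h, le_moduleGrade_iff]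
  refine ⟨⟨limitDimFiltration_zero, h.limitDimFiltration_succ_le hG hreg,
    h.limitDimFiltration_eq_bot_of_lt hG hreg hdim d.lt_succ_self, hD, fun l n =>
      ⟨h.flat_ι n _ _ _ (Submodule.injective_subtype _),
        h.range_map_limitDimFiltration hG l hreg h' hdim n⟩⟩,
    gradeGE_iff_le, by simp only [moduleGrade_eq_iSup, gradeGE_iff_eq_top],
    fun hp j hj => ⟨(gradeGE_iff_eq_top j).1 (le_moduleGrade_iff.1 hj.ge),
      h.limitDimFiltration_succ_eq_bot_of_isPureModule hG hreg h' hdim h'' hp hj⟩, fun l => ?_⟩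
  rw [Submodule.submoduleOf, h.comap_limitDimFiltration hG hreg (Submodule.injective_subtype _)]
  have hl := (gradeGE_iff_le _ (hD l) l).2 le_rfl
  exact (subsingleton_or_nontrivial _).imp_right fun nontrivial =>
    ⟨h.isPureModule_quotient_limitDimFiltration (hD l) hreg h' hdim h'' hl nontrivial,
      h.moduleGrade_quotient_limitDimFiltration (hD l) hreg h' hdim hl nontrivial⟩

end

theorem proposition8p7
    (K : Type w) [NontriviallyNormedField K] [IsUltrametricDist K] [CompleteSpace K]
    (A : Type u) [Ring A] [Algebra K A] [UniformSpace A] [IsUniformAddGroup A]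
    (Q : AlgSeminormSeq K A) (hQ : Q.IsTwoSidedFrechetStein)
    (d : ℕ) (hreg : ∀ n, IsAuslanderRegular (Q.alg n))
    (hdim : ∀ n, GlobalDimensionLE (Q.alg n) d)
    (M : Type u) [AddCommGroup M] [Module A M] (hM : Q.IsCoadmissible M) :
    -- the `Δ^l(M)` form a finite decreasing filtration of `M` by coadmissible submodules
    -- which induces the dimension filtration on each `A_{q_n} ⊗_A M`
    (Q.dimFil M 0 = ⊤ ∧ (∀ l, Q.dimFil M (l + 1) ≤ Q.dimFil M l) ∧ Q.dimFil M (d + 1) = ⊥ ∧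
      (∀ l, Q.IsCoadmissible (Q.dimFil M l)) ∧
      ∀ l n, Function.Injective (BaseChange.map (Q.ι n) (Q.dimFil M l).subtype) ∧
        LinearMap.range (BaseChange.map (Q.ι n) (Q.dimFil M l).subtype) =
          dimFiltration (Q.alg n) (BaseChange (Q.ι n) M) l) ∧
    -- i
    (∀ N : Submodule A M, Q.IsCoadmissible N →
      ∀ l : ℕ, (l : ℕ∞) ≤ moduleGrade A N ↔ N ≤ Q.dimFil M l) ∧
    -- ii
    (moduleGrade A M = ⨆ (l : ℕ) (_ : Q.dimFil M l = ⊤), (l : ℕ∞)) ∧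
    -- iii
    (IsPureModule A M → ∀ j : ℕ, moduleGrade A M = j →
      Q.dimFil M j = ⊤ ∧ Q.dimFil M (j + 1) = ⊥) ∧
    -- iv
    (∀ l : ℕ,
      Subsingleton (Q.dimFil M l ⧸ (Q.dimFil M (l + 1)).submoduleOf (Q.dimFil M l)) ∨
      (IsPureModule A (Q.dimFil M l ⧸ (Q.dimFil M (l + 1)).submoduleOf (Q.dimFil M l)) ∧
        moduleGrade A (Q.dimFil M l ⧸ (Q.dimFil M (l + 1)).submoduleOf (Q.dimFil M l)) = l)) :=
  proposition8p7_general K A Q hQ d hreg hdim M hM
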